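/- **Setting.** Let $u\in C^1(\mathbb R^2)$ have compact support, $0\le u\le 1$. For $k\in\mathbb N_0$ let $\Lambda^{(k)}=(2^{-k}\mathbb Z)^2$, and let $\omega=\{\omega^{(k)}_z: k\in\mathbb N_0,\ z\in\Lambda^{(k)}\}$ be independent real random variables (realized on the product space with the product measure $\mathbb P$) with zero expectation and $|\omega_z^{(k)}|\le C_{\rm ran}e^{-\rho k}$ almost surely for some $\rho>0$; assume that for each fixed $k$ the variables $\omega_z^{(k)}$, $z\in\Lambda^{(k)}$, are identically distributed. Let $B_0\in\mathbb R$, let $B_{\rm var}:\mathbb R^2\to\mathbb R$ be continuous and $\mathbb Z^2$-periodic, let $V:\mathbb R^2\to\mathbb R$ be differentiable and $\mathbb Z^2$-periodic, let $\mu\in(0,1]$, and put $$B_\omega(x)=B_0+B_{\rm var}(x)+\mu\sum_{k\ge0}\ \sum_{z\in\Lambda^{(k)}}\omega^{(k)}_z\,u\big(2^k(x-z)\big).$$ For a magnetic field $B$ let $\sigma(H(B))$ be the spectrum of the Friedrichs extension $H(A)$ of $(p-A)^2+V$, $p=-i\nabla$, on $L^2(\mathbb R^2)$, where $A$ is any continuous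 vector potential with $\nabla\times A=B$ in the sense of distributions. Let $$(\omega_+)^{(k)}_z=\operatorname{ess\,sup}\,[\omega^{(k)}_z]_+,\qquad (\omega_-)^{(k)}_z=-\operatorname{ess\,sup}\,[-\omega^{(k)}_z]_+,$$ where $[t]_+=\max(0,t)$, and, for $n\in\mathbb N_0$, $$E_n^-=\inf_x\,[(2n+1)B_{\omega_-}(x)+V(x)],\qquad E_n^+=\sup_x\,[(2n+1)B_{\omega_+}(x)+V(x)].$$ When $B_{\omega_\pm}$ is differentiable let $K_2^\pm=\|\nabla B_{\omega_\pm}\|_\infty+\|\nabla V\|_\infty$ and $K_3^\pm=\|\nabla B_{\omega_\pm}\|_\infty^2$. **Theorem.** For every $n\in\mathbb N_0$ there is a constant $C_{{\rm int},n}>0$, depending only on $n$, such that in every such setting the following holds. There is a set $\Sigma\subset\mathbb R$ with $\sigma(H(B_\omega))=\Sigma$ for $\mathbb P$-almost every $\omega$ (whatever the choice of the vector potential), and for each choice of the sign $\pm$: if $B_{\omega_\pm}$ is differentiable and $0<b_0\le B_{\omega_\pm}(x)$ for all $x\in\mathbb R^2$ with some constant $b_0$, then $$\operatorname{dist}(\Sigma,E_n^\pm)\le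 C_{{\rm int},n}\big[K_2^\pm b_0^{-1/2}+K_3^\pm b_0^{-2}\big],$$ where $\operatorname{dist}(\Sigma,E)=\inf_{\lambda\in\Sigma}|\lambda-E|$ (in particular $\Sigma\neq\emptyset$ when the right side is finite). -/

import Mathlib

open MeasureTheory Set Filter Topology
open scoped ENNReal ContDiff InnerProductSpace ComplexConjugate

noncomputable section

/-- The Euclidean plane. -/
abbrev Plane := EuclideanSpace ℝ (Fin 2)

/-- The complex Hilbert space `L²(ℝ²)`. -/
abbrev L2Plane := Lp ℂ 2 (volume : Measure Plane)

/-- The partial derivative in the direction of the `j`-th coordinate. -/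
def partialDeriv {F : Type*} [NormedAddCommGroup F] [NormedSpace ℝ F]
    (j : Fin 2) (f : Plane → F) (x : Plane) : F :=
  fderiv ℝ f x (EuclideanSpace.single j 1)

/-- Smooth complex functions of compact support. -/
def testSpace : Submodule ℂ (Plane → ℂ) where
  carrier := {φ | ContDiff ℝ ∞ φ ∧ HasCompactSupport φ}
  zero_mem' := ⟨contDiff_const, HasCompactSupport.zero⟩
  add_mem' := fun hf hg => ⟨hf.1.add hg.1, hf.2.add hg.2⟩
  smul_mem' := fun c _ hf => ⟨contDiff_const.smul hf.1, hf.2.smul_left (f := fun _ => c)⟩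

theorem testSpace_differentiable (φ : testSpace) : Differentiable ℝ (φ : Plane → ℂ) :=
  φ.2.1.differentiable (by simp)

theorem memLp_mul_test {w : Plane → ℂ} (hw : Continuous w) (φ : testSpace) :
    MemLp (fun x => w x * (φ : Plane → ℂ) x) 2 (volume : Measure Plane) :=
  (hw.mul φ.2.1.continuous).memLp_of_hasCompactSupport (HasCompactSupport.mul_left φ.2.2)

/-- Multiplication of test functions by a continuous function, with values in `L²`. -/
def mulTest (w : C(Plane, ℂ)) : testSpace →ₗ[ℂ] L2Plane where
  toFun φ := (memLp_mul_test w.continuous φ).toLp _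
  map_add' φ ψ := by
    rw [← MemLp.toLp_add]
    congr 1
    funext x
    simp [mul_add]
  map_smul' c φ := by
    rw [RingHom.id_apply, ← MemLp.toLp_const_smul]
    congr 1
    funext x
    simp [mul_left_comm]

/-- The embedding of the test functions into `L²`. -/
def testToL2 : testSpace →ₗ[ℂ] L2Plane := mulTest 1

/-- The component `(p_j - A_j) φ = -i ∂_j φ - A_j φ` of the magnetic momentum. -/
def magMomentum (A : Plane → Plane) (j : Fin 2) (φ : Plane → ℂ) (x : Plane) : ℂ :=
  -Complex.I * partialDeriv j φ x - (A x j : ℂ) * φ x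

theorem partialDeriv_test_continuous (j : Fin 2) (φ : testSpace) :
    Continuous (partialDeriv j (φ : Plane → ℂ)) :=
  (φ.2.1.continuous_fderiv (by simp)).clm_apply continuous_const

theorem partialDeriv_test_hasCompactSupport (j : Fin 2) (φ : testSpace) :
    HasCompactSupport (partialDeriv j (φ : Plane → ℂ)) :=
  φ.2.2.fderiv_apply ℝ _

theorem memLp_magMomentum (A : C(Plane, Plane)) (j : Fin 2) (φ : testSpace) :
    MemLp (magMomentum A j φ) 2 (volume : Measure Plane) := by
  have hA : Continuous fun x => ((A x j : ℝ) : ℂ) := by fun_prop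
  refine MemLp.sub ?_ (memLp_mul_test hA φ)
  exact ((partialDeriv_test_continuous j φ).memLp_of_hasCompactSupport
    (partialDeriv_test_hasCompactSupport j φ)).const_mul _

/-- The magnetic momentum as a linear map from the test functions to `L²`. -/
def momentumTest (A : C(Plane, Plane)) (j : Fin 2) : testSpace →ₗ[ℂ] L2Plane where
  toFun φ := (memLp_magMomentum A j φ).toLp _
  map_add' φ ψ := by
    rw [← MemLp.toLp_add]
    congr 1
    funext x
    have h : fderiv ℝ ((φ : Plane → ℂ) + (ψ : Plane → ℂ)) x = _ :=
      fderiv_add (testSpace_differentiable φ x) (testSpace_differentiable ψ x)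
    simp only [magMomentum, partialDeriv, Submodule.coe_add, Pi.add_apply, h,
      add_apply]
    ring
  map_smul' c φ := by
    rw [RingHom.id_apply, ← MemLp.toLp_const_smul]
    congr 1
    funext x
    have h : fderiv ℝ (c • (φ : Plane → ℂ)) x = _ :=
      fderiv_const_smul (testSpace_differentiable φ x) c
    simp only [magMomentum, partialDeriv, Submodule.coe_smul, Pi.smul_apply, h,
      smul_apply, smul_eq_mul]
    ring

/-- The closure in `L² × (L²)²` of the pairs `(φ, (p - A) φ)`, `φ` a test function. Its first
projection is the domain of the closure of the quadratic form `‖(p - A) φ‖² + ⟪φ, V φ⟫`,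
where `V` is bounded, and its elements are the pairs `(ψ, (p - A) ψ)`, `ψ` in that form domain. -/
def formClosure (A : C(Plane, Plane)) : Submodule ℂ (L2Plane × (Fin 2 → L2Plane)) :=
  (LinearMap.range (testToL2.prod (LinearMap.pi fun j => momentumTest A j))).topologicalClosure

/-- The continuous real function `V` as a complex-valued one. -/
def complexify (V : C(Plane, ℝ)) : C(Plane, ℂ) := ⟨fun x => (V x : ℂ), by fun_prop⟩

/-- The graph of the Friedrichs extension of `(p - A)² + V`: the pairs `(ψ, f)` such that `ψ` is
in the form domain and `⟪(p - A) χ, (p - A) ψ⟫ + ⟪χ, V ψ⟫ = ⟪χ, f⟫` for all test functions `χ`. -/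
def hamiltonianGraph (A : C(Plane, Plane)) (V : C(Plane, ℝ)) :
    Submodule ℂ (L2Plane × L2Plane) where
  carrier := {p | ∃ g : Fin 2 → L2Plane, (p.1, g) ∈ formClosure A ∧ ∀ χ : testSpace,
    ∑ j, ⟪momentumTest A j χ, g j⟫_ℂ + ⟪mulTest (complexify V) χ, p.1⟫_ℂ = ⟪testToL2 χ, p.2⟫_ℂ}
  zero_mem' := ⟨0, (formClosure A).zero_mem, by simp⟩
  add_mem' := by
    rintro p q ⟨g, hg, h⟩ ⟨g', hg', h'⟩
    refine ⟨g + g', (formClosure A).add_mem hg hg', fun χ => ?_⟩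
    simp only [Pi.add_apply, inner_add_right, Finset.sum_add_distrib, Prod.fst_add, Prod.snd_add,
      ← h χ, ← h' χ]
    ring
  smul_mem' := by
    rintro c p ⟨g, hg, h⟩
    refine ⟨c • g, (formClosure A).smul_mem c hg, fun χ => ?_⟩
    simp only [Pi.smul_apply, inner_smul_right, Prod.smul_fst, Prod.smul_snd, ← h χ, mul_add,
      Finset.mul_sum]

theorem mulTest_coeFn (w : C(Plane, ℂ)) (φ : testSpace) :
    mulTest w φ =ᵐ[volume] fun x => w x * (φ : Plane → ℂ) x :=
  (memLp_mul_test w.continuous φ).coeFn_toLp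

theorem momentumTest_coeFn (A : C(Plane, Plane)) (j : Fin 2) (φ : testSpace) :
    momentumTest A j φ =ᵐ[volume] magMomentum A j φ :=
  (memLp_magMomentum A j φ).coeFn_toLp

theorem eq_zero_of_inner_test {f : L2Plane} (h : ∀ χ, ⟪testToL2 χ, f⟫_ℂ = 0) : f = 0 := by
  refine (Lp.dense_hasCompactSupport_contDiff (F := ℂ) (μ := (volume : Measure Plane))
    (p := 2) (by simp)).eq_zero_of_inner_right ℂ ?_
  intro v ⟨g, hg, hc, hs⟩
  have : v = testToL2 ⟨g, hs, hc⟩ := by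
    refine Lp.ext (hg.trans ?_)
    filter_upwards [mulTest_coeFn 1 ⟨g, hs, hc⟩] with x hx
    rw [testToL2, hx]
    simp
  rw [this]
  exact h _

theorem inner_test_momentum (A : C(Plane, Plane)) (j : Fin 2) (χ φ : testSpace) :
    ⟪testToL2 χ, momentumTest A j φ⟫_ℂ = ⟪momentumTest A j χ, testToL2 φ⟫_ℂ := by
  have hχ := χ.2.1.continuous
  have hφ := φ.2.1.continuous
  have hA : Continuous fun x => ((A x j : ℝ) : ℂ) := by fun_prop
  have hdχ := partialDeriv_test_continuous j χ
  have hdφ := partialDeriv_test_continuous j φ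
  have hcs : HasCompactSupport fun x => conj ((χ : Plane → ℂ) x) :=
    χ.2.2.comp_left (g := fun z : ℂ => conj z) (by simp)
  have hcd (x : Plane) : fderiv ℝ (fun x => conj ((χ : Plane → ℂ) x)) x
      (EuclideanSpace.single j 1) = conj (partialDeriv j χ x) := by
    have := (Complex.conjCLE.toContinuousLinearMap.hasFDerivAt.comp x
      (testSpace_differentiable χ x).hasFDerivAt).fderiv
    rw [show (fun x => conj ((χ : Plane → ℂ) x)) =
      Complex.conjCLE.toContinuousLinearMap ∘ (χ : Plane → ℂ) from rfl, this]
    rfl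
  have hcc : Continuous fun x => conj ((χ : Plane → ℂ) x) := Complex.continuous_conj.comp hχ
  have hcdc : Continuous fun x => conj (partialDeriv j χ x) := Complex.continuous_conj.comp hdχ
  have i1 : Integrable (fun x => conj (partialDeriv j χ x) * (φ : Plane → ℂ) x) :=
    (hcdc.mul hφ).integrable_of_hasCompactSupport (φ.2.2.mul_left)
  have i2 : Integrable (fun x => conj ((χ : Plane → ℂ) x) * partialDeriv j φ x) :=
    (hcc.mul hdφ).integrable_of_hasCompactSupport hcs.mul_right
  have i3 : Integrable (fun x => conj ((χ : Plane → ℂ) x) * (φ : Plane → ℂ) x) :=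
    (hcc.mul hφ).integrable_of_hasCompactSupport hcs.mul_right
  have i4 : Integrable (fun x => ((A x j : ℝ) : ℂ) * (conj ((χ : Plane → ℂ) x) *
      (φ : Plane → ℂ) x)) :=
    (hA.mul (hcc.mul hφ)).integrable_of_hasCompactSupport (hcs.mul_right.mul_left)
  have ibp := integral_mul_fderiv_eq_neg_fderiv_mul_of_integrable (μ := (volume : Measure Plane))
    (f := fun x => conj ((χ : Plane → ℂ) x)) (g := (φ : Plane → ℂ))
    (v := EuclideanSpace.single j 1) (by simpa only [hcd] using i1) i2 i3
    (fun x _ => Complex.conjCLE.differentiableAt.comp x (testSpace_differentiable χ x))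
    (fun x _ => testSpace_differentiable φ x)
  simp only [hcd] at ibp
  rw [L2.inner_def, L2.inner_def]
  have e1 : ∫ x, ⟪testToL2 χ x, momentumTest A j φ x⟫_ℂ =
      ∫ x, (-Complex.I * (conj ((χ : Plane → ℂ) x) * partialDeriv j φ x) -
        ((A x j : ℝ) : ℂ) * (conj ((χ : Plane → ℂ) x) * (φ : Plane → ℂ) x)) := by
    refine integral_congr_ae ?_
    filter_upwards [mulTest_coeFn 1 χ, momentumTest_coeFn A j φ] with x h1 h2
    rw [testToL2, h1, h2]
    simp only [RCLike.inner_apply, magMomentum, ContinuousMap.one_apply, one_mul]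
    ring
  have e2 : ∫ x, ⟪momentumTest A j χ x, testToL2 φ x⟫_ℂ =
      ∫ x, (Complex.I * (conj (partialDeriv j χ x) * (φ : Plane → ℂ) x) -
        ((A x j : ℝ) : ℂ) * (conj ((χ : Plane → ℂ) x) * (φ : Plane → ℂ) x)) := by
    refine integral_congr_ae ?_
    filter_upwards [mulTest_coeFn 1 φ, momentumTest_coeFn A j χ] with x h1 h2
    rw [testToL2, h1, h2]
    simp only [RCLike.inner_apply, magMomentum, ContinuousMap.one_apply, one_mul, map_sub,
      map_mul, map_neg, Complex.conj_I, Complex.conj_ofReal]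
    ring
  rw [e1, e2, integral_sub (i2.const_mul _) i4, integral_sub (i1.const_mul _) i4,
    integral_const_mul, integral_const_mul]
  congr 1
  have : ∫ x, conj ((χ : Plane → ℂ) x) * partialDeriv j φ x = _ := ibp
  rw [this]
  ring

theorem inner_test_of_mem_formClosure (A : C(Plane, Plane)) {p : L2Plane × (Fin 2 → L2Plane)}
    (hp : p ∈ formClosure A) (j : Fin 2) (χ : testSpace) :
    ⟪testToL2 χ, p.2 j⟫_ℂ = ⟪momentumTest A j χ, p.1⟫_ℂ := by
  have hcl : IsClosed {p : L2Plane × (Fin 2 → L2Plane) |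
      ⟪testToL2 χ, p.2 j⟫_ℂ = ⟪momentumTest A j χ, p.1⟫_ℂ} :=
    isClosed_eq (by fun_prop) (by fun_prop)
  refine closure_minimal ?_ hcl hp
  rintro _ ⟨φ, rfl⟩
  exact inner_test_momentum A j χ φ

/-- `hamiltonianGraph A V` is the graph of an operator. -/
theorem hamiltonianGraph_functional (A : C(Plane, Plane)) (V : C(Plane, ℝ)) :
    ∀ p ∈ hamiltonianGraph A V, p.1 = 0 → p.2 = 0 := by
  rintro ⟨ψ, f⟩ ⟨g, hg, h⟩ (rfl : ψ = 0)
  have hg0 (j : Fin 2) : g j = 0 :=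
    eq_zero_of_inner_test fun χ => by simpa using inner_test_of_mem_formClosure A hg j χ
  exact eq_zero_of_inner_test fun χ => by simpa [hg0] using (h χ).symm

/-- The magnetic Schrödinger operator `H(A) = (p - A)² + V` on `L²(ℝ²)` (Friedrichs extension). -/
def hamiltonian (A : C(Plane, Plane)) (V : C(Plane, ℝ)) : L2Plane →ₗ.[ℂ] L2Plane :=
  (hamiltonianGraph A V).toLinearPMap

/-- The resolvent set of an unbounded operator: those `z` for which `T - z` is a bijection of the
domain of `T` onto the whole space with a bounded inverse. -/
def unboundedResolventSet {H : Type*} [NormedAddCommGroup H] [NormedSpace ℂ H]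
    (T : H →ₗ.[ℂ] H) : Set ℂ :=
  {z | ∃ R : H →L[ℂ] H,
    (∀ f, ∃ h : R f ∈ T.domain, T ⟨R f, h⟩ - z • R f = f) ∧
    ∀ ψ : T.domain, R (T ψ - z • (ψ : H)) = ψ}

/-- The real points of the spectrum (all of it, if `T` is self-adjoint). -/
def realSpectrum {H : Type*} [NormedAddCommGroup H] [NormedSpace ℂ H]
    (T : H →ₗ.[ℂ] H) : Set ℝ :=
  {E | (E : ℂ) ∉ unboundedResolventSet T}

/-- `∇ × A = ∂₁ A₂ - ∂₂ A₁ = B` in the sense of distributions. -/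
def IsVectorPotential (A : C(Plane, Plane)) (B : Plane → ℝ) : Prop :=
  ∀ φ : Plane → ℝ, ContDiff ℝ ∞ φ → HasCompactSupport φ →
    ∫ x, (A x 0 * partialDeriv 1 φ x - A x 1 * partialDeriv 0 φ x) = ∫ x, B x * φ x

/-- `σ(H(B)) = S`: the field `B` has a vector potential, and `σ(H(A)) = S` for every (continuous)
vector potential `A` of `B`. -/
def HasMagneticSpectrum (B : Plane → ℝ) (V : C(Plane, ℝ)) (S : Set ℝ) : Prop :=
  (∃ A, IsVectorPotential A B) ∧
    ∀ A, IsVectorPotential A B → realSpectrum (hamiltonian A V) = S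

/-- The point `2⁻ᵏ m` of the lattice `(2⁻ᵏ ℤ)²`. -/
def latticePoint (k : ℕ) (m : ℤ × ℤ) : Plane := !₂[(m.1 : ℝ) / 2 ^ k, (m.2 : ℝ) / 2 ^ k]

/-- `ℤ²`-periodicity. -/
def IsZ2Periodic (f : Plane → ℝ) : Prop :=
  ∀ (m : ℤ × ℤ) (x : Plane), f (x + !₂[(m.1 : ℝ), (m.2 : ℝ)]) = f x

/-- The pair `(k, m)` labels the lattice point `2⁻ᵏ m` of scale `k`. -/
abbrev ScaleIndex := ℕ × (ℤ × ℤ)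

/-- The data of the random magnetic field: the constant field `B0`, the variable part `Bvar`, the
coupling constant `μ`, the profile `u`, and the laws `ν (k, m)` of the independent, centred random
variables, bounded by `Cran * exp (-ρ k)`. -/
structure RandomFieldModel where
  B0 : ℝ
  Bvar : Plane → ℝ
  μ : ℝ
  u : Plane → ℝ
  Cran : ℝ
  ρ : ℝ
  ν : ScaleIndex → Measure ℝ
  Bvar_continuous : Continuous Bvar
  μ_pos : 0 < μ
  μ_le_one : μ ≤ 1
  u_contDiff : ContDiff ℝ 1 u
  u_hasCompactSupport : HasCompactSupport u
  u_nonneg : ∀ x, 0 ≤ u x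
  u_le_one : ∀ x, u x ≤ 1
  ρ_pos : 0 < ρ
  ν_prob : ∀ i, IsProbabilityMeasure (ν i)
  ν_mean : ∀ i, ∫ s, s ∂(ν i) = 0
  ν_bound : ∀ i, ∀ᵐ s ∂(ν i), |s| ≤ Cran * Real.exp (-ρ * i.1)

namespace RandomFieldModel

variable (M : RandomFieldModel)

/-- The product probability measure on the configurations. -/
def prob : Measure (ScaleIndex → ℝ) :=
  haveI := M.ν_prob
  Measure.infinitePi M.ν

/-- On each scale the random variables are identically distributed. -/
def IID : Prop := ∀ (k : ℕ) (m m' : ℤ × ℤ), M.ν (k, m) = M.ν (k, m')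

/-- The random part `∑ₖ ∑_z ω_z^(k) u(2ᵏ (x - z))`. -/
def randomPart (cfg : ScaleIndex → ℝ) (x : Plane) : ℝ :=
  ∑' k : ℕ, ∑' m : ℤ × ℤ, cfg (k, m) * M.u ((2 : ℝ) ^ k • (x - latticePoint k m))

/-- The magnetic field `B_ω = B0 + Bvar + μ B_ran^ω`. -/
def field (cfg : ScaleIndex → ℝ) (x : Plane) : ℝ :=
  M.B0 + M.Bvar x + M.μ * M.randomPart cfg x

/-- The maximal configuration `ω₊ = ess sup [ω]₊`. -/
def omegaPlus (i : ScaleIndex) : ℝ := essSup (fun s : ℝ => max 0 s) (M.ν i)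

/-- The minimal configuration `ω₋ = - ess sup [-ω]₊`. -/
def omegaMinus (i : ScaleIndex) : ℝ := -essSup (fun s : ℝ => max 0 (-s)) (M.ν i)

/-- `S` is the almost sure spectrum of `H(B_ω)`. -/
def IsAlmostSureSpectrum (V : C(Plane, ℝ)) (S : Set ℝ) : Prop :=
  ∀ᵐ cfg ∂M.prob, HasMagneticSpectrum (M.field cfg) V S

/-- `E_n⁺ = sup [(2n+1) B_{ω₊} + V]`. -/
def EPlus (V : C(Plane, ℝ)) (n : ℕ) : ℝ :=
  ⨆ x, ((2 * (n : ℝ) + 1) * M.field M.omegaPlus x + V x)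

/-- `E_n⁻ = inf [(2n+1) B_{ω₋} + V]`. -/
def EMinus (V : C(Plane, ℝ)) (n : ℕ) : ℝ :=
  ⨅ x, ((2 * (n : ℝ) + 1) * M.field M.omegaMinus x + V x)

end RandomFieldModel

/-- `‖∇f‖_∞`, as an extended real, for a differentiable function `f`. -/
def gradSup (f : Plane → ℝ) : ℝ≥0∞ := ⨆ x, ‖fderiv ℝ f x‖ₑ

/-- `K₂ = ‖∇B‖_∞ + ‖∇V‖_∞`. -/
def K2 (B V : Plane → ℝ) : ℝ≥0∞ := gradSup B + gradSup V

/-- `K₃ = ‖∇B‖_∞²`. -/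
def K3 (B : Plane → ℝ) : ℝ≥0∞ := gradSup B ^ 2

end

/-! The proof has a probabilistic half and a deterministic half.

Probabilistic half. The variables have mean zero, so each component of `omegaPlus` and `omegaMinus`
lies in the support of its law, and both configurations lie in the support of the product measure
(`omegaPlus_mem_support`, `omegaMinus_mem_support`). By independence, identical distribution on each
scale and the second Borel–Cantelli lemma, the `ℤ²`-translates of a typical configuration accumulate
at every configuration `η` of that support (`ae_forall_mem_support_exists_shift`). On bounded
configurations the field depends jointly continuously on configuration and position. Hence, after a
translation by a period of `V` and `Bvar`, the typical field is as close as desired to the field of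
`η` on any given ball. Local closeness of the fields gives local closeness of the vector potentials
up to a gauge. This carries compactly supported approximate eigenfunctions over, so the spectrum of
`η` is contained in the typical one (`realSpectrum_subset_of_field_approx`). A typical configuration
lies in the support itself, so two typical configurations have the same spectrum. This common set is
the almost sure spectrum, and it contains the spectra belonging to `omegaPlus` and `omegaMinus`.

Deterministic half. Fix a point `c`, put `b = B c`, and take as trial state the `n`-th Landau
function of the constant field `b` centred at `c`. It has width of order `b^(-1/2)`. The true vector
potential differs from the symmetric gauge of `b` by a quantity of order `‖∇B‖ ‖x - c‖²`, and `V`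
differs from `V c` by at most `‖∇V‖ ‖x - c‖`. Scaling the Gaussian moments bounds the relative error
by a multiple of `K₂ b^(-1/2) + K₃ b^(-2)`, which by self-adjointness bounds the distance of `(2n+1)
B c + V c` to the spectrum (`infEDist_landau_le`). As `c` varies, these levels have `E_n^±` in the
closure of their range, and the distance to a set is continuous.

Vector potentials are only continuous, so `(p - A)²` need not map test functions into `L²`. The
spectral theory is therefore carried out with forms: the Hamiltonian is studied through a bounded
self-adjoint operator on the Hilbert space of the form norm, and Weyl's criterion is stated on the
form core of test functions (`mem_realSpectrum_iff_quasimode`). -/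

noncomputable section

/-! ### Spectrum of a form-defined operator through a bounded operator on its form space. -/

section FormOperator

open ContinuousLinearMap

variable {X L : Type*} [NormedAddCommGroup X] [InnerProductSpace ℂ X] [CompleteSpace X]
  [NormedAddCommGroup L] [InnerProductSpace ℂ L] [CompleteSpace L]

/-- The operator on the form space `X` representing the form
`⟪x, y⟫ + ⟪J x, (W - E) J y⟫`. -/
def formOperator (J : X →L[ℂ] L) (W : L →L[ℂ] L) (E : ℝ) : X →L[ℂ] X :=
  1 + adjoint J ∘L (W - (E : ℂ) • 1) ∘L J

theorem formOperator_apply (J : X →L[ℂ] L) (W : L →L[ℂ] L) (E : ℝ) (x : X) :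
    formOperator J W E x = x + adjoint J (W (J x)) - (E : ℂ) • adjoint J (J x) := by
  simp [formOperator, add_sub_assoc]

/-- The unbounded operator `T` on `L` is the one defined by the closed form
`⟪x, y⟫ + ⟪J x, W J y⟫` on the form space `X`, embedded into `L` by `J`. -/
structure IsFormRealization (J : X →L[ℂ] L) (W : L →L[ℂ] L) (T : L →ₗ.[ℂ] L) : Prop where
  isSelfAdjoint : IsSelfAdjoint W
  injective : Function.Injective J
  adjoint_injective : Function.Injective (adjoint J)
  mem_graph : ∀ ψ f, (ψ, f) ∈ T.graph ↔ ∃ x, J x = ψ ∧ x + adjoint J (W (J x)) = adjoint J f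

theorem formOperator_isSelfAdjoint (J : X →L[ℂ] L) {W : L →L[ℂ] L} (hW : IsSelfAdjoint W)
    (E : ℝ) : IsSelfAdjoint (formOperator J W E) := by
  rw [isSelfAdjoint_iff']
  rw [isSelfAdjoint_iff'] at hW
  simp only [formOperator, map_add, adjoint_comp, adjoint_adjoint, map_sub, hW, map_smulₛₗ,
    Complex.conj_ofReal]
  simp only [← star_eq_adjoint, star_one]
  rfl

/-- The lower bound makes `S` injective with closed range. The orthogonal complement of the range is
the kernel of the adjoint, which is `S` itself, so the range is also dense. -/
theorem IsSelfAdjoint.isUnit_of_bounded_below {S : X →L[ℂ] X} (hS : IsSelfAdjoint S) {c : ℝ}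
    (hc : 0 < c) (h : ∀ x, c * ‖x‖ ≤ ‖S x‖) : IsUnit S := by
  have hanti : AntilipschitzWith (Real.toNNReal c)⁻¹ S := by
    refine S.antilipschitz_of_bound fun x => ?_
    rw [NNReal.coe_inv, Real.coe_toNNReal _ hc.le, inv_mul_eq_div, le_div_iff₀ hc, mul_comm]
    exact h x
  rw [isUnit_iff_bijective, bijective_iff_dense_range_and_antilipschitz]
  refine ⟨?_, _, hanti⟩
  rw [Submodule.topologicalClosure_eq_top_iff, orthogonal_range, isSelfAdjoint_iff'.1 hS]
  exact LinearMap.ker_eq_bot.2 hanti.injective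

variable {J : X →L[ℂ] L} {W : L →L[ℂ] L} {T : L →ₗ.[ℂ] L}

/-- `(T - E) J x = f`, in terms of the form operator. -/
theorem IsFormRealization.formOperator_eq_iff (h : IsFormRealization J W T) (E : ℝ) (x : X)
    (f : L) : formOperator J W E x = adjoint J f ↔
      ∃ hx : J x ∈ T.domain, T ⟨J x, hx⟩ - (E : ℂ) • J x = f := by
  have key : formOperator J W E x = adjoint J f ↔ (J x, f + (E : ℂ) • J x) ∈ T.graph := by
    rw [h.mem_graph, formOperator_apply]
    constructor
    · intro hx
      exact ⟨x, rfl, by rw [map_add, map_smul, ← hx]; abel⟩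
    · rintro ⟨y, hy, hy'⟩
      obtain rfl := h.injective hy
      rw [hy', map_add, map_smul]; abel
  rw [key, LinearPMap.mem_graph_iff]
  constructor
  · rintro ⟨y, hy, hy'⟩
    have hy : (y : L) = J x := hy
    have hm : J x ∈ T.domain := hy ▸ y.2
    refine ⟨hm, ?_⟩
    have : y = ⟨J x, hm⟩ := Subtype.ext hy
    rw [← this, hy']; simp
  · rintro ⟨hx, rfl⟩
    exact ⟨⟨J x, hx⟩, rfl, by simp⟩

/-- The resolvent is `J S⁻¹ J*`, where `S` is the form operator at `E`. -/
theorem IsFormRealization.mem_resolventSet_of_bounded_below (h : IsFormRealization J W T) {E : ℝ}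
    {c : ℝ} (hc : 0 < c) (hb : ∀ x, c * ‖x‖ ≤ ‖formOperator J W E x‖) :
    (E : ℂ) ∈ unboundedResolventSet T := by
  obtain ⟨u, hu⟩ := (formOperator_isSelfAdjoint J h.isSelfAdjoint E).isUnit_of_bounded_below hc hb
  have h1 (y : X) : formOperator J W E ((↑u⁻¹ : X →L[ℂ] X) y) = y := by
    rw [← hu]; exact congr($(u.mul_inv) y)
  have h2 (y : X) : (↑u⁻¹ : X →L[ℂ] X) (formOperator J W E y) = y := by
    rw [← hu]; exact congr($(u.inv_mul) y)
  refine ⟨J ∘L (↑u⁻¹ : X →L[ℂ] X) ∘L adjoint J, fun f => ?_, fun ψ => ?_⟩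
  · exact (h.formOperator_eq_iff E _ f).1 (h1 _)
  · obtain ⟨x, hx, -⟩ := (h.mem_graph _ _).1 (T.mem_graph ψ)
    have := (h.formOperator_eq_iff E x (T ψ - (E : ℂ) • (ψ : L))).2
      ⟨hx ▸ ψ.2, by congr 1; · congr 1; exact Subtype.ext hx
                    · rw [hx]⟩
    simp only [comp_apply, ← this, h2, hx]

/-- Write `S = 1 + J* Q J` and `g = S x`. Then `y = x - g` solves `S y = J* (-Q J g)`, whose right
side comes from `L`, so the resolvent gives `J y = -R Q J g`. Inserting this into `y = S y - J* Q J
y` bounds `y`, hence `x`, by a multiple of `g` in the stronger norm of the form space. -/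
theorem IsFormRealization.bounded_below_of_mem_resolventSet (h : IsFormRealization J W T) {E : ℝ}
    (hE : (E : ℂ) ∈ unboundedResolventSet T) :
    ∃ c > 0, ∀ x, c * ‖x‖ ≤ ‖formOperator J W E x‖ := by
  obtain ⟨R, -, hR⟩ := hE
  set Q : L →L[ℂ] L := W - (E : ℂ) • 1 with hQ
  have hF (y : X) : formOperator J W E y = y + adjoint J (Q (J y)) := rfl
  have hJ : ‖adjoint J‖ = ‖J‖ := (adjoint (𝕜 := ℂ) (E := X) (F := L)).norm_map J
  set K : ℝ := ‖J‖ * (‖Q‖ * (‖R‖ * (‖Q‖ * ‖J‖))) + ‖J‖ * (‖Q‖ * ‖J‖) with hK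
  have hK0 : 0 ≤ K := by positivity
  refine ⟨(K + 1)⁻¹, by positivity, fun x => ?_⟩
  set g := formOperator J W E x with hg
  set y := x - g with hy
  have hyeq : formOperator J W E y = adjoint J (-(Q (J g))) := by
    rw [hy, map_sub, ← hg, hF g, map_neg]; abel
  obtain ⟨hm, hm'⟩ := (h.formOperator_eq_iff E y _).1 hyeq
  have hJy : J y = R (-(Q (J g))) := by rw [← hm']; exact (hR ⟨J y, hm⟩).symm
  have hyy : y = adjoint J (-(Q (J g))) - adjoint J (Q (J y)) := by rw [← hyeq, hF]; abel
  have e1 : ‖Q (J g)‖ ≤ ‖Q‖ * ‖J‖ * ‖g‖ := by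
    rw [mul_assoc]; exact (Q.le_opNorm _).trans (by gcongr; exact J.le_opNorm _)
  have e2 : ‖J y‖ ≤ ‖R‖ * (‖Q‖ * ‖J‖ * ‖g‖) := by
    rw [hJy]; exact (R.le_opNorm _).trans (by rw [norm_neg]; gcongr)
  have e3 : ‖y‖ ≤ K * ‖g‖ := by
    have a1 : ‖adjoint J (-(Q (J g)))‖ ≤ ‖J‖ * (‖Q‖ * ‖J‖ * ‖g‖) := by
      refine ((adjoint J).le_opNorm _).trans ?_
      rw [norm_neg, hJ]; gcongr
    have a2 : ‖adjoint J (Q (J y))‖ ≤ ‖J‖ * (‖Q‖ * (‖R‖ * (‖Q‖ * ‖J‖ * ‖g‖))) := by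
      refine ((adjoint J).le_opNorm _).trans ?_
      rw [hJ]; gcongr
      exact (Q.le_opNorm _).trans (by gcongr)
    calc ‖y‖ = ‖adjoint J (-(Q (J g))) - adjoint J (Q (J y))‖ := by rw [← hyy]
      _ ≤ _ := norm_sub_le _ _
      _ ≤ _ := add_le_add a1 a2
      _ = K * ‖g‖ := by rw [hK]; ring
  have e4 : ‖x‖ ≤ (K + 1) * ‖g‖ := by
    have : x = y + g := by rw [hy]; abel
    calc ‖x‖ = ‖y + g‖ := by rw [← this]
      _ ≤ ‖y‖ + ‖g‖ := norm_add_le _ _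
      _ ≤ (K + 1) * ‖g‖ := by linarith
  rw [inv_mul_le_iff₀ (by positivity)]
  exact e4

theorem IsFormRealization.mem_realSpectrum_iff (h : IsFormRealization J W T) (E : ℝ) :
    E ∈ realSpectrum T ↔ ∀ ε > 0, ∃ x, ‖formOperator J W E x‖ < ε * ‖x‖ := by
  constructor
  · intro hE ε hε
    by_contra! hcon
    exact hE (h.mem_resolventSet_of_bounded_below hε hcon)
  · intro hE hres
    obtain ⟨c, hc, hb⟩ := h.bounded_below_of_mem_resolventSet hres
    obtain ⟨x, hx⟩ := hE c hc
    exact absurd hx (hb x).not_gt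

/-- An approximate eigenvector `(T - E) ψ = f` yields a point of the spectrum at distance at most
`‖f‖ / ‖ψ‖` from `E`. -/
theorem IsFormRealization.infEDist_le (h : IsFormRealization J W T) (E : ℝ) {x : X} {f : L}
    (hx : formOperator J W E x = adjoint J f) (hx0 : x ≠ 0) :
    Metric.infEDist E (realSpectrum T) ≤ ENNReal.ofReal (‖f‖ / ‖J x‖) := by
  by_cases hE : E ∈ realSpectrum T
  · rw [Metric.infEDist_zero_of_mem hE]; exact zero_le
  obtain ⟨R, hR1, hR2⟩ := not_not.1 hE
  have hJx : J x ≠ 0 := fun h0 => hx0 (h.injective (by rw [h0, map_zero]))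
  obtain ⟨hm, hm'⟩ := (h.formOperator_eq_iff E x f).1 hx
  have hRf : R f = J x := by rw [← hm']; exact hR2 ⟨J x, hm⟩
  -- Symmetry of `R` is inherited from the form operator: `R v` and `R w` are the images under `J`
  -- of the solutions `y`, `z` of `S y = J* v`, `S z = J* w`.
  have hsym : IsSelfAdjoint R := by
    rw [isSelfAdjoint_iff_isSymmetric]
    intro v w
    have hp (v : L) : ∃ y, J y = R v ∧ formOperator J W E y = adjoint J v := by
      obtain ⟨hv, hv'⟩ := hR1 v
      obtain ⟨y, hy, -⟩ := (h.mem_graph _ _).1 (T.mem_graph ⟨R v, hv⟩)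
      refine ⟨y, hy, (h.formOperator_eq_iff E y v).2 ?_⟩
      have hy : J y = R v := hy
      simp only [hy]
      exact ⟨hv, hv'⟩
    obtain ⟨y, hy, hy'⟩ := hp v
    obtain ⟨z, hz, hz'⟩ := hp w
    have hS := (formOperator_isSelfAdjoint J h.isSelfAdjoint E).isSymmetric y z
    calc ⟪R v, w⟫_ℂ = ⟪y, adjoint J w⟫_ℂ := by rw [adjoint_inner_right, hy]
      _ = ⟪adjoint J v, z⟫_ℂ := by rw [← hz', ← hy']; exact hS.symm
      _ = ⟪v, R w⟫_ℂ := by rw [adjoint_inner_left, hz]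
  have hRne : R ≠ 0 := fun h0 => hJx (by rw [← hRf, h0]; rfl)
  have : Nontrivial L := ⟨⟨J x, 0, hJx⟩⟩
  -- For the self-adjoint `R` the norm is the spectral radius, so some real spectral value `r` has
  -- `|r| = ‖R‖`. The point of the spectrum of `T` corresponding to it is `E + 1 / r`.
  obtain ⟨k, hk, hk'⟩ := spectrum.exists_nnnorm_eq_spectralRadius R
  rw [hsym.spectralRadius_eq_nnnorm] at hk'
  have hkn : ‖k‖ = ‖R‖ := by exact_mod_cast congr($(hk').toReal)
  have hk0 : k ≠ 0 := by rw [← norm_ne_zero_iff, hkn]; exact norm_ne_zero_iff.2 hRne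
  have hkre : k = (k.re : ℂ) := hsym.mem_spectrum_eq_re hk
  set r := k.re with hr
  have hr0 : r ≠ 0 := fun h0 => hk0 (by rw [hkre, h0]; simp)
  have hrn : |r| = ‖R‖ := by rw [← hkn, hkre]; simp
  have hmem : E + r⁻¹ ∈ realSpectrum T := by
    rintro ⟨R', h1, h2⟩
    refine hk ?_
    rw [hkre]
    have hrc : (r : ℂ) ≠ 0 := by exact_mod_cast hr0
    -- If `E + 1 / r` had a resolvent `R'`, the resolvent identity, in both orders, would make `r⁻¹
    -- (1 + r⁻¹ R')` a two-sided inverse of `r - R`.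
    have comm1 (v : L) : R v - R' v = -(r : ℂ)⁻¹ • R' (R v) := by
      obtain ⟨hv, hv'⟩ := hR1 v
      have := h2 ⟨R v, hv⟩
      have e : T ⟨R v, hv⟩ - ((E + r⁻¹ : ℝ) : ℂ) • R v = v - (r : ℂ)⁻¹ • R v := by
        push_cast
        linear_combination (norm := module) (1 : ℂ) • hv'
      simp only at this
      rw [e, map_sub, map_smul] at this
      linear_combination (norm := module) (-1 : ℂ) • this
    have comm2 (v : L) : R v - R' v = -(r : ℂ)⁻¹ • R (R' v) := by
      obtain ⟨hv, hv'⟩ := h1 v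
      have := hR2 ⟨R' v, hv⟩
      have e : T ⟨R' v, hv⟩ - (E : ℂ) • R' v = v + (r : ℂ)⁻¹ • R' v := by
        push_cast at hv'
        linear_combination (norm := module) (1 : ℂ) • hv'
      simp only at this
      rw [e, map_add, map_smul] at this
      linear_combination (norm := module) (1 : ℂ) • this
    let Q : L →L[ℂ] L := (r : ℂ)⁻¹ • (1 + (r : ℂ)⁻¹ • R')
    have a1 : (algebraMap ℂ (L →L[ℂ] L) r - R) * Q = 1 := by
      ext v
      rw [Algebra.algebraMap_eq_smul_one]
      change (r : ℂ) • ((r : ℂ)⁻¹ • (v + (r : ℂ)⁻¹ • R' v)) -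
        R ((r : ℂ)⁻¹ • (v + (r : ℂ)⁻¹ • R' v)) = v
      simp only [map_smul, map_add, smul_inv_smul₀ hrc]
      linear_combination (norm := module) (-(r : ℂ)⁻¹) • comm2 v
    have a2 : Q * (algebraMap ℂ (L →L[ℂ] L) r - R) = 1 := by
      ext v
      rw [Algebra.algebraMap_eq_smul_one]
      change (r : ℂ)⁻¹ • (((r : ℂ) • v - R v) + (r : ℂ)⁻¹ • R' ((r : ℂ) • v - R v)) = v
      simp only [map_smul, map_sub, smul_sub, smul_add, inv_smul_smul₀ hrc]
      linear_combination (norm := module) (-(r : ℂ)⁻¹) • comm1 v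
    exact (⟨⟨_, Q, a1, a2⟩, rfl⟩ : IsUnit (algebraMap ℂ (L →L[ℂ] L) r - R))
  refine (Metric.infEDist_le_edist_of_mem hmem).trans ?_
  rw [edist_dist, Real.dist_eq]
  refine ENNReal.ofReal_le_ofReal ?_
  rw [show E - (E + r⁻¹) = -r⁻¹ by ring, abs_neg, abs_inv, hrn]
  have hRpos : 0 < ‖R‖ := norm_pos_iff.2 hRne
  rw [inv_eq_one_div, div_le_div_iff₀ hRpos (norm_pos_iff.2 hJx), one_mul, mul_comm, ← hRf]
  exact R.le_opNorm f

end FormOperator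

/-! ### Closed forms given by their values on a core. -/

section FormCore

open ContinuousLinearMap

/-- A closed subspace of `L × Lⁿ` as a Hilbert space with the `ℓ²` norm of the product. -/
theorem exists_hilbert_structure {L : Type} [NormedAddCommGroup L] [InnerProductSpace ℂ L]
    [CompleteSpace L] {G : Submodule ℂ (L × (Fin 2 → L))} (hG : IsClosed (G : Set (L × (Fin 2 → L)))) :
    ∃ (X : Type) (_ : NormedAddCommGroup X) (_ : InnerProductSpace ℂ X) (_ : CompleteSpace X)
      (J : X →L[ℂ] L) (m : Fin 2 → X →L[ℂ] L),
      (∀ x y : X, ⟪x, y⟫_ℂ = ⟪J x, J y⟫_ℂ + ∑ j, ⟪m j x, m j y⟫_ℂ) ∧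
      ∀ p, p ∈ G ↔ ∃ x, (J x, fun j => m j x) = p := by
  let Y := WithLp 2 (L × PiLp 2 (fun _ : Fin 2 => L))
  let e : Y ≃L[ℂ] L × (Fin 2 → L) :=
    (WithLp.prodContinuousLinearEquiv 2 ℂ L (PiLp 2 (fun _ : Fin 2 => L))).trans
      ((ContinuousLinearEquiv.refl ℂ L).prodCongr
        (PiLp.continuousLinearEquiv 2 ℂ (fun _ : Fin 2 => L)))
  let K : Submodule ℂ Y := G.comap (e : Y →ₗ[ℂ] L × (Fin 2 → L))
  have hK : IsClosed (K : Set Y) := hG.preimage e.continuous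
  let eK : K →L[ℂ] L × (Fin 2 → L) := (e : Y →L[ℂ] L × (Fin 2 → L)) ∘L K.subtypeL
  refine ⟨K, inferInstance, inferInstance, hK.completeSpace_coe,
    ContinuousLinearMap.fst ℂ L (Fin 2 → L) ∘L eK,
    fun j => ContinuousLinearMap.proj (R := ℂ) (φ := fun _ : Fin 2 => L) j ∘L
      ContinuousLinearMap.snd ℂ L (Fin 2 → L) ∘L eK, fun x y => ?_, fun p => ⟨fun hp => ?_, ?_⟩⟩
  · have h1 := WithLp.prod_inner_apply (𝕜 := ℂ) (x : Y) (y : Y)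
    rw [PiLp.inner_apply] at h1
    exact h1
  · refine ⟨⟨e.symm p, ?_⟩, e.apply_symm_apply p⟩
    change e (e.symm p) ∈ G
    rwa [e.apply_symm_apply]
  · rintro ⟨x, rfl⟩
    exact x.2

variable {X L D : Type*} [NormedAddCommGroup X] [InnerProductSpace ℂ X]
  [NormedAddCommGroup L] [InnerProductSpace ℂ L] {J : X →L[ℂ] L} {m : Fin 2 → X →L[ℂ] L}

theorem norm_sq_of_inner_eq (hin : ∀ x y : X, ⟪x, y⟫_ℂ = ⟪J x, J y⟫_ℂ + ∑ j, ⟪m j x, m j y⟫_ℂ)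
    (x : X) : ‖x‖ ^ 2 = ‖J x‖ ^ 2 + ∑ j, ‖m j x‖ ^ 2 := by
  have h := hin x x
  simp only [inner_self_eq_norm_sq_to_K] at h
  exact_mod_cast h

theorem norm_le_of_inner_eq (hin : ∀ x y : X, ⟪x, y⟫_ℂ = ⟪J x, J y⟫_ℂ + ∑ j, ⟪m j x, m j y⟫_ℂ)
    (x : X) : ‖x‖ ≤ ‖J x‖ + ∑ j, ‖m j x‖ := by
  refine abs_le_of_sq_le_sq' ?_ (by positivity) |>.2
  rw [norm_sq_of_inner_eq hin, Fin.sum_univ_two, Fin.sum_univ_two]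
  have h1 := norm_nonneg (J x)
  have h2 := norm_nonneg (m 0 x)
  have h3 := norm_nonneg (m 1 x)
  nlinarith [mul_nonneg h1 h2, mul_nonneg h1 h3, mul_nonneg h2 h3]

theorem le_norm_of_inner_eq (hin : ∀ x y : X, ⟪x, y⟫_ℂ = ⟪J x, J y⟫_ℂ + ∑ j, ⟪m j x, m j y⟫_ℂ)
    (x : X) : ‖J x‖ + ∑ j, ‖m j x‖ ≤ 3 * ‖x‖ := by
  have h := norm_sq_of_inner_eq hin x
  rw [Fin.sum_univ_two] at h
  have h0 := norm_nonneg x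
  have h1 : ‖J x‖ ≤ ‖x‖ := abs_le_of_sq_le_sq' (by nlinarith) h0 |>.2
  have h2 : ‖m 0 x‖ ≤ ‖x‖ := abs_le_of_sq_le_sq' (by nlinarith) h0 |>.2
  have h3 : ‖m 1 x‖ ≤ ‖x‖ := abs_le_of_sq_le_sq' (by nlinarith) h0 |>.2
  rw [Fin.sum_univ_two]
  linarith

variable [CompleteSpace X] [CompleteSpace L]

/-- The inner product of the form space already contains `⟪J x, J y⟫`. Taking `W = P - 1` cancels it
and leaves the form with potential `P`. -/
theorem inner_formOperator_of_inner_eq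
    (hin : ∀ x y : X, ⟪x, y⟫_ℂ = ⟪J x, J y⟫_ℂ + ∑ j, ⟪m j x, m j y⟫_ℂ)
    (P : L →L[ℂ] L) (hP : IsSelfAdjoint P) (E : ℝ) (x y : X) :
    ⟪x, formOperator J (P - 1) E y⟫_ℂ =
      ∑ j, ⟪m j x, m j y⟫_ℂ + ⟪P (J x), J y⟫_ℂ - E * ⟪J x, J y⟫_ℂ := by
  rw [formOperator_apply, inner_sub_right, inner_add_right, inner_smul_right,
    adjoint_inner_right, adjoint_inner_right, hin]
  have := hP.isSymmetric (J x) (J y)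
  change ⟪P (J x), _⟫_ℂ = ⟪_, P (J y)⟫_ℂ at this
  rw [this]
  change _ + ⟪_, P (J y) - J y⟫_ℂ - _ = _
  rw [inner_sub_right]
  ring

theorem IsFormRealization.infEDist_le_of_mem_graph {W : L →L[ℂ] L} {T : L →ₗ.[ℂ] L}
    (h : IsFormRealization J W T) (E : ℝ) {ψ f : L} (hψ : ψ ≠ 0)
    (hmem : (ψ, (E : ℂ) • ψ + f) ∈ T.graph) :
    Metric.infEDist E (realSpectrum T) ≤ ENNReal.ofReal (‖f‖ / ‖ψ‖) := by
  obtain ⟨x, rfl, hx⟩ := (h.mem_graph _ _).1 hmem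
  refine h.infEDist_le E ?_ fun h0 => hψ (by rw [h0, map_zero])
  rw [formOperator_apply, hx, map_add, map_smul]
  abel

/-- Weyl's criterion in terms of a core of the form. -/
theorem IsFormRealization.mem_realSpectrum_iff_core {P : L →L[ℂ] L} {T : L →ₗ.[ℂ] L}
    (h : IsFormRealization J (P - 1) T) (hP : IsSelfAdjoint P)
    (hin : ∀ x y : X, ⟪x, y⟫_ℂ = ⟪J x, J y⟫_ℂ + ∑ j, ⟪m j x, m j y⟫_ℂ)
    {t : D → X} (ht : DenseRange t) (E : ℝ) :
    E ∈ realSpectrum T ↔ ∀ ε > 0, ∃ φ, 0 < ‖J (t φ)‖ + ∑ j, ‖m j (t φ)‖ ∧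
      ∀ χ, ‖∑ j, ⟪m j (t χ), m j (t φ)⟫_ℂ + ⟪P (J (t χ)), J (t φ)⟫_ℂ -
        E * ⟪J (t χ), J (t φ)⟫_ℂ‖ ≤
        ε * (‖J (t χ)‖ + ∑ j, ‖m j (t χ)‖) * (‖J (t φ)‖ + ∑ j, ‖m j (t φ)‖) := by
  rw [h.mem_realSpectrum_iff]
  simp only [← inner_formOperator_of_inner_eq hin P hP E]
  set S := formOperator J (P - 1) E with hS
  have hle := norm_le_of_inner_eq hin
  have hge := le_norm_of_inner_eq hin
  set N : X → ℝ := fun x => ‖J x‖ + ∑ j, ‖m j x‖ with hN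
  have hN0 (x : X) : 0 ≤ N x := (norm_nonneg x).trans (hle x)
  constructor
  · intro h ε hε
    -- The set of approximate eigenvectors is open, so a nonempty one meets the dense core.
    have hopen : IsOpen {x : X | ‖S x‖ < ε * ‖x‖} := isOpen_lt (by fun_prop) (by fun_prop)
    obtain ⟨φ, hφ⟩ := ht.exists_mem_open hopen (h ε hε)
    have hφ : ‖S (t φ)‖ < ε * ‖t φ‖ := hφ
    have hpos : 0 < ‖t φ‖ := pos_of_mul_pos_right ((norm_nonneg _).trans_lt hφ) hε.le
    refine ⟨φ, hpos.trans_le (hle _), fun χ => ?_⟩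
    calc _ ≤ ‖t χ‖ * ‖S (t φ)‖ := norm_inner_le_norm _ _
      _ ≤ N (t χ) * (ε * N (t φ)) := by
        refine mul_le_mul (hle _) (hφ.le.trans ?_) (norm_nonneg _) (hN0 _)
        exact mul_le_mul_of_nonneg_left (hle _) hε.le
      _ = _ := by ring
  · intro h ε hε
    -- Passing from the sum of the three norms to the Hilbert norm costs a factor `3` in each
    -- argument. The remaining factor `2` makes the final inequality strict.
    obtain ⟨φ, h0, hφ⟩ := h (ε / 18) (by positivity)
    have hpos : 0 < ‖t φ‖ := by linarith [hge (t φ)]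
    refine ⟨t φ, ?_⟩
    have hb (y : X) : ‖⟪y, S (t φ)⟫_ℂ‖ ≤ ε / 2 * ‖y‖ * ‖t φ‖ := by
      refine ht.induction_on y
        (isClosed_le (by fun_prop) (by fun_prop)) fun χ => ?_
      calc _ ≤ ε / 18 * N (t χ) * N (t φ) := hφ χ
        _ ≤ ε / 18 * (3 * ‖t χ‖) * (3 * ‖t φ‖) := by
          refine mul_le_mul ?_ (hge _) (hN0 _) (by positivity)
          exact mul_le_mul_of_nonneg_left (hge _) (by positivity)
        _ = _ := by ring
    -- The estimate, extended to all `y` by density, is tested at `y = S (t φ)`, which turns the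
    -- bound on the pairing into a bound on the norm.
    have h1 := hb (S (t φ))
    rw [inner_self_eq_norm_sq_to_K, norm_pow, RCLike.norm_ofReal, abs_norm] at h1
    rcases (norm_nonneg (S (t φ))).eq_or_lt with h2 | h2
    · rw [← h2]; positivity
    · have h3 : ‖S (t φ)‖ ≤ ε / 2 * ‖t φ‖ := by
        refine le_of_mul_le_mul_right ?_ h2
        linarith
      have := mul_pos hε hpos
      linarith

/-- The operator defined by the closure of a form on a core `D` is a form realization. -/
theorem exists_formRealization {L D : Type} [NormedAddCommGroup L] [InnerProductSpace ℂ L]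
    [CompleteSpace L] {G : Submodule ℂ (L × (Fin 2 → L))} {a : D → L} {p : Fin 2 → D → L}
    (hG : (G : Set (L × (Fin 2 → L))) = closure (range fun χ => (a χ, fun j => p j χ)))
    (hfun : ∀ x ∈ G, x.1 = 0 → x.2 = 0) (ha : ∀ f : L, (∀ χ, ⟪a χ, f⟫_ℂ = 0) → f = 0)
    {P : L →L[ℂ] L} (hP : IsSelfAdjoint P) {T : L →ₗ.[ℂ] L}
    (hT : ∀ ψ f, (ψ, f) ∈ T.graph ↔ ∃ g : Fin 2 → L, (ψ, g) ∈ G ∧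
      ∀ χ, ∑ j, ⟪p j χ, g j⟫_ℂ + ⟪P (a χ), ψ⟫_ℂ = ⟪a χ, f⟫_ℂ) :
    ∃ (X : Type) (_ : NormedAddCommGroup X) (_ : InnerProductSpace ℂ X) (_ : CompleteSpace X)
      (J : X →L[ℂ] L) (m : Fin 2 → X →L[ℂ] L) (t : D → X),
      (∀ x y : X, ⟪x, y⟫_ℂ = ⟪J x, J y⟫_ℂ + ∑ j, ⟪m j x, m j y⟫_ℂ) ∧ DenseRange t ∧
      (∀ χ, J (t χ) = a χ ∧ ∀ j, m j (t χ) = p j χ) ∧ IsFormRealization J (P - 1) T := by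
  obtain ⟨X, i1, i2, i3, J, m, hin, hmem⟩ :=
    exists_hilbert_structure (G := G) (by rw [hG]; exact isClosed_closure)
  have hmemX (x : X) : (J x, fun j => m j x) ∈ G := (hmem _).2 ⟨x, rfl⟩
  have hex (χ : D) : ∃ x, (J x, fun j => m j x) = (a χ, fun j => p j χ) := by
    rw [← hmem, ← SetLike.mem_coe, hG]
    exact subset_closure ⟨χ, rfl⟩
  choose t ht using hex
  have ht1 (χ : D) : J (t χ) = a χ := congr($(ht χ).1)
  have ht2 (χ : D) (j : Fin 2) : m j (t χ) = p j χ := congr($(ht χ).2 j)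
  -- Injectivity of `J` is closability of the form: in `G` the first component determines the other
  -- two.
  have hinj : Function.Injective J := by
    rw [injective_iff_map_eq_zero]
    intro x hx
    have h2 := hfun _ (hmemX x) hx
    have h3 : ∀ j, m j x = 0 := fun j => congr($h2 j)
    have := norm_sq_of_inner_eq hin x
    simpa [hx, h3] using this
  have hdense : DenseRange t := by
    intro x
    rw [Metric.mem_closure_range_iff]
    intro ε hε
    have hx : (J x, fun j => m j x) ∈ closure (range fun χ => (a χ, fun j => p j χ)) := by
      rw [← hG]; exact hmemX x
    obtain ⟨χ, hχ⟩ := Metric.mem_closure_range_iff.1 hx (ε / 3) (by positivity)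
    refine ⟨χ, ?_⟩
    rw [Prod.dist_eq, max_lt_iff] at hχ
    have h1 : ‖J (x - t χ)‖ < ε / 3 := by
      rw [map_sub, ht1, ← dist_eq_norm]; exact hχ.1
    have h2 (j : Fin 2) : ‖m j (x - t χ)‖ < ε / 3 := by
      rw [map_sub, ht2, ← dist_eq_norm]; exact (dist_le_pi_dist _ _ j).trans_lt hχ.2
    rw [dist_eq_norm]
    refine (norm_le_of_inner_eq hin _).trans_lt ?_
    rw [Fin.sum_univ_two]
    linarith [h2 0, h2 1]
  have hext {x y : X} (h : ∀ χ, ⟪t χ, x⟫_ℂ = ⟪t χ, y⟫_ℂ) : x = y := by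
    refine sub_eq_zero.1 (Dense.eq_zero_of_inner_right ℂ hdense ?_)
    rintro _ ⟨χ, rfl⟩
    rw [inner_sub_right, h, sub_self]
  have key (x : X) (χ : D) : ⟪t χ, x + adjoint J ((P - 1) (J x))⟫_ℂ =
      ∑ j, ⟪p j χ, m j x⟫_ℂ + ⟪P (a χ), J x⟫_ℂ := by
    have := inner_formOperator_of_inner_eq hin P hP 0 (t χ) x
    rw [formOperator_apply] at this
    simpa [ht1, ht2] using this
  refine ⟨X, i1, i2, i3, J, m, t, hin, hdense, fun χ => ⟨ht1 χ, ht2 χ⟩, ?_⟩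
  refine ⟨hP.sub (IsSelfAdjoint.one _), hinj, ?_, fun ψ f => ?_⟩
  · rw [injective_iff_map_eq_zero]
    intro f hf
    refine ha f fun χ => ?_
    rw [← ht1, ← adjoint_inner_right, hf, inner_zero_right]
  · rw [hT]
    constructor
    · rintro ⟨g, hg, h⟩
      obtain ⟨x, hx⟩ := (hmem _).1 hg
      have hx1 : J x = ψ := congr($hx.1)
      have hx2 (j : Fin 2) : m j x = g j := congr($hx.2 j)
      refine ⟨x, hx1, hext fun χ => ?_⟩
      rw [key, adjoint_inner_right, ht1, hx1, ← h χ]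
      simp only [hx2]
    · rintro ⟨x, rfl, h⟩
      refine ⟨fun j => m j x, hmemX x, fun χ => ?_⟩
      rw [← key, h, adjoint_inner_right, ht1]

end FormCore

/-! ### The magnetic Hamiltonian as a form realization, and quasimodes. -/

theorem memLp_mul_bounded (V : C(Plane, ℝ)) {C : ℝ} (hC : ∀ x, |V x| ≤ C) (f : L2Plane) :
    MemLp (fun x => (V x : ℂ) * f x) 2 (volume : Measure Plane) := by
  refine (Lp.memLp f).of_le_mul (c := C) ?_ (ae_of_all _ fun x => ?_)
  · exact (Complex.continuous_ofReal.comp V.continuous).aestronglyMeasurable.mul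
      (Lp.aestronglyMeasurable f)
  · rw [norm_mul, Complex.norm_real]
    exact mul_le_mul_of_nonneg_right (hC x) (norm_nonneg _)

/-- Multiplication by the bounded continuous function `V` on `L²`. -/
def potentialMul (V : C(Plane, ℝ)) {C : ℝ} (hC : ∀ x, |V x| ≤ C) : L2Plane →L[ℂ] L2Plane :=
  LinearMap.mkContinuous
    { toFun := fun f => (memLp_mul_bounded V hC f).toLp _
      map_add' := fun f g => by
        rw [← MemLp.toLp_add]
        refine MemLp.toLp_congr _ _ ?_
        filter_upwards [Lp.coeFn_add f g] with x hx
        change (V x : ℂ) * (f + g : L2Plane) x = V x * f x + V x * g x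
        rw [hx, Pi.add_apply, mul_add]
      map_smul' := fun c f => by
        rw [RingHom.id_apply, ← MemLp.toLp_const_smul]
        refine MemLp.toLp_congr _ _ ?_
        filter_upwards [Lp.coeFn_smul c f] with x hx
        change (V x : ℂ) * (c • f : L2Plane) x = c * (V x * f x)
        rw [hx, Pi.smul_apply, smul_eq_mul, mul_left_comm] } C
    (fun f => by
      refine Lp.norm_le_mul_norm_of_ae_le_mul ?_
      filter_upwards [(memLp_mul_bounded V hC f).coeFn_toLp] with x hx
      change ‖(memLp_mul_bounded V hC f).toLp _ x‖ ≤ _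
      rw [hx, norm_mul, Complex.norm_real]
      exact mul_le_mul_of_nonneg_right (hC x) (norm_nonneg _))

theorem potentialMul_coeFn (V : C(Plane, ℝ)) {C : ℝ} (hC : ∀ x, |V x| ≤ C) (f : L2Plane) :
    potentialMul V hC f =ᵐ[volume] fun x => (V x : ℂ) * f x :=
  (memLp_mul_bounded V hC f).coeFn_toLp

theorem potentialMul_test (V : C(Plane, ℝ)) {C : ℝ} (hC : ∀ x, |V x| ≤ C) (χ : testSpace) :
    potentialMul V hC (testToL2 χ) = mulTest (complexify V) χ := by
  refine Lp.ext ?_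
  filter_upwards [potentialMul_coeFn V hC (testToL2 χ), mulTest_coeFn 1 χ,
    mulTest_coeFn (complexify V) χ] with x h1 h2 h3
  rw [h1, h3, testToL2, h2]
  simp [complexify]

theorem potentialMul_isSelfAdjoint (V : C(Plane, ℝ)) {C : ℝ} (hC : ∀ x, |V x| ≤ C) :
    IsSelfAdjoint (potentialMul V hC) := by
  rw [ContinuousLinearMap.isSelfAdjoint_iff_isSymmetric]
  intro f g
  change ⟪potentialMul V hC f, g⟫_ℂ = ⟪f, potentialMul V hC g⟫_ℂ
  rw [L2.inner_def, L2.inner_def]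
  refine integral_congr_ae ?_
  filter_upwards [potentialMul_coeFn V hC f, potentialMul_coeFn V hC g] with x h1 h2
  rw [h1, h2]
  simp only [RCLike.inner_apply, map_mul, Complex.conj_ofReal]
  ring


/-- Closability comes from the symmetry of the magnetic momentum on test functions: if `ψ = 0`, then
its momentum is orthogonal to all test functions. -/
theorem exists_hamiltonian_formRealization (A : C(Plane, Plane)) (V : C(Plane, ℝ)) {C : ℝ}
    (hC : ∀ x, |V x| ≤ C) :
    ∃ (X : Type) (_ : NormedAddCommGroup X) (_ : InnerProductSpace ℂ X) (_ : CompleteSpace X)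
      (J : X →L[ℂ] L2Plane) (m : Fin 2 → X →L[ℂ] L2Plane) (t : testSpace → X),
      (∀ x y : X, ⟪x, y⟫_ℂ = ⟪J x, J y⟫_ℂ + ∑ j, ⟪m j x, m j y⟫_ℂ) ∧ DenseRange t ∧
      (∀ χ, J (t χ) = testToL2 χ ∧ ∀ j, m j (t χ) = momentumTest A j χ) ∧
      IsFormRealization J (potentialMul V hC - 1) (hamiltonian A V) := by
  have hgr : (hamiltonian A V).graph = hamiltonianGraph A V :=
    Submodule.toLinearPMap_graph_eq _ (hamiltonianGraph_functional A V)
  refine exists_formRealization (G := formClosure A) (a := testToL2)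
    (p := fun j => momentumTest A j) rfl ?_ (fun f => eq_zero_of_inner_test)
    (potentialMul_isSelfAdjoint V hC) ?_
  · rintro ⟨ψ, g⟩ hg (rfl : ψ = 0)
    funext j
    exact eq_zero_of_inner_test fun χ => by simpa using inner_test_of_mem_formClosure A hg j χ
  · intro ψ f
    rw [hgr]
    simp only [potentialMul_test]
    rfl

/-- The graph norm of `p - A` on test functions. -/
def formNorm (A : C(Plane, Plane)) (φ : testSpace) : ℝ :=
  ‖testToL2 φ‖ + ∑ j, ‖momentumTest A j φ‖

/-- The form of `H(A) - E` on test functions. -/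
def formPairing (A : C(Plane, Plane)) (V : C(Plane, ℝ)) (E : ℝ) (χ φ : testSpace) : ℂ :=
  ∑ j, ⟪momentumTest A j χ, momentumTest A j φ⟫_ℂ +
    ⟪mulTest (complexify V) χ, testToL2 φ⟫_ℂ - E * ⟪testToL2 χ, testToL2 φ⟫_ℂ

/-- `φ` is an `ε`-approximate eigenvector of `H(A)` at the energy `E`, in the sense of forms. -/
def IsQuasimode (A : C(Plane, Plane)) (V : C(Plane, ℝ)) (E ε : ℝ) (φ : testSpace) : Prop :=
  0 < formNorm A φ ∧ ∀ χ, ‖formPairing A V E χ φ‖ ≤ ε * formNorm A χ * formNorm A φ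

theorem formNorm_nonneg (A : C(Plane, Plane)) (φ : testSpace) : 0 ≤ formNorm A φ := by
  unfold formNorm; positivity

/-- Weyl's criterion in the sense of forms. -/
theorem mem_realSpectrum_iff_quasimode (A : C(Plane, Plane)) (V : C(Plane, ℝ)) {C : ℝ}
    (hC : ∀ x, |V x| ≤ C) (E : ℝ) :
    E ∈ realSpectrum (hamiltonian A V) ↔ ∀ ε > 0, ∃ φ, IsQuasimode A V E ε φ := by
  obtain ⟨X, _, _, _, J, m, t, hin, hd, ht, h⟩ := exists_hamiltonian_formRealization A V hC
  have := h.mem_realSpectrum_iff_core (potentialMul_isSelfAdjoint V hC) hin hd E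
  simp only [fun χ => (ht χ).1, fun χ => (ht χ).2, potentialMul_test] at this
  exact this

/-- A weak solution of `(H(A) - E) ψ = f` yields a point of the spectrum at distance at most
`‖f‖ / ‖ψ‖` from `E`. -/
theorem infEDist_realSpectrum_le (A : C(Plane, Plane)) (V : C(Plane, ℝ)) {C : ℝ}
    (hC : ∀ x, |V x| ≤ C) (E : ℝ) {ψ f : L2Plane} {g : Fin 2 → L2Plane}
    (hg : (ψ, g) ∈ formClosure A) (hψ : ψ ≠ 0)
    (h : ∀ χ : testSpace, ∑ j, ⟪momentumTest A j χ, g j⟫_ℂ + ⟪mulTest (complexify V) χ, ψ⟫_ℂ =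
      ⟪testToL2 χ, (E : ℂ) • ψ + f⟫_ℂ) :
    Metric.infEDist E (realSpectrum (hamiltonian A V)) ≤ ENNReal.ofReal (‖f‖ / ‖ψ‖) := by
  obtain ⟨X, _, _, _, J, m, t, -, -, -, hreal⟩ := exists_hamiltonian_formRealization A V hC
  have hmem : (ψ, (E : ℂ) • ψ + f) ∈ (hamiltonian A V).graph := by
    rw [hamiltonian, Submodule.toLinearPMap_graph_eq _ (hamiltonianGraph_functional A V)]
    exact ⟨g, hg, h⟩
  exact hreal.infEDist_le_of_mem_graph E hψ hmem

/-! ### Cutoffs and local stability of quasimodes. -/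

/-- A smooth cutoff at scale `R`, equal to `1` on the ball of radius `R` and to `0` off the ball of
radius `2 R`. -/
def cutoff (R : ℝ) (x : Plane) : ℝ :=
  (⟨1, 2, one_pos, one_lt_two⟩ : ContDiffBump (0 : Plane)) (R⁻¹ • x)

theorem cutoff_contDiff (R : ℝ) : ContDiff ℝ ∞ (cutoff R) :=
  (ContDiffBump.contDiff _).comp (contDiff_const_smul R⁻¹)

theorem cutoff_differentiable (R : ℝ) : Differentiable ℝ (cutoff R) :=
  (cutoff_contDiff R).differentiable (by simp)

theorem cutoff_nonneg (R : ℝ) (x : Plane) : 0 ≤ cutoff R x := ContDiffBump.nonneg _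

theorem cutoff_le_one (R : ℝ) (x : Plane) : cutoff R x ≤ 1 := ContDiffBump.le_one _

theorem cutoff_eq_one {R : ℝ} (hR : 0 < R) {x : Plane} (hx : ‖x‖ ≤ R) : cutoff R x = 1 := by
  refine ContDiffBump.one_of_mem_closedBall _ ?_
  rw [mem_closedBall_zero_iff, norm_smul, norm_inv, Real.norm_of_nonneg hR.le]
  exact inv_mul_le_one_of_le₀ hx hR.le

theorem cutoff_eq_zero {R : ℝ} (hR : 0 < R) {x : Plane} (hx : 2 * R ≤ ‖x‖) : cutoff R x = 0 := by
  refine ContDiffBump.zero_of_le_dist _ ?_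
  rw [dist_zero_right, norm_smul, norm_inv, Real.norm_of_nonneg hR.le]
  change 2 ≤ _
  rw [inv_mul_eq_div, le_div_iff₀ hR]
  exact hx

theorem cutoff_hasCompactSupport {R : ℝ} (hR : 0 < R) : HasCompactSupport (cutoff R) := by
  refine HasCompactSupport.intro (isCompact_closedBall (0 : Plane) (2 * R)) fun x hx => ?_
  rw [mem_closedBall_zero_iff, not_le] at hx
  exact cutoff_eq_zero hR hx.le

theorem exists_partialDeriv_cutoff_bound :
    ∃ C : ℝ, 0 < C ∧ ∀ R : ℝ, 0 < R → ∀ (j : Fin 2) (x : Plane),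
      |partialDeriv j (cutoff R) x| ≤ C / R := by
  let b : ContDiffBump (0 : Plane) := ⟨1, 2, one_pos, one_lt_two⟩
  have hb : ContDiff ℝ ∞ b := b.contDiff
  obtain ⟨C, hC⟩ := (b.hasCompactSupport.fderiv ℝ).exists_bound_of_continuous
    (hb.continuous_fderiv (by simp))
  have hC0 : 0 ≤ C := (norm_nonneg _).trans (hC 0)
  refine ⟨C + 1, by positivity, fun R hR j x => ?_⟩
  have hd : partialDeriv j (cutoff R) x = R⁻¹ * fderiv ℝ b (R⁻¹ • x) (EuclideanSpace.single j 1) := by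
    have h1 : HasFDerivAt b (fderiv ℝ b (R⁻¹ • x)) (R⁻¹ • x) :=
      ((hb.differentiable (by simp)) _).hasFDerivAt
    have h2 : HasFDerivAt (fun y : Plane => R⁻¹ • y) (R⁻¹ • ContinuousLinearMap.id ℝ Plane) x :=
      (hasFDerivAt_id x).const_smul R⁻¹
    have h3 : HasFDerivAt (cutoff R) _ x := h1.comp x h2
    rw [partialDeriv, h3.fderiv]
    simp
  rw [hd, abs_mul, abs_inv, abs_of_pos hR, inv_mul_eq_div]
  gcongr
  refine ((fderiv ℝ b (R⁻¹ • x)).le_opNorm _).trans ?_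
  rw [show ‖(EuclideanSpace.single j 1 : Plane)‖ = 1 by simp, mul_one]
  exact (hC _).trans (by linarith)

/-- The product of a smooth function with the cutoff at scale `R`. -/
def cutTest {R : ℝ} (hR : 0 < R) {f : Plane → ℂ} (hf : ContDiff ℝ ∞ f) : testSpace :=
  ⟨fun x => (cutoff R x : ℂ) * f x,
    (Complex.ofRealCLM.contDiff.comp (cutoff_contDiff R)).mul hf,
    ((cutoff_hasCompactSupport hR).comp_left (g := fun t : ℝ => (t : ℂ)) (by simp)).mul_right⟩

theorem cutTest_apply {R : ℝ} (hR : 0 < R) {f : Plane → ℂ} (hf : ContDiff ℝ ∞ f) (x : Plane) :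
    (cutTest hR hf : Plane → ℂ) x = (cutoff R x : ℂ) * f x := rfl

/-- Leibniz rule: the commutator of `p - A` with the cutoff is `-i` times the gradient of the
cutoff, of order `1 / R` and independent of `A`. -/
theorem magMomentum_cutTest (A : Plane → Plane) (j : Fin 2) {R : ℝ} (hR : 0 < R) {f : Plane → ℂ}
    (hf : ContDiff ℝ ∞ f) (x : Plane) :
    magMomentum A j (cutTest hR hf) x = (cutoff R x : ℂ) * magMomentum A j f x -
      Complex.I * ((partialDeriv j (cutoff R) x : ℝ) : ℂ) * f x := by
  have h1 : HasFDerivAt (fun x => (cutoff R x : ℂ))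
      (Complex.ofRealCLM ∘L fderiv ℝ (cutoff R) x) x :=
    Complex.ofRealCLM.hasFDerivAt.comp x (cutoff_differentiable R x).hasFDerivAt
  have h2 : HasFDerivAt f (fderiv ℝ f x) x := (hf.differentiable (by simp) x).hasFDerivAt
  have h3 : HasFDerivAt (cutTest hR hf : Plane → ℂ) _ x := h1.mul h2
  simp only [magMomentum, partialDeriv, h3.fderiv, cutTest_apply]
  simp only [add_apply, smul_apply, smul_eq_mul,
    ContinuousLinearMap.comp_apply, Complex.ofRealCLM_apply]
  ring

theorem norm_Lp_le_add {f g h : L2Plane} {c : ℝ} (hc : 0 ≤ c)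
    (hle : ∀ᵐ x, ‖f x‖ ≤ ‖g x‖ + c * ‖h x‖) : ‖f‖ ≤ ‖g‖ + c * ‖h‖ := by
  have hg := (Lp.memLp g).norm
  have hh := (Lp.memLp h).norm.const_smul c
  have e : ‖(hg.add hh).toLp _‖ ≤ ‖g‖ + c * ‖h‖ := by
    rw [MemLp.toLp_add hg hh]
    refine (norm_add_le _ _).trans (le_of_eq ?_)
    rw [Lp.norm_toLp, Lp.norm_toLp, eLpNorm_norm, eLpNorm_const_smul, eLpNorm_norm,
      ENNReal.toReal_mul, Lp.norm_def, Lp.norm_def]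
    simp [abs_of_nonneg hc]
  refine le_trans ?_ e
  refine Lp.norm_le_norm_of_ae_le ?_
  filter_upwards [hle, (hg.add hh).coeFn_toLp] with x h1 h2
  rw [h2]
  exact h1.trans (le_abs_self _)

theorem norm_cutTest_le {R : ℝ} (hR : 0 < R) (χ : testSpace) :
    ‖testToL2 (cutTest hR χ.2.1)‖ ≤ ‖testToL2 χ‖ := by
  refine Lp.norm_le_norm_of_ae_le ?_
  filter_upwards [mulTest_coeFn 1 χ, mulTest_coeFn 1 (cutTest hR χ.2.1)] with x h1 h2
  rw [testToL2, h1, h2, cutTest_apply]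
  simp only [ContinuousMap.one_apply, one_mul, norm_mul, Complex.norm_real, Real.norm_eq_abs,
    abs_of_nonneg (cutoff_nonneg R x)]
  exact mul_le_of_le_one_left (norm_nonneg _) (cutoff_le_one R x)

theorem norm_momentumTest_cutTest_le {C : ℝ} (hC0 : 0 < C)
    (hC : ∀ R : ℝ, 0 < R → ∀ (j : Fin 2) (x : Plane), |partialDeriv j (cutoff R) x| ≤ C / R)
    (A : C(Plane, Plane)) {R : ℝ} (hR : 0 < R) (χ : testSpace) (j : Fin 2) :
    ‖momentumTest A j (cutTest hR χ.2.1)‖ ≤ ‖momentumTest A j χ‖ + C / R * ‖testToL2 χ‖ := by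
  refine norm_Lp_le_add (by positivity) ?_
  filter_upwards [mulTest_coeFn 1 χ, momentumTest_coeFn A j χ,
    momentumTest_coeFn A j (cutTest hR χ.2.1)] with x h1 h2 h3
  rw [testToL2, h1, h2, h3, magMomentum_cutTest]
  refine (norm_sub_le _ _).trans (add_le_add ?_ ?_)
  · rw [norm_mul, Complex.norm_real, Real.norm_of_nonneg (cutoff_nonneg R x)]
    exact mul_le_of_le_one_left (norm_nonneg _) (cutoff_le_one R x)
  · simp only [norm_mul, Complex.norm_I, Complex.norm_real, one_mul, ContinuousMap.one_apply,
      Real.norm_eq_abs]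
    exact mul_le_mul_of_nonneg_right (hC R hR j x) (norm_nonneg _)

theorem magMomentum_eq_zero_of_notMem (A : Plane → Plane) (j : Fin 2) {f : Plane → ℂ} {x : Plane}
    (hx : x ∉ tsupport f) : magMomentum A j f x = 0 := by
  have h1 : f x = 0 := image_eq_zero_of_notMem_tsupport hx
  have h2 : fderiv ℝ f x = 0 := image_eq_zero_of_notMem_tsupport fun h =>
    hx (tsupport_fderiv_subset ℝ h)
  simp [magMomentum, partialDeriv, h1, h2]

/-- The form is local and the cutoff equals `1` near the support of `φ`. Hence only `χ` supported in
a fixed ball have to be tested, although a quasimode is required to work against all test functions.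
-/
theorem formPairing_cutTest (A : C(Plane, Plane)) (V : C(Plane, ℝ)) (E : ℝ) {R : ℝ} (hR : 0 < R)
    (χ φ : testSpace) (hφ : tsupport (φ : Plane → ℂ) ⊆ Metric.ball 0 R) :
    formPairing A V E (cutTest hR χ.2.1) φ = formPairing A V E χ φ := by
  have hone {x : Plane} (hx : x ∈ tsupport (φ : Plane → ℂ)) :
      (cutTest hR χ.2.1 : Plane → ℂ) =ᶠ[𝓝 x] χ := by
    filter_upwards [Metric.isOpen_ball.mem_nhds (hφ hx)] with y hy
    rw [mem_ball_zero_iff] at hy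
    rw [cutTest_apply, cutoff_eq_one hR hy.le]
    simp
  have hmul (w : C(Plane, ℂ)) : ⟪mulTest w (cutTest hR χ.2.1), testToL2 φ⟫_ℂ =
      ⟪mulTest w χ, testToL2 φ⟫_ℂ := by
    rw [L2.inner_def, L2.inner_def]
    refine integral_congr_ae ?_
    filter_upwards [mulTest_coeFn w χ, mulTest_coeFn w (cutTest hR χ.2.1), mulTest_coeFn 1 φ]
      with x h1 h2 h3
    rw [testToL2, h1, h2, h3]
    by_cases hx : x ∈ tsupport (φ : Plane → ℂ)
    · rw [(hone hx).eq_of_nhds]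
    · simp [image_eq_zero_of_notMem_tsupport hx]
  have hmom (j : Fin 2) : ⟪momentumTest A j (cutTest hR χ.2.1), momentumTest A j φ⟫_ℂ =
      ⟪momentumTest A j χ, momentumTest A j φ⟫_ℂ := by
    rw [L2.inner_def, L2.inner_def]
    refine integral_congr_ae ?_
    filter_upwards [momentumTest_coeFn A j χ, momentumTest_coeFn A j (cutTest hR χ.2.1),
      momentumTest_coeFn A j φ] with x h1 h2 h3
    rw [h1, h2, h3]
    by_cases hx : x ∈ tsupport (φ : Plane → ℂ)
    · simp only [magMomentum, partialDeriv, (hone hx).eq_of_nhds, (hone hx).fderiv_eq]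
    · simp [magMomentum_eq_zero_of_notMem A j hx]
  have hone' : ⟪testToL2 (cutTest hR χ.2.1), testToL2 φ⟫_ℂ = ⟪testToL2 χ, testToL2 φ⟫_ℂ := hmul 1
  simp only [formPairing, hmom, hmul, hone']

/-- The difference of the `j`-th components of two vector fields. -/
def componentDiff (A A' : C(Plane, Plane)) (j : Fin 2) : C(Plane, ℂ) :=
  ⟨fun x => ((A' x j - A x j : ℝ) : ℂ), by fun_prop⟩

theorem momentumTest_sub (A A' : C(Plane, Plane)) (j : Fin 2) (φ : testSpace) :
    momentumTest A' j φ = momentumTest A j φ - mulTest (componentDiff A A' j) φ := by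
  refine Lp.ext ?_
  filter_upwards [momentumTest_coeFn A j φ, momentumTest_coeFn A' j φ,
    mulTest_coeFn (componentDiff A A' j) φ,
    Lp.coeFn_sub (momentumTest A j φ) (mulTest (componentDiff A A' j) φ)] with x h1 h2 h3 h4
  rw [h4, Pi.sub_apply, h1, h2, h3]
  simp only [magMomentum, componentDiff, ContinuousMap.coe_mk]
  push_cast
  ring

theorem norm_mulTest_le (w : C(Plane, ℂ)) (φ : testSpace) {δ : ℝ}
    (h : ∀ x, (φ : Plane → ℂ) x ≠ 0 → ‖w x‖ ≤ δ) : ‖mulTest w φ‖ ≤ δ * ‖testToL2 φ‖ := by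
  refine Lp.norm_le_mul_norm_of_ae_le_mul ?_
  filter_upwards [mulTest_coeFn w φ, mulTest_coeFn 1 φ] with x h1 h2
  rw [testToL2, h1, h2]
  by_cases hx : (φ : Plane → ℂ) x = 0
  · simp [hx]
  · simp only [norm_mul, ContinuousMap.one_apply, one_mul]
    exact mul_le_mul_of_nonneg_right (h x hx) (norm_nonneg _)

theorem formNorm_le_of_close {A A' : C(Plane, Plane)} {δ : ℝ} (hδ1 : δ ≤ 1) (φ : testSpace)
    (h : ∀ x, (φ : Plane → ℂ) x ≠ 0 → ∀ j, |A' x j - A x j| ≤ δ) :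
    formNorm A φ ≤ 3 * formNorm A' φ := by
  have hj (j : Fin 2) : ‖momentumTest A j φ‖ ≤ ‖momentumTest A' j φ‖ + ‖testToL2 φ‖ := by
    have e : momentumTest A j φ = momentumTest A' j φ + mulTest (componentDiff A A' j) φ := by
      rw [momentumTest_sub A A']; abel
    rw [e]
    refine (norm_add_le _ _).trans (add_le_add le_rfl ?_)
    have := norm_mulTest_le (componentDiff A A' j) φ (δ := 1) fun x hx => by
      simp only [componentDiff, ContinuousMap.coe_mk, Complex.norm_real]
      exact (h x hx j).trans hδ1
    simpa using this
  rw [formNorm, formNorm, Fin.sum_univ_two, Fin.sum_univ_two]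
  have h0 := hj 0
  have h1 := hj 1
  have := norm_nonneg (momentumTest A' 0 φ)
  have := norm_nonneg (momentumTest A' 1 φ)
  linarith

/-- With `c`, `d` the products of the component difference with `χ`, `φ`, expanding `⟪p - c, q - d⟫
- ⟪p, q⟫` leaves terms that each contain `c` or `d`, hence a factor `δ`. The term `⟪c, d⟫` is of
second order, and `δ ≤ 1` absorbs the extra factor. -/
theorem norm_formPairing_sub_le {A A' : C(Plane, Plane)} (V : C(Plane, ℝ)) (E : ℝ) {δ : ℝ}
    (hδ0 : 0 ≤ δ) (hδ1 : δ ≤ 1) (χ φ : testSpace)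
    (hχ : ∀ x, (χ : Plane → ℂ) x ≠ 0 → ∀ j, |A' x j - A x j| ≤ δ)
    (hφ : ∀ x, (φ : Plane → ℂ) x ≠ 0 → ∀ j, |A' x j - A x j| ≤ δ) :
    ‖formPairing A' V E χ φ - formPairing A V E χ φ‖ ≤ 2 * δ * formNorm A χ * formNorm A φ := by
  have hj (j : Fin 2) : ‖⟪momentumTest A' j χ, momentumTest A' j φ⟫_ℂ -
      ⟪momentumTest A j χ, momentumTest A j φ⟫_ℂ‖ ≤
      δ * (‖momentumTest A j χ‖ * ‖testToL2 φ‖ + ‖testToL2 χ‖ * ‖momentumTest A j φ‖ +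
        ‖testToL2 χ‖ * ‖testToL2 φ‖) := by
    have d1 := norm_mulTest_le (componentDiff A A' j) χ (δ := δ) fun x hx => by
      simp only [componentDiff, ContinuousMap.coe_mk, Complex.norm_real]
      exact hχ x hx j
    have d2 := norm_mulTest_le (componentDiff A A' j) φ (δ := δ) fun x hx => by
      simp only [componentDiff, ContinuousMap.coe_mk, Complex.norm_real]
      exact hφ x hx j
    rw [momentumTest_sub A A' j χ, momentumTest_sub A A' j φ]
    set p := momentumTest A j χ
    set q := momentumTest A j φ
    set c := mulTest (componentDiff A A' j) χ
    set d := mulTest (componentDiff A A' j) φ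
    have e : ⟪p - c, q - d⟫_ℂ - ⟪p, q⟫_ℂ = ⟪c, d⟫_ℂ - ⟪p, d⟫_ℂ - ⟪c, q⟫_ℂ := by
      rw [inner_sub_left, inner_sub_right, inner_sub_right]; ring
    rw [e]
    have n1 : ‖⟪c, d⟫_ℂ‖ ≤ δ * ‖testToL2 χ‖ * (1 * ‖testToL2 φ‖) :=
      (norm_inner_le_norm _ _).trans (mul_le_mul d1 (d2.trans (by gcongr)) (norm_nonneg _)
        (by positivity))
    have n2 : ‖⟪p, d⟫_ℂ‖ ≤ ‖p‖ * (δ * ‖testToL2 φ‖) :=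
      (norm_inner_le_norm _ _).trans (mul_le_mul_of_nonneg_left d2 (norm_nonneg _))
    have n3 : ‖⟪c, q⟫_ℂ‖ ≤ δ * ‖testToL2 χ‖ * ‖q‖ :=
      (norm_inner_le_norm _ _).trans (mul_le_mul_of_nonneg_right d1 (norm_nonneg _))
    have := (norm_sub_le (⟪c, d⟫_ℂ - ⟪p, d⟫_ℂ) ⟪c, q⟫_ℂ).trans
      (add_le_add (norm_sub_le _ _) le_rfl)
    linarith
  have e : formPairing A' V E χ φ - formPairing A V E χ φ =
      ∑ j, (⟪momentumTest A' j χ, momentumTest A' j φ⟫_ℂ -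
        ⟪momentumTest A j χ, momentumTest A j φ⟫_ℂ) := by
    simp only [formPairing, Finset.sum_sub_distrib]; ring
  rw [e, Fin.sum_univ_two]
  refine (norm_add_le _ _).trans ((add_le_add (hj 0) (hj 1)).trans ?_)
  rw [formNorm, formNorm, Fin.sum_univ_two, Fin.sum_univ_two]
  set a := ‖testToL2 χ‖
  set a0 := ‖momentumTest A 0 χ‖
  set a1 := ‖momentumTest A 1 χ‖
  set b := ‖testToL2 φ‖
  set b0 := ‖momentumTest A 0 φ‖
  set b1 := ‖momentumTest A 1 φ‖
  have : 0 ≤ δ * (a0 * b + a1 * b + a * b0 + a * b1 + 2 * (a0 + a1) * (b0 + b1)) := by positivity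
  linarith

/-- Quasimodes are stable under small local perturbations of the vector potential. -/
theorem exists_quasimode_perturbation_constant :
    ∃ K : ℝ, 0 < K ∧ ∀ (A A' : C(Plane, Plane)) (V : C(Plane, ℝ)) (E ε δ R : ℝ) (φ : testSpace),
      0 ≤ ε → 0 ≤ δ → δ ≤ 1 → 1 ≤ R → tsupport (φ : Plane → ℂ) ⊆ Metric.ball 0 R →
      (∀ x ∈ Metric.closedBall (0 : Plane) (2 * R), ∀ j, |A' x j - A x j| ≤ δ) →
      IsQuasimode A V E ε φ → IsQuasimode A' V E (K * (ε + δ)) φ := by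
  obtain ⟨C, hC0, hC⟩ := exists_partialDeriv_cutoff_bound
  -- The factors are `2` from `ε + 2δ ≤ 2(ε + δ)`, two factors `3` from the comparison of the form
  -- norms of `A` and `A'`, and `1 + 2C` from cutting off the test function.
  refine ⟨18 * (1 + 2 * C), by positivity, ?_⟩
  intro A A' V E ε δ R φ hε hδ0 hδ1 hR1 hsupp hclose hq
  have hR : 0 < R := one_pos.trans_le hR1
  have hφ : ∀ x, (φ : Plane → ℂ) x ≠ 0 → ∀ j, |A' x j - A x j| ≤ δ := fun x hx => hclose x <| by
    have := hsupp (subset_tsupport _ hx)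
    rw [mem_ball_zero_iff] at this
    rw [mem_closedBall_zero_iff]
    linarith
  have hNφ := formNorm_le_of_close hδ1 φ hφ
  refine ⟨by linarith [hq.1], fun χ => ?_⟩
  set χ' := cutTest hR χ.2.1 with hχ'def
  have hχ' : ∀ x, (χ' : Plane → ℂ) x ≠ 0 → ∀ j, |A' x j - A x j| ≤ δ := fun x hx =>
    hclose x <| by
      by_contra h
      rw [mem_closedBall_zero_iff, not_le] at h
      exact hx (by rw [hχ'def, cutTest_apply, cutoff_eq_zero hR h.le]; simp)
  have hNχ' := formNorm_le_of_close hδ1 χ' hχ'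
  have hNχ : formNorm A' χ' ≤ (1 + 2 * C) * formNorm A' χ := by
    have h0 := norm_cutTest_le hR χ
    have hm (j : Fin 2) : ‖momentumTest A' j χ'‖ ≤ ‖momentumTest A' j χ‖ + C * ‖testToL2 χ‖ :=
      (norm_momentumTest_cutTest_le hC0 hC A' hR χ j).trans (by
        gcongr
        exact div_le_self hC0.le hR1)
    rw [formNorm, formNorm, Fin.sum_univ_two, Fin.sum_univ_two]
    have h1 := hm 0
    have h2 := hm 1
    have := mul_nonneg hC0.le (norm_nonneg (momentumTest A' 0 χ))
    have := mul_nonneg hC0.le (norm_nonneg (momentumTest A' 1 χ))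
    linarith
  rw [← formPairing_cutTest A' V E hR χ φ hsupp, ← hχ'def]
  have h1 := norm_formPairing_sub_le V E hδ0 hδ1 χ' φ hχ' hφ
  have h2 := hq.2 χ'
  have h3 : ‖formPairing A' V E χ' φ‖ ≤ (ε + 2 * δ) * formNorm A χ' * formNorm A φ := by
    have := norm_add_le (formPairing A' V E χ' φ - formPairing A V E χ' φ)
      (formPairing A V E χ' φ)
    rw [sub_add_cancel] at this
    linarith
  refine h3.trans ?_
  have n1 := formNorm_nonneg A χ'
  have n2 := formNorm_nonneg A φ
  have n3 := formNorm_nonneg A' χ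
  have n4 := formNorm_nonneg A' φ
  calc (ε + 2 * δ) * formNorm A χ' * formNorm A φ
      ≤ (ε + 2 * δ) * (3 * ((1 + 2 * C) * formNorm A' χ)) * (3 * formNorm A' φ) := by
        gcongr
        linarith
    _ ≤ (2 * (ε + δ)) * (3 * ((1 + 2 * C) * formNorm A' χ)) * (3 * formNorm A' φ) := by
        gcongr
        linarith
    _ = _ := by ring

/-! ### Gauge transformations and magnetic translations. -/

/-- The vector potential `x ↦ A (x + a) - ∇g (x)`. -/
def gaugeShift (A : C(Plane, Plane)) (a : Plane) {g : Plane → ℝ} (hg : ContDiff ℝ ∞ g) :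
    C(Plane, Plane) :=
  ⟨fun x => A (x + a) - WithLp.toLp 2 fun j => partialDeriv j g x, by
    have h (j : Fin 2) : Continuous fun x => partialDeriv j g x :=
      (hg.continuous_fderiv (by simp)).clm_apply continuous_const
    exact (by fun_prop : Continuous fun x => A (x + a)).sub
      ((PiLp.continuous_toLp 2 _).comp (continuous_pi h))⟩

theorem gaugeShift_apply (A : C(Plane, Plane)) (a : Plane) {g : Plane → ℝ} (hg : ContDiff ℝ ∞ g)
    (x : Plane) (j : Fin 2) : gaugeShift A a hg x j = A (x + a) j - partialDeriv j g x := rfl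

/-- The action `φ ↦ exp (i g (· - a)) φ (· - a)` of a translation and a gauge transformation. -/
def gaugeTest (a : Plane) {g : Plane → ℝ} (hg : ContDiff ℝ ∞ g) (φ : testSpace) : testSpace :=
  ⟨fun x => Complex.exp (Complex.I * g (x - a)) * (φ : Plane → ℂ) (x - a), by
    have hsub : ContDiff ℝ ∞ fun x : Plane => x - a := contDiff_id.sub contDiff_const
    refine ContDiff.mul ?_ (φ.2.1.comp hsub)
    exact (contDiff_const.mul (Complex.ofRealCLM.contDiff.comp (hg.comp hsub))).cexp, by
    exact (φ.2.2.comp_homeomorph (Homeomorph.subRight a)).mul_left⟩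

theorem gaugeTest_apply (a : Plane) {g : Plane → ℝ} (hg : ContDiff ℝ ∞ g) (φ : testSpace)
    (x : Plane) : (gaugeTest a hg φ : Plane → ℂ) x =
      Complex.exp (Complex.I * g (x - a)) * (φ : Plane → ℂ) (x - a) := rfl

theorem gaugeTest_surjective (a : Plane) {g : Plane → ℝ} (hg : ContDiff ℝ ∞ g) :
    Function.Surjective (gaugeTest a hg) := by
  intro χ
  have hg' : ContDiff ℝ ∞ fun x => -g (x - a) := (hg.comp (contDiff_id.sub contDiff_const)).neg
  refine ⟨gaugeTest (-a) hg' χ, Subtype.ext (funext fun x => ?_)⟩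
  rw [gaugeTest_apply, gaugeTest_apply, ← mul_assoc, ← Complex.exp_add]
  simp

/-- Gauge covariance: differentiating the phase produces exactly the gradient of `g` that
`gaugeShift` subtracts. -/
theorem magMomentum_gaugeTest (A : C(Plane, Plane)) (a : Plane) {g : Plane → ℝ}
    (hg : ContDiff ℝ ∞ g) (j : Fin 2) (φ : testSpace) (x : Plane) :
    magMomentum A j (gaugeTest a hg φ) x =
      Complex.exp (Complex.I * g (x - a)) * magMomentum (gaugeShift A a hg) j φ (x - a) := by
  set y := x - a with hy
  have hx : x = y + a := by rw [hy]; abel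
  have h1 : HasFDerivAt (fun y => (g y : ℂ)) (Complex.ofRealCLM ∘L fderiv ℝ g y) y :=
    Complex.ofRealCLM.hasFDerivAt.comp y ((hg.differentiable (by simp)) y).hasFDerivAt
  have h2 : HasFDerivAt (φ : Plane → ℂ) (fderiv ℝ (φ : Plane → ℂ) y) y :=
    (testSpace_differentiable φ y).hasFDerivAt
  have h3 := ((h1.const_mul Complex.I).cexp).mul h2
  have h4 : HasFDerivAt (fun x : Plane => x - a) (ContinuousLinearMap.id ℝ Plane) x :=
    (hasFDerivAt_id x).sub_const a
  have h5 : HasFDerivAt (gaugeTest a hg φ : Plane → ℂ) _ x :=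
    HasFDerivAt.comp (g := fun y => Complex.exp (Complex.I * g y) * (φ : Plane → ℂ) y) x h3 h4
  simp only [magMomentum, partialDeriv, h5.fderiv, gaugeTest_apply, ← hy]
  rw [gaugeShift_apply, ← hx, partialDeriv]
  simp only [ContinuousLinearMap.comp_id, add_apply, smul_apply, smul_eq_mul,
    ContinuousLinearMap.comp_apply, Complex.ofRealCLM_apply]
  push_cast
  linear_combination (-(φ : Plane → ℂ) y * Complex.exp (Complex.I * g y) *
    ((fderiv ℝ g y) (EuclideanSpace.single j 1) : ℝ)) * Complex.I_sq

theorem inner_exp_mul (t : ℝ) (z w : ℂ) :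
    ⟪Complex.exp (Complex.I * t) * z, Complex.exp (Complex.I * t) * w⟫_ℂ = ⟪z, w⟫_ℂ := by
  simp only [RCLike.inner_apply, map_mul]
  have : Complex.exp (Complex.I * t) * conj (Complex.exp (Complex.I * t)) = 1 := by
    rw [Complex.mul_conj, Complex.normSq_eq_norm_sq, mul_comm Complex.I, Complex.norm_exp_ofReal_mul_I]
    simp
  linear_combination (w * conj z) * this

theorem inner_momentumTest_gaugeTest (A : C(Plane, Plane)) (a : Plane) {g : Plane → ℝ}
    (hg : ContDiff ℝ ∞ g) (j : Fin 2) (χ φ : testSpace) :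
    ⟪momentumTest A j (gaugeTest a hg χ), momentumTest A j (gaugeTest a hg φ)⟫_ℂ =
      ⟪momentumTest (gaugeShift A a hg) j χ, momentumTest (gaugeShift A a hg) j φ⟫_ℂ := by
  rw [L2.inner_def, L2.inner_def]
  have e1 : ∫ x, ⟪momentumTest (gaugeShift A a hg) j χ x, momentumTest (gaugeShift A a hg) j φ x⟫_ℂ =
      ∫ x, ⟪magMomentum (gaugeShift A a hg) j χ x, magMomentum (gaugeShift A a hg) j φ x⟫_ℂ := by
    refine integral_congr_ae ?_
    filter_upwards [momentumTest_coeFn (gaugeShift A a hg) j χ,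
      momentumTest_coeFn (gaugeShift A a hg) j φ] with x h1 h2
    rw [h1, h2]
  rw [e1, ← integral_sub_right_eq_self (fun x => ⟪magMomentum (gaugeShift A a hg) j χ x,
    magMomentum (gaugeShift A a hg) j φ x⟫_ℂ) a]
  refine integral_congr_ae ?_
  filter_upwards [momentumTest_coeFn A j (gaugeTest a hg χ),
    momentumTest_coeFn A j (gaugeTest a hg φ)] with x h1 h2
  rw [h1, h2, magMomentum_gaugeTest, magMomentum_gaugeTest, inner_exp_mul]

theorem inner_mulTest_gaugeTest {w : C(Plane, ℂ)} {a : Plane} (hw : ∀ x, w (x + a) = w x)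
    {g : Plane → ℝ} (hg : ContDiff ℝ ∞ g) (χ φ : testSpace) :
    ⟪mulTest w (gaugeTest a hg χ), testToL2 (gaugeTest a hg φ)⟫_ℂ =
      ⟪mulTest w χ, testToL2 φ⟫_ℂ := by
  rw [L2.inner_def, L2.inner_def]
  have e1 : ∫ x, ⟪mulTest w χ x, testToL2 φ x⟫_ℂ =
      ∫ x, ⟪w x * (χ : Plane → ℂ) x, (φ : Plane → ℂ) x⟫_ℂ := by
    refine integral_congr_ae ?_
    filter_upwards [mulTest_coeFn w χ, mulTest_coeFn 1 φ] with x h1 h2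
    rw [testToL2, h1, h2]
    simp
  rw [e1, ← integral_sub_right_eq_self (fun x => ⟪w x * (χ : Plane → ℂ) x, (φ : Plane → ℂ) x⟫_ℂ) a]
  refine integral_congr_ae ?_
  filter_upwards [mulTest_coeFn w (gaugeTest a hg χ), mulTest_coeFn 1 (gaugeTest a hg φ)]
    with x h1 h2
  have hwx : w x = w (x - a) := by rw [← hw (x - a), sub_add_cancel]
  rw [testToL2, h1, h2, gaugeTest_apply, gaugeTest_apply, ContinuousMap.one_apply, one_mul,
    mul_left_comm, inner_exp_mul, hwx]

theorem norm_eq_of_inner_self_eq {f g : L2Plane} (h : ⟪f, f⟫_ℂ = ⟪g, g⟫_ℂ) : ‖f‖ = ‖g‖ := by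
  rw [inner_self_eq_norm_sq_to_K, inner_self_eq_norm_sq_to_K] at h
  have h' : ‖f‖ ^ 2 = ‖g‖ ^ 2 := by exact_mod_cast h
  exact (sq_eq_sq₀ (norm_nonneg _) (norm_nonneg _)).1 h'

theorem formNorm_gaugeTest (A : C(Plane, Plane)) (a : Plane) {g : Plane → ℝ}
    (hg : ContDiff ℝ ∞ g) (φ : testSpace) :
    formNorm A (gaugeTest a hg φ) = formNorm (gaugeShift A a hg) φ := by
  rw [formNorm, formNorm]
  congr 1
  · exact norm_eq_of_inner_self_eq (inner_mulTest_gaugeTest (w := 1) (fun _ => rfl) hg φ φ)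
  · exact Finset.sum_congr rfl fun j _ =>
      norm_eq_of_inner_self_eq (inner_momentumTest_gaugeTest A a hg j φ φ)

/-- Translations by periods of `V` and gauge transformations map quasimodes to quasimodes. -/
theorem IsQuasimode.gaugeTest {A : C(Plane, Plane)} {V : C(Plane, ℝ)} {a : Plane}
    (hV : ∀ x, V (x + a) = V x) {g : Plane → ℝ} (hg : ContDiff ℝ ∞ g) {E ε : ℝ} {φ : testSpace}
    (h : IsQuasimode (gaugeShift A a hg) V E ε φ) :
    IsQuasimode A V E ε (gaugeTest a hg φ) := by
  refine ⟨by rw [formNorm_gaugeTest]; exact h.1, fun χ' => ?_⟩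
  obtain ⟨χ, rfl⟩ := gaugeTest_surjective a hg χ'
  rw [formNorm_gaugeTest, formNorm_gaugeTest]
  convert h.2 χ using 2
  have h1 : ⟪testToL2 (_root_.gaugeTest a hg χ), testToL2 (_root_.gaugeTest a hg φ)⟫_ℂ =
    ⟪testToL2 χ, testToL2 φ⟫_ℂ := inner_mulTest_gaugeTest (w := 1) (fun _ => rfl) hg χ φ
  rw [formPairing, formPairing, inner_mulTest_gaugeTest (w := complexify V) (a := a)
    (fun x => by simp [complexify, hV]) hg χ φ, h1]
  simp only [inner_momentumTest_gaugeTest]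

/-- If, up to gauge and translations by periods of `V`, the vector potential `A'` approximates `A`
on arbitrarily large balls, then the spectrum of `H(A)` is contained in that of `H(A')`. -/
theorem realSpectrum_subset_of_approx {A A' : C(Plane, Plane)} {V : C(Plane, ℝ)} {C : ℝ}
    (hC : ∀ x, |V x| ≤ C)
    (happ : ∀ R > 0, ∀ δ > 0, ∃ (a : Plane) (g : Plane → ℝ), ContDiff ℝ ∞ g ∧
      (∀ x, V (x + a) = V x) ∧ ∀ x ∈ Metric.closedBall (0 : Plane) R, ∀ j,
        |A' (x + a) j - A x j - partialDeriv j g x| ≤ δ) :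
    realSpectrum (hamiltonian A V) ⊆ realSpectrum (hamiltonian A' V) := by
  obtain ⟨K, hK0, hK⟩ := exists_quasimode_perturbation_constant
  intro E hE
  rw [mem_realSpectrum_iff_quasimode A V hC] at hE
  rw [mem_realSpectrum_iff_quasimode A' V hC]
  intro ε hε
  obtain ⟨φ, hφ⟩ := hE (ε / (2 * K)) (by positivity)
  obtain ⟨R₀, hR₀⟩ := φ.2.2.isBounded.subset_ball (0 : Plane)
  set R := max R₀ 1
  set δ := min 1 (ε / (2 * K))
  have hδ : 0 < δ := lt_min one_pos (by positivity)
  -- Closeness is needed on the ball of radius `2 R`, because the test functions are cut off there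
  -- and not at the support of `φ`.
  obtain ⟨a, g, hg, hV, hclose⟩ := happ (2 * R) (by positivity) δ hδ
  have hq := hK A (gaugeShift A' a hg) V E (ε / (2 * K)) δ R φ (by positivity) hδ.le
    (min_le_left _ _) (le_max_right _ _)
    (hR₀.trans (Metric.ball_subset_ball (le_max_left _ _))) (fun x hx j => by
      rw [gaugeShift_apply]
      convert hclose x hx j using 2
      ring) hφ
  refine ⟨gaugeTest a hg φ, IsQuasimode.gaugeTest hV hg ⟨hq.1, fun χ => (hq.2 χ).trans ?_⟩⟩
  have n1 := formNorm_nonneg (gaugeShift A' a hg) χ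
  have n2 := formNorm_nonneg (gaugeShift A' a hg) φ
  gcongr
  calc K * (ε / (2 * K) + δ) ≤ K * (ε / (2 * K) + ε / (2 * K)) := by
        gcongr
        exact min_le_right _ _
    _ = ε := by field_simp; norm_num

/-! ### Vector potentials, distributional curl, and approximate gauge equivalence. -/

/-- The coordinate direction `e_j`. -/
abbrev coordDir (j : Fin 2) : Plane := EuclideanSpace.single j 1

theorem integral_mul_partialDeriv {f f' φ : Plane → ℝ} {j : Fin 2} (hf : Continuous f)
    (hf' : Continuous f') (hd : ∀ x, HasLineDerivAt ℝ f (f' x) x (coordDir j))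
    (hφ : ContDiff ℝ ∞ φ) (hc : HasCompactSupport φ) :
    ∫ x, f x * partialDeriv j φ x = -∫ x, f' x * φ x := by
  have hφ' : Continuous (partialDeriv j φ) :=
    (hφ.continuous_fderiv (by simp)).clm_apply continuous_const
  have hc' : HasCompactSupport (partialDeriv j φ) := hc.fderiv_apply ℝ _
  exact integral_bilinear_hasLineDerivAt_right_eq_neg_left_of_integrable
    (B := ContinuousLinearMap.mul ℝ ℝ)
    ((hf'.mul hφ.continuous).integrable_of_hasCompactSupport hc.mul_left)
    ((hf.mul hφ').integrable_of_hasCompactSupport hc'.mul_left)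
    ((hf.mul hφ.continuous).integrable_of_hasCompactSupport hc.mul_left)
    (fun x _ => hd x)
    (fun x _ => ((hφ.differentiable (by simp)) x).hasFDerivAt.hasLineDerivAt _)

theorem integrable_continuous_mul {f φ : Plane → ℝ} (hf : Continuous f) (hφ : ContDiff ℝ ∞ φ)
    (hc : HasCompactSupport φ) : Integrable fun x => f x * φ x :=
  (hf.mul hφ.continuous).integrable_of_hasCompactSupport hc.mul_left

/-- Only the two line derivatives that enter the curl are required, since a vector potential built
from a continuous field need not be differentiable in the other directions. -/
theorem isVectorPotential_of_hasLineDerivAt {A : C(Plane, Plane)} {d₀ d₁ : Plane → ℝ}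
    (hd₀ : Continuous d₀) (hd₁ : Continuous d₁)
    (h₀ : ∀ x, HasLineDerivAt ℝ (fun y => A y 0) (d₀ x) x (coordDir 1))
    (h₁ : ∀ x, HasLineDerivAt ℝ (fun y => A y 1) (d₁ x) x (coordDir 0)) :
    IsVectorPotential A fun x => d₁ x - d₀ x := by
  intro φ hφ hc
  have hA (j : Fin 2) : Continuous fun x => A x j := by fun_prop
  have hφ' (j : Fin 2) : Continuous (partialDeriv j φ) :=
    (hφ.continuous_fderiv (by simp)).clm_apply continuous_const
  have hc' (j : Fin 2) : HasCompactSupport (partialDeriv j φ) := hc.fderiv_apply ℝ _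
  have i (j k : Fin 2) : Integrable fun x => A x j * partialDeriv k φ x :=
    ((hA j).mul (hφ' k)).integrable_of_hasCompactSupport (hc' k).mul_left
  rw [integral_sub (i 0 1) (i 1 0), integral_mul_partialDeriv (hA 0) hd₀ h₀ hφ hc,
    integral_mul_partialDeriv (hA 1) hd₁ h₁ hφ hc]
  simp only [sub_mul]
  rw [integral_sub (integrable_continuous_mul hd₁ hφ hc) (integrable_continuous_mul hd₀ hφ hc)]
  ring

/-- The integral of `b` along the vertical segment from height `c` to the point `x`. -/
def verticalIntegral (b : Plane → ℝ) (c : ℝ) (x : Plane) : ℝ :=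
  ∫ t in c..x 1, b !₂[x 0, t]

theorem continuous_vec_two : Continuous fun p : ℝ × ℝ => (!₂[p.1, p.2] : Plane) := by
  refine (PiLp.continuous_toLp 2 _).comp (continuous_pi fun j => ?_)
  fin_cases j
  · exact continuous_fst
  · exact continuous_snd

theorem verticalIntegral_continuous {b : Plane → ℝ} (hb : Continuous b) (c : ℝ) :
    Continuous (verticalIntegral b c) := by
  refine intervalIntegral.continuous_parametric_intervalIntegral_of_continuous
    (f := fun (x : Plane) t => b !₂[x 0, t]) ?_ (by fun_prop)
  have h : Continuous fun p : Plane × ℝ => (p.1 0, p.2) := by fun_prop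
  exact hb.comp (continuous_vec_two.comp h)

theorem vec_two_eta (x : Plane) : !₂[x 0, x 1] = x := by
  ext j; fin_cases j <;> rfl

theorem verticalIntegral_hasLineDerivAt {b : Plane → ℝ} (hb : Continuous b) (c : ℝ) (x : Plane) :
    HasLineDerivAt ℝ (verticalIntegral b c) (b x) x (coordDir 1) := by
  have hc : Continuous fun t => b !₂[x 0, t] :=
    hb.comp (continuous_vec_two.comp (by fun_prop : Continuous fun t : ℝ => (x 0, t)))
  have h1 := (hc.integral_hasStrictDerivAt c (x 1 + 0)).hasDerivAt
  have h2 := h1.comp_const_add (x 1) 0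
  rw [add_zero, vec_two_eta] at h2
  refine HasDerivAt.congr_of_eventuallyEq h2 (Eventually.of_forall fun t => ?_)
  simp [verticalIntegral]

/-- The vector potential `(-∫ b, 0)` of `b`. -/
def axisPotential {b : Plane → ℝ} (hb : Continuous b) : C(Plane, Plane) :=
  ⟨fun x => !₂[-verticalIntegral b 0 x, 0], continuous_vec_two.comp
    ((verticalIntegral_continuous hb 0).neg.prodMk continuous_const)⟩

theorem axisPotential_isVectorPotential {b : Plane → ℝ} (hb : Continuous b) :
    IsVectorPotential (axisPotential hb) b := by
  have := isVectorPotential_of_hasLineDerivAt (A := axisPotential hb) (d₀ := fun x => -b x)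
    (d₁ := 0) hb.neg continuous_zero
    (fun x => (verticalIntegral_hasLineDerivAt hb 0 x).neg)
    (fun x => hasDerivAt_const _ _)
  simpa using this

theorem abs_verticalIntegral_le {b : Plane → ℝ} {δ R : ℝ} (hb : ∀ x, ‖x‖ ≤ R → |b x| ≤ δ)
    {x : Plane} (hx : ‖x‖ ≤ R) : |verticalIntegral b 0 x| ≤ δ * R := by
  have h1 : ‖verticalIntegral b 0 x‖ ≤ δ * |x 1 - 0| := by
    refine intervalIntegral.norm_integral_le_of_norm_le_const fun t ht => hb _ ?_
    have ht' : |t| ≤ |x 1| := by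
      rcases le_total 0 (x 1) with h | h
      · rw [uIoc_of_le h] at ht
        rw [abs_of_pos ht.1, abs_of_nonneg h]; exact ht.2
      · rw [uIoc_of_ge h] at ht
        rw [abs_of_nonpos ht.2, abs_of_nonpos h]; linarith [ht.1]
    refine le_trans ?_ hx
    rw [EuclideanSpace.norm_eq, EuclideanSpace.norm_eq]
    refine Real.sqrt_le_sqrt ?_
    rw [Fin.sum_univ_two, Fin.sum_univ_two]
    simp only [Real.norm_eq_abs, sq_abs]
    have := sq_le_sq.2 ht'
    simpa using this
  have hδ : 0 ≤ δ := (abs_nonneg _).trans (hb x hx)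
  rw [Real.norm_eq_abs, sub_zero] at h1
  refine h1.trans ?_
  gcongr
  exact (PiLp.norm_apply_le x 1).trans hx

theorem IsVectorPotential.integrable_left (A : C(Plane, Plane)) {φ : Plane → ℝ}
    (hφ : ContDiff ℝ ∞ φ) (hc : HasCompactSupport φ) :
    Integrable fun x => A x 0 * partialDeriv 1 φ x - A x 1 * partialDeriv 0 φ x := by
  have hφ' (j : Fin 2) : Continuous (partialDeriv j φ) :=
    (hφ.continuous_fderiv (by simp)).clm_apply continuous_const
  have hc' (j : Fin 2) : HasCompactSupport (partialDeriv j φ) := hc.fderiv_apply ℝ _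
  have i (j k : Fin 2) : Integrable fun x => A x j * partialDeriv k φ x :=
    ((by fun_prop : Continuous fun x => A x j).mul (hφ' k)).integrable_of_hasCompactSupport
      (hc' k).mul_left
  exact (i 0 1).sub (i 1 0)

theorem IsVectorPotential.sub {A A' : C(Plane, Plane)} {B B' : Plane → ℝ} (hB : Continuous B)
    (hB' : Continuous B') (h : IsVectorPotential A B) (h' : IsVectorPotential A' B') :
    IsVectorPotential (A - A') fun x => B x - B' x := by
  intro φ hφ hc
  have e : ∀ x, (A - A') x 0 * partialDeriv 1 φ x - (A - A') x 1 * partialDeriv 0 φ x =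
      (A x 0 * partialDeriv 1 φ x - A x 1 * partialDeriv 0 φ x) -
        (A' x 0 * partialDeriv 1 φ x - A' x 1 * partialDeriv 0 φ x) := fun x => by
    simp only [ContinuousMap.sub_apply, PiLp.sub_apply]; ring
  simp only [e, sub_mul]
  rw [integral_sub (integrable_left A hφ hc) (integrable_left A' hφ hc), h φ hφ hc, h' φ hφ hc,
    integral_sub (integrable_continuous_mul hB hφ hc) (integrable_continuous_mul hB' hφ hc)]

theorem IsVectorPotential.translate {A : C(Plane, Plane)} {B : Plane → ℝ}
    (h : IsVectorPotential A B) (a : Plane) :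
    IsVectorPotential (A.comp ⟨fun x => x + a, by fun_prop⟩) fun x => B (x + a) := by
  intro φ hφ hc
  have hφ' : ContDiff ℝ ∞ fun x => φ (x - a) := hφ.comp (contDiff_id.sub contDiff_const)
  have hc' : HasCompactSupport fun x => φ (x - a) := hc.comp_homeomorph (Homeomorph.subRight a)
  have hd (j : Fin 2) (x : Plane) :
      partialDeriv j (fun x => φ (x - a)) (x + a) = partialDeriv j φ x := by
    rw [partialDeriv, fderiv_comp_sub, add_sub_cancel_right]; rfl
  have key := h _ hφ' hc'
  rw [← integral_add_right_eq_self _ a, ← integral_add_right_eq_self (fun x => B x * φ (x - a)) a]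
    at key
  simp only [hd, add_sub_cancel_right] at key
  exact key

/-- The convolution of a continuous function with a smooth function of compact support. -/
def mollify (ρ f : Plane → ℝ) : Plane → ℝ := convolution f ρ (ContinuousLinearMap.lsmul ℝ ℝ) volume

theorem mollify_contDiff {ρ f : Plane → ℝ} (hρ : ContDiff ℝ ∞ ρ) (hc : HasCompactSupport ρ)
    (hf : Continuous f) : ContDiff ℝ ∞ (mollify ρ f) :=
  hc.contDiff_convolution_right _ hf.locallyIntegrable hρ

theorem partialDeriv_mollify {ρ f : Plane → ℝ} (hρ : ContDiff ℝ ∞ ρ) (hc : HasCompactSupport ρ)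
    (hf : Continuous f) (j : Fin 2) (x : Plane) :
    partialDeriv j (mollify ρ f) x = ∫ y, f y * partialDeriv j ρ (x - y) := by
  have h := hc.hasFDerivAt_convolution_right (ContinuousLinearMap.lsmul ℝ ℝ)
    (μ := (volume : Measure Plane)) hf.locallyIntegrable (hρ.of_le (by simp)) x
  rw [partialDeriv, mollify, h.fderiv, convolution_precompR_apply _ hf.locallyIntegrable
    (hc.fderiv ℝ) (hρ.continuous_fderiv (by simp))]
  rfl

/-- The distributional identity `curl F = 0` is tested with the reflected and translated mollifier
`y ↦ ρ (x - y)`. -/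
theorem IsVectorPotential.partialDeriv_mollify_comm {F : C(Plane, Plane)}
    (hF : IsVectorPotential F fun _ => 0) {ρ : Plane → ℝ} (hρ : ContDiff ℝ ∞ ρ)
    (hc : HasCompactSupport ρ) (x : Plane) :
    partialDeriv 1 (mollify ρ fun y => F y 0) x = partialDeriv 0 (mollify ρ fun y => F y 1) x := by
  have hF' (j : Fin 2) : Continuous fun y => F y j := by fun_prop
  rw [partialDeriv_mollify hρ hc (hF' 0), partialDeriv_mollify hρ hc (hF' 1)]
  have hφ : ContDiff ℝ ∞ fun y => ρ (x - y) := hρ.comp (contDiff_const.sub contDiff_id)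
  have hφc : HasCompactSupport fun y => ρ (x - y) := hc.comp_homeomorph (Homeomorph.subLeft x)
  have hd (j : Fin 2) (y : Plane) :
      partialDeriv j (fun y => ρ (x - y)) y = -partialDeriv j ρ (x - y) := by
    have h1 : HasFDerivAt (fun y : Plane => x - y) (-ContinuousLinearMap.id ℝ Plane) y :=
      (hasFDerivAt_id y).const_sub x
    have h2 := (((hρ.differentiable (by simp)) (x - y)).hasFDerivAt.comp y h1).fderiv
    change fderiv ℝ (ρ ∘ fun y => x - y) y _ = _
    rw [h2]
    simp [partialDeriv]
  have key := hF _ hφ hφc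
  have i (j k : Fin 2) : Integrable fun y => F y j * partialDeriv k ρ (x - y) := by
    have h1 : Continuous fun y => partialDeriv k ρ (x - y) :=
      ((hρ.continuous_fderiv (by simp)).clm_apply continuous_const).comp (by fun_prop)
    have h2 : HasCompactSupport fun y => partialDeriv k ρ (x - y) :=
      (hc.fderiv_apply ℝ _).comp_homeomorph (Homeomorph.subLeft x)
    exact ((hF' j).mul h1).integrable_of_hasCompactSupport h2.mul_left
  simp only [hd, mul_neg, zero_mul, integral_zero] at key
  have e : ∀ y, -(F y 0 * partialDeriv 1 ρ (x - y)) - -(F y 1 * partialDeriv 0 ρ (x - y)) =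
      F y 1 * partialDeriv 0 ρ (x - y) - F y 0 * partialDeriv 1 ρ (x - y) := fun y => by ring
  simp only [e] at key
  rw [integral_sub (i 1 0) (i 0 1)] at key
  linarith

theorem plane_eq_sum_coordDir (v : Plane) : v = v 0 • coordDir 0 + v 1 • coordDir 1 := by
  ext j; fin_cases j <;> simp

/-- A smooth closed `1`-form on the plane is exact. -/
theorem exists_potential_of_closed {f : Fin 2 → Plane → ℝ} (hf : ∀ j, ContDiff ℝ ∞ (f j))
    (hcl : ∀ x, partialDeriv 1 (f 0) x = partialDeriv 0 (f 1) x) :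
    ∃ g : Plane → ℝ, ContDiff ℝ ∞ g ∧ ∀ j x, partialDeriv j g x = f j x := by
  let P : Fin 2 → Plane →L[ℝ] ℝ := fun j => EuclideanSpace.proj j
  let α : Plane → Plane →L[ℝ] ℝ := fun x => f 0 x • P 0 + f 1 x • P 1
  have hα : ContDiff ℝ ∞ α := ((hf 0).smul contDiff_const).add ((hf 1).smul contDiff_const)
  have hfd (j : Fin 2) (x : Plane) : HasFDerivAt (f j) (fderiv ℝ (f j) x) x :=
    ((hf j).differentiable (by simp) x).hasFDerivAt
  have hderiv (x v w : Plane) :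
      fderiv ℝ α x v w = fderiv ℝ (f 0) x v * w 0 + fderiv ℝ (f 1) x v * w 1 := by
    have h : HasFDerivAt α _ x := ((hfd 0 x).smul_const (P 0)).add ((hfd 1 x).smul_const (P 1))
    rw [h.fderiv]
    simp [P]
  have hexp (j : Fin 2) (x v : Plane) : fderiv ℝ (f j) x v =
      v 0 * partialDeriv 0 (f j) x + v 1 * partialDeriv 1 (f j) x := by
    conv_lhs => rw [plane_eq_sum_coordDir v]
    simp [partialDeriv]
  -- Poincaré lemma: vanishing curl is the symmetry of the derivative of the `1`-form `α`.
  obtain ⟨g, hg⟩ := (convex_univ (𝕜 := ℝ) (E := Plane)).exists_forall_hasFDerivAt_of_fderiv_symmetric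
    isOpen_univ (hα.differentiable (by simp)).differentiableOn (fun x _ v w => by
      rw [hderiv, hderiv]
      simp only [hexp, hcl x]
      ring)
  have hfg : fderiv ℝ g = α := funext fun x => (hg x trivial).fderiv
  refine ⟨g, contDiff_infty_iff_fderiv.2
    ⟨fun x => (hg x trivial).differentiableAt, hfg ▸ hα⟩, fun j x => ?_⟩
  rw [partialDeriv, hfg]
  fin_cases j <;> simp [α, P]

/-- A continuous vector field which is curl-free in the sense of distributions is locally
uniformly a limit of gradients. -/
theorem IsVectorPotential.exists_gradient_approx {F : C(Plane, Plane)}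
    (hF : IsVectorPotential F fun _ => 0) (R : ℝ) {δ : ℝ} (hδ : 0 < δ) :
    ∃ g : Plane → ℝ, ContDiff ℝ ∞ g ∧ ∀ x ∈ Metric.closedBall (0 : Plane) R, ∀ j,
      |F x j - partialDeriv j g x| ≤ δ := by
  -- The mollifier has radius at most `1`, so uniform continuity on the ball of radius `R + 1`
  -- controls the mollification error on the ball of radius `R`.
  have huc := (isCompact_closedBall (0 : Plane) (R + 1)).uniformContinuousOn_of_continuous
    F.continuous.continuousOn
  obtain ⟨η, hη, huc⟩ := Metric.uniformContinuousOn_iff_le.1 huc δ hδ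
  let r := min η 1
  have hr : 0 < r := lt_min hη one_pos
  let b : ContDiffBump (0 : Plane) := ⟨r / 2, r, by positivity, by linarith⟩
  let ρ := b.normed (volume : Measure Plane)
  have hρ : ContDiff ℝ ∞ ρ := b.contDiff_normed
  have hc : HasCompactSupport ρ := b.hasCompactSupport_normed
  obtain ⟨g, hg, hg'⟩ := exists_potential_of_closed (f := fun j => mollify ρ fun y => F y j)
    (fun j => mollify_contDiff hρ hc (by fun_prop)) (hF.partialDeriv_mollify_comm hρ hc)
  refine ⟨g, hg, fun x hx j => ?_⟩
  rw [hg', abs_sub_comm, ← Real.dist_eq]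
  have e : mollify ρ (fun y => F y j) x =
      convolution ρ (fun y => F y j) (ContinuousLinearMap.lsmul ℝ ℝ) volume x := by
    rw [mollify, ← convolution_flip]
    congr 1
    ext; simp
  rw [e]
  rw [mem_closedBall_zero_iff] at hx
  refine b.dist_normed_convolution_le (g := fun y => F y j)
    (by fun_prop : Continuous fun y => F y j).aestronglyMeasurable fun y hy => ?_
  have hy : dist y x < r := hy
  have h1 := huc y (by
    rw [mem_closedBall_zero_iff]
    have := norm_le_norm_add_norm_sub x y
    rw [norm_sub_rev, ← dist_eq_norm] at this
    linarith [min_le_right η 1]) x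
    (by rw [mem_closedBall_zero_iff]; linarith) (hy.le.trans (min_le_left _ _))
  refine le_trans ?_ h1
  rw [Real.dist_eq, dist_eq_norm]
  exact PiLp.norm_apply_le (F y - F x) j

/-- If the field `B'` approximates `B` on arbitrarily large balls, up to translations by periods of
`V`, then the spectrum belonging to `B` is contained in that belonging to `B'`. -/
theorem realSpectrum_subset_of_field_approx {A A' : C(Plane, Plane)} {B B' : Plane → ℝ}
    {V : C(Plane, ℝ)} {C : ℝ} (hC : ∀ x, |V x| ≤ C) (hB : Continuous B) (hB' : Continuous B')
    (hA : IsVectorPotential A B) (hA' : IsVectorPotential A' B')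
    (happ : ∀ R > 0, ∀ δ > 0, ∃ a : Plane, (∀ x, V (x + a) = V x) ∧
      ∀ x, ‖x‖ ≤ R → |B' (x + a) - B x| ≤ δ) :
    realSpectrum (hamiltonian A V) ⊆ realSpectrum (hamiltonian A' V) := by
  refine realSpectrum_subset_of_approx hC fun R hR δ hδ => ?_
  -- Integrating the field difference along segments of length at most `R` gives a vector potential
  -- of size at most `δ / 2`. The other `δ / 2` is for the approximation of the remaining curl-free
  -- field by a gradient.
  obtain ⟨a, hV, hclose⟩ := happ R hR (δ / (2 * R)) (by positivity)
  have hB'a : Continuous fun x => B' (x + a) := by fun_prop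
  have hb : Continuous fun x => B' (x + a) - B x := hB'a.sub hB
  have h1 := (hA'.translate a).sub hB'a hB hA
  have h2 := h1.sub hb hb (axisPotential_isVectorPotential hb)
  simp only [sub_self] at h2
  obtain ⟨g, hg, hg'⟩ := h2.exists_gradient_approx R (half_pos hδ)
  refine ⟨a, g, hg, hV, fun x hx j => ?_⟩
  have h3 := hg' x hx j
  rw [mem_closedBall_zero_iff] at hx
  have h4 : |axisPotential hb x j| ≤ δ / 2 := by
    fin_cases j
    · have := abs_verticalIntegral_le hclose hx
      change |-verticalIntegral _ 0 x| ≤ _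
      rw [abs_neg]
      refine this.trans (le_of_eq ?_)
      field_simp
    · change |(0 : ℝ)| ≤ _
      rw [abs_zero]; positivity
  have e : A' (x + a) j - A x j - partialDeriv j g x =
      ((A'.comp ⟨fun x => x + a, by fun_prop⟩ - A - axisPotential hb) x j - partialDeriv j g x) +
        axisPotential hb x j := by
    simp only [ContinuousMap.sub_apply, PiLp.sub_apply, ContinuousMap.comp_apply,
      ContinuousMap.coe_mk]
    ring
  rw [e]
  exact (abs_add_le _ _).trans (by linarith)

/-! ### Smooth square-integrable trial functions. -/

theorem partialDeriv_smooth_continuous {f : Plane → ℂ} (hf : ContDiff ℝ ∞ f) (j : Fin 2) :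
    Continuous (partialDeriv j f) :=
  (hf.continuous_fderiv (by simp)).clm_apply continuous_const

theorem magMomentum_continuous (A : C(Plane, Plane)) {f : Plane → ℂ} (hf : ContDiff ℝ ∞ f)
    (j : Fin 2) : Continuous (magMomentum A j f) := by
  have hA : Continuous fun x => ((A x j : ℝ) : ℂ) := by fun_prop
  exact (continuous_const.mul (partialDeriv_smooth_continuous hf j)).sub (hA.mul hf.continuous)

theorem norm_sq_eq_integral (f : L2Plane) : ‖f‖ ^ 2 = ∫ x, ‖f x‖ ^ 2 := by
  have h := L2.inner_def (𝕜 := ℂ) f f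
  rw [inner_self_eq_norm_sq_to_K] at h
  have e : ∀ x, ⟪f x, f x⟫_ℂ = ((‖f x‖ ^ 2 : ℝ) : ℂ) := fun x => by
    rw [inner_self_eq_norm_sq_to_K]; norm_cast
  simp only [e] at h
  have h' := h.trans (integral_ofReal (𝕜 := ℂ))
  exact_mod_cast h'

/-- Dominated convergence for the squares: at each point the cutoff is eventually equal to `1`. -/
theorem tendsto_norm_cutoff_sub_one (h : L2Plane) {f : ℕ → L2Plane}
    (hf : ∀ m, ∀ᵐ x, ‖f m x‖ ≤ |cutoff (m + 1) x - 1| * ‖h x‖) :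
    Tendsto (fun m => ‖f m‖) atTop (𝓝 0) := by
  have hint : Integrable fun x => ‖h x‖ ^ 2 := (Lp.memLp h).integrable_norm_pow (by simp)
  have hcut (m : ℕ) (x : Plane) : |cutoff (m + 1) x - 1| ≤ 1 := by
    rw [abs_le]
    constructor <;> linarith [cutoff_nonneg (m + 1) x, cutoff_le_one (m + 1) x]
  have hint' (m : ℕ) : Integrable fun x => ‖f m x‖ ^ 2 :=
    (Lp.memLp (f m)).integrable_norm_pow (by simp)
  have key : Tendsto (fun m => ∫ x, ‖f m x‖ ^ 2) atTop (𝓝 (∫ _ : Plane, (0 : ℝ))) := by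
    refine tendsto_integral_of_dominated_convergence (fun x => ‖h x‖ ^ 2)
      (fun m => (hint' m).aestronglyMeasurable) hint (fun m => ?_) ?_
    · filter_upwards [hf m] with x hx
      rw [Real.norm_of_nonneg (by positivity)]
      gcongr
      exact hx.trans (mul_le_of_le_one_left (norm_nonneg _) (hcut m x))
    · filter_upwards [ae_all_iff.2 hf] with x hx
      refine tendsto_const_nhds.congr' ?_
      obtain ⟨m₀, hm₀⟩ := exists_nat_ge ‖x‖
      filter_upwards [eventually_ge_atTop m₀] with m hm
      have h1 : cutoff (m + 1) x = 1 := cutoff_eq_one (by positivity) (by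
        have : (m₀ : ℝ) ≤ m := by exact_mod_cast hm
        linarith)
      have h2 := hx m
      rw [h1, sub_self, abs_zero, zero_mul] at h2
      rw [le_antisymm h2 (norm_nonneg _)]
      simp
  simp only [← norm_sq_eq_integral, integral_zero] at key
  have := key.sqrt
  simpa using this

/-- Smooth functions `φ` with `φ` and `(p - A) φ` in `L²` belong to the form domain. -/
theorem mem_formClosure_of_contDiff (A : C(Plane, Plane)) {φ : Plane → ℂ} (hφ : ContDiff ℝ ∞ φ)
    (h2 : MemLp φ 2 (volume : Measure Plane))
    (hm : ∀ j, MemLp (magMomentum A j φ) 2 (volume : Measure Plane)) :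
    (h2.toLp φ, fun j => (hm j).toLp (magMomentum A j φ)) ∈ formClosure A := by
  obtain ⟨C, hC0, hC⟩ := exists_partialDeriv_cutoff_bound
  have hpos (m : ℕ) : (0 : ℝ) < m + 1 := by positivity
  let s : ℕ → testSpace := fun m => cutTest (hpos m) hφ
  have t1 : Tendsto (fun m => testToL2 (s m)) atTop (𝓝 (h2.toLp φ)) := by
    rw [tendsto_iff_norm_sub_tendsto_zero]
    refine tendsto_norm_cutoff_sub_one (h2.toLp φ) fun m => ?_
    filter_upwards [mulTest_coeFn 1 (s m), h2.coeFn_toLp,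
      Lp.coeFn_sub (testToL2 (s m)) (h2.toLp φ)] with x e1 e2 e3
    rw [e3, Pi.sub_apply, testToL2, e1, e2, cutTest_apply, ← Real.norm_eq_abs, ← Complex.norm_real,
      ← norm_mul]
    refine le_of_eq ?_
    congr 1
    simp only [ContinuousMap.one_apply]
    push_cast
    ring
  have t2 (j : Fin 2) : Tendsto (fun m => momentumTest A j (s m)) atTop
      (𝓝 ((hm j).toLp (magMomentum A j φ))) := by
    set G := (hm j).toLp (magMomentum A j φ)
    have hmem (m : ℕ) : MemLp (fun x => ((cutoff (m + 1) x - 1 : ℝ) : ℂ) * magMomentum A j φ x) 2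
        (volume : Measure Plane) := by
      refine (hm j).of_le_mul (c := 1) ?_ (ae_of_all _ fun x => ?_)
      · have : Continuous fun x => ((cutoff (m + 1) x - 1 : ℝ) : ℂ) := by
          have := (cutoff_contDiff (m + 1)).continuous
          fun_prop
        exact this.aestronglyMeasurable.mul (hm j).aestronglyMeasurable
      · rw [norm_mul, Complex.norm_real, Real.norm_eq_abs]
        gcongr
        rw [abs_le]
        constructor <;> linarith [cutoff_nonneg (m + 1) x, cutoff_le_one (m + 1) x]
    have t3 := tendsto_norm_cutoff_sub_one G (f := fun m => (hmem m).toLp _) fun m => by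
      filter_upwards [(hmem m).coeFn_toLp, (hm j).coeFn_toLp] with x e1 e2
      rw [e1, e2, norm_mul, Complex.norm_real, Real.norm_eq_abs]
    have t4 : Tendsto (fun m : ℕ => C / ((m : ℝ) + 1) * ‖h2.toLp φ‖) atTop (𝓝 0) := by
      have := (tendsto_const_div_atTop_nhds_zero_nat C).comp (tendsto_add_atTop_nat 1)
      have := this.mul_const ‖h2.toLp φ‖
      simpa using this
    have t5 := t3.add t4
    rw [add_zero] at t5
    rw [tendsto_iff_norm_sub_tendsto_zero]
    refine squeeze_zero (fun _ => norm_nonneg _) (fun m => ?_) t5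
    refine norm_Lp_le_add (by positivity) ?_
    filter_upwards [momentumTest_coeFn A j (s m), (hmem m).coeFn_toLp, (hm j).coeFn_toLp,
      h2.coeFn_toLp, Lp.coeFn_sub (momentumTest A j (s m)) G] with x e1 e2 e3 e4 e5
    rw [e5, Pi.sub_apply, e1, e2, e3, e4, magMomentum_cutTest]
    have : (cutoff (m + 1) x : ℂ) * magMomentum A j φ x -
        Complex.I * ((partialDeriv j (cutoff (m + 1)) x : ℝ) : ℂ) * φ x - magMomentum A j φ x =
        ((cutoff (m + 1) x - 1 : ℝ) : ℂ) * magMomentum A j φ x -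
          Complex.I * ((partialDeriv j (cutoff (m + 1)) x : ℝ) : ℂ) * φ x := by
      push_cast; ring
    rw [this]
    refine (norm_sub_le _ _).trans (add_le_add le_rfl ?_)
    simp only [norm_mul, Complex.norm_I, Complex.norm_real, one_mul, Real.norm_eq_abs]
    exact mul_le_mul_of_nonneg_right (hC _ (hpos m) j x) (norm_nonneg _)
  have t : Tendsto (fun m => (testToL2 (s m), fun j => momentumTest A j (s m))) atTop
      (𝓝 (h2.toLp φ, fun j => (hm j).toLp (magMomentum A j φ))) :=
    t1.prodMk_nhds (tendsto_pi_nhds.2 t2)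
  exact mem_closure_of_tendsto t (Eventually.of_forall fun m => ⟨s m, rfl⟩)

theorem integral_mul_lineDeriv_complex {f f' g g' : Plane → ℂ} {v : Plane}
    (hf'g : Integrable fun x => f' x * g x) (hfg' : Integrable fun x => f x * g' x)
    (hfg : Integrable fun x => f x * g x) (hf : ∀ x, HasLineDerivAt ℝ f (f' x) x v)
    (hg : ∀ x, HasLineDerivAt ℝ g (g' x) x v) :
    ∫ x, f x * g' x = -∫ x, f' x * g x :=
  integral_bilinear_hasLineDerivAt_right_eq_neg_left_of_integrable
    (B := ContinuousLinearMap.mul ℝ ℂ) hf'g hfg' hfg (fun x _ => hf x) (fun x _ => hg x)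

theorem conj_test_hasFDerivAt (χ : testSpace) (x : Plane) :
    HasFDerivAt (fun x => conj ((χ : Plane → ℂ) x))
      (Complex.conjCLE.toContinuousLinearMap ∘L fderiv ℝ (χ : Plane → ℂ) x) x :=
  Complex.conjCLE.toContinuousLinearMap.hasFDerivAt.comp x
    (testSpace_differentiable χ x).hasFDerivAt

/-- Integration by parts for the magnetic momentum against a test function. -/
theorem integral_conj_magMomentum_mul (A : C(Plane, Plane)) (j : Fin 2) (χ : testSpace)
    {w w' : Plane → ℂ} (hw : Continuous w) (hd : ∀ x, HasLineDerivAt ℝ w (w' x) x (coordDir j))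
    (hi : Integrable fun x => conj ((χ : Plane → ℂ) x) * w' x) :
    ∫ x, conj (magMomentum A j χ x) * w x =
      ∫ x, conj ((χ : Plane → ℂ) x) * (-Complex.I * w' x - (A x j : ℂ) * w x) := by
  have hA : Continuous fun x => ((A x j : ℝ) : ℂ) := by fun_prop
  have hcs : HasCompactSupport fun x => conj ((χ : Plane → ℂ) x) :=
    χ.2.2.comp_left (g := fun z : ℂ => conj z) (by simp)
  have hcc : Continuous fun x => conj ((χ : Plane → ℂ) x) :=
    Complex.continuous_conj.comp χ.2.1.continuous
  have hcdc : Continuous fun x => conj (partialDeriv j χ x) :=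
    Complex.continuous_conj.comp (partialDeriv_test_continuous j χ)
  have hcds : HasCompactSupport fun x => conj (partialDeriv j (χ : Plane → ℂ) x) :=
    (partialDeriv_test_hasCompactSupport j χ).mono fun x hx h0 => hx (by simp [h0])
  have i1 : Integrable fun x => conj (partialDeriv j χ x) * w x :=
    (hcdc.mul hw).integrable_of_hasCompactSupport hcds.mul_right
  have i2 : Integrable fun x => conj ((χ : Plane → ℂ) x) * w x :=
    (hcc.mul hw).integrable_of_hasCompactSupport hcs.mul_right
  have i3 : Integrable fun x => ((A x j : ℝ) : ℂ) * (conj ((χ : Plane → ℂ) x) * w x) :=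
    (hA.mul (hcc.mul hw)).integrable_of_hasCompactSupport hcs.mul_right.mul_left
  have hl (x : Plane) : HasLineDerivAt ℝ (fun x => conj ((χ : Plane → ℂ) x))
      (conj (partialDeriv j χ x)) x (coordDir j) :=
    (conj_test_hasFDerivAt χ x).hasLineDerivAt (coordDir j)
  have ibp := integral_mul_lineDeriv_complex i1 hi i2 hl hd
  have e1 : ∀ x, conj (magMomentum A j χ x) * w x =
      Complex.I * (conj (partialDeriv j χ x) * w x) -
        ((A x j : ℝ) : ℂ) * (conj ((χ : Plane → ℂ) x) * w x) := fun x => by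
    simp only [magMomentum, map_sub, map_mul, map_neg, Complex.conj_I, Complex.conj_ofReal]
    ring
  have e2 : ∀ x, conj ((χ : Plane → ℂ) x) * (-Complex.I * w' x - (A x j : ℂ) * w x) =
      -Complex.I * (conj ((χ : Plane → ℂ) x) * w' x) -
        ((A x j : ℝ) : ℂ) * (conj ((χ : Plane → ℂ) x) * w x) := fun x => by ring
  simp only [e1, e2]
  rw [integral_sub (i1.const_mul _) i3, integral_sub (hi.const_mul _) i3, integral_const_mul,
    integral_const_mul, ibp]
  ring

/-- A smooth approximate solution of `(H(A) - E) φ = f`, in the pointwise sense, yields a point of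
the spectrum at distance at most `‖f‖ / ‖φ‖` from `E`. -/
theorem infEDist_realSpectrum_le_of_pointwise (A : C(Plane, Plane)) (V : C(Plane, ℝ)) {C : ℝ}
    (hC : ∀ x, |V x| ≤ C) (E : ℝ) {φ f : Plane → ℂ} (hφ : ContDiff ℝ ∞ φ)
    (h2 : MemLp φ 2 (volume : Measure Plane)) (hf : MemLp f 2 (volume : Measure Plane))
    (hm : ∀ j, MemLp (magMomentum A j φ) 2 (volume : Measure Plane)) (hne : h2.toLp φ ≠ 0)
    {w' : Fin 2 → Plane → ℂ}
    (hd : ∀ j x, HasLineDerivAt ℝ (magMomentum A j φ) (w' j x) x (coordDir j))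
    (hi : ∀ (j : Fin 2) (χ : testSpace), Integrable fun x => conj ((χ : Plane → ℂ) x) * w' j x)
    (heq : ∀ x, ∑ j, (-Complex.I * w' j x - (A x j : ℂ) * magMomentum A j φ x) + (V x : ℂ) * φ x =
      (E : ℂ) * φ x + f x) :
    Metric.infEDist E (realSpectrum (hamiltonian A V)) ≤
      ENNReal.ofReal (‖hf.toLp f‖ / ‖h2.toLp φ‖) := by
  refine infEDist_realSpectrum_le A V hC E (mem_formClosure_of_contDiff A hφ h2 hm) hne fun χ => ?_
  have hcs : HasCompactSupport fun x => conj ((χ : Plane → ℂ) x) :=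
    χ.2.2.comp_left (g := fun z : ℂ => conj z) (by simp)
  have hcc : Continuous fun x => conj ((χ : Plane → ℂ) x) :=
    Complex.continuous_conj.comp χ.2.1.continuous
  have e1 (j : Fin 2) : ⟪momentumTest A j χ, (hm j).toLp (magMomentum A j φ)⟫_ℂ =
      ∫ x, conj ((χ : Plane → ℂ) x) *
        (-Complex.I * w' j x - (A x j : ℂ) * magMomentum A j φ x) := by
    rw [← integral_conj_magMomentum_mul A j χ (magMomentum_continuous A hφ j) (hd j) (hi j χ),
      L2.inner_def]
    refine integral_congr_ae ?_
    filter_upwards [momentumTest_coeFn A j χ, (hm j).coeFn_toLp] with x a1 a2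
    rw [a1, a2, RCLike.inner_apply, mul_comm]
  have e2 : ⟪mulTest (complexify V) χ, h2.toLp φ⟫_ℂ =
      ∫ x, conj ((χ : Plane → ℂ) x) * ((V x : ℂ) * φ x) := by
    rw [L2.inner_def]
    refine integral_congr_ae ?_
    filter_upwards [mulTest_coeFn (complexify V) χ, h2.coeFn_toLp] with x a1 a2
    rw [a1, a2, RCLike.inner_apply]
    simp only [complexify, ContinuousMap.coe_mk, map_mul, Complex.conj_ofReal]
    ring
  have e3 : ⟪testToL2 χ, (E : ℂ) • h2.toLp φ + hf.toLp f⟫_ℂ =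
      ∫ x, conj ((χ : Plane → ℂ) x) * ((E : ℂ) * φ x + f x) := by
    rw [L2.inner_def]
    refine integral_congr_ae ?_
    filter_upwards [mulTest_coeFn 1 χ, h2.coeFn_toLp, hf.coeFn_toLp,
      Lp.coeFn_add ((E : ℂ) • h2.toLp φ) (hf.toLp f), Lp.coeFn_smul (E : ℂ) (h2.toLp φ)]
      with x a1 a2 a3 a4 a5
    rw [testToL2, a1, a4, Pi.add_apply, a5, Pi.smul_apply, a2, a3, RCLike.inner_apply]
    simp only [ContinuousMap.one_apply, one_mul, smul_eq_mul]
    ring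
  have i1 (j : Fin 2) : Integrable fun x => conj ((χ : Plane → ℂ) x) *
      (-Complex.I * w' j x - (A x j : ℂ) * magMomentum A j φ x) := by
    have hA : Continuous fun x => ((A x j : ℝ) : ℂ) := by fun_prop
    have := ((hi j χ).const_mul (-Complex.I)).sub
      ((hcc.mul (hA.mul (magMomentum_continuous A hφ j))).integrable_of_hasCompactSupport
        hcs.mul_right)
    refine this.congr (ae_of_all _ fun x => ?_)
    simp only [Pi.sub_apply, Pi.mul_apply]
    ring
  have i2 : Integrable fun x => conj ((χ : Plane → ℂ) x) * ((V x : ℂ) * φ x) := by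
    have hV : Continuous fun x => ((V x : ℝ) : ℂ) := by fun_prop
    exact (hcc.mul (hV.mul hφ.continuous)).integrable_of_hasCompactSupport hcs.mul_right
  rw [e2, e3]
  simp only [e1]
  rw [← integral_finsetSum _ fun j _ => i1 j, ← integral_add (integrable_finsetSum _ fun j _ => i1 j) i2]
  refine integral_congr_ae (ae_of_all _ fun x => ?_)
  simp only
  rw [← heq x, ← Finset.mul_sum, ← mul_add]

/-! ### Landau functions and the trial state estimate. -/

/-- The conjugate complex coordinate of `x` relative to the centre `c`. -/
def conjCoord (c x : Plane) : ℂ := ((x 0 - c 0 : ℝ) : ℂ) - Complex.I * ((x 1 - c 1 : ℝ) : ℂ)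

/-- The state of angular momentum `-k` in the Landau level `k` of the constant field `b`, in the
symmetric gauge centred at `c`. -/
def landau (b : ℝ) (c : Plane) (k : ℕ) (x : Plane) : ℂ :=
  conjCoord c x ^ k * (Real.exp (-(b / 4) * ((x 0 - c 0) ^ 2 + (x 1 - c 1) ^ 2)) : ℂ)

theorem norm_sub_sq_plane (c x : Plane) : ‖x - c‖ ^ 2 = (x 0 - c 0) ^ 2 + (x 1 - c 1) ^ 2 := by
  rw [EuclideanSpace.norm_sq_eq, Fin.sum_univ_two]
  simp

theorem norm_conjCoord (c x : Plane) : ‖conjCoord c x‖ = ‖x - c‖ := by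
  refine (sq_eq_sq₀ (norm_nonneg _) (norm_nonneg _)).1 ?_
  rw [norm_sub_sq_plane, ← Complex.normSq_eq_norm_sq, Complex.normSq_apply, conjCoord]
  simp
  ring

theorem norm_landau (b : ℝ) (c : Plane) (k : ℕ) (x : Plane) :
    ‖landau b c k x‖ = ‖x - c‖ ^ k * Real.exp (-(b / 4) * ‖x - c‖ ^ 2) := by
  rw [landau, norm_mul, norm_pow, norm_conjCoord, Complex.norm_real,
    Real.norm_of_nonneg (Real.exp_pos _).le, norm_sub_sq_plane]

theorem landau_succ (b : ℝ) (c : Plane) (k : ℕ) (x : Plane) :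
    landau b c (k + 1) x = conjCoord c x * landau b c k x := by
  simp only [landau]; ring

theorem landau_contDiff (b : ℝ) (c : Plane) (k : ℕ) : ContDiff ℝ ∞ (landau b c k) := by
  have h (j : Fin 2) : ContDiff ℝ ∞ fun x : Plane => x j - c j := by fun_prop
  have h' (j : Fin 2) : ContDiff ℝ ∞ fun x : Plane => ((x j - c j : ℝ) : ℂ) :=
    Complex.ofRealCLM.contDiff.comp (h j)
  refine ContDiff.mul (((h' 0).sub (contDiff_const.mul (h' 1))).pow k) ?_
  exact Complex.ofRealCLM.contDiff.comp
    (contDiff_const.mul (((h 0).pow 2).add ((h 1).pow 2))).exp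

/-- For `k = 0` the truncated index `k - 1` is harmless, because its coefficient vanishes. -/
theorem landau_hasLineDerivAt_zero (b : ℝ) (c : Plane) (k : ℕ) (x : Plane) :
    HasLineDerivAt ℝ (landau b c k)
      (k * landau b c (k - 1) x - (b / 2 : ℝ) * ((x 0 - c 0 : ℝ) : ℂ) * landau b c k x) x
      (coordDir 0) := by
  have h0 : HasDerivAt (fun t : ℝ => x 0 + t - c 0) 1 0 :=
    ((hasDerivAt_id (0 : ℝ)).const_add (x 0)).sub_const (c 0)
  have h1 : HasDerivAt (fun t : ℝ => ((x 0 + t - c 0 : ℝ) : ℂ) -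
      Complex.I * ((x 1 - c 1 : ℝ) : ℂ)) 1 0 := by
    simpa using (h0.ofReal_comp).sub_const (Complex.I * ((x 1 - c 1 : ℝ) : ℂ))
  have h2 := (((h0.pow 2).add_const ((x 1 - c 1) ^ 2)).const_mul (-(b / 4))).exp.ofReal_comp
  have h3 := (h1.pow k).mul h2
  refine (h3.congr_of_eventuallyEq (Eventually.of_forall fun t => ?_)).congr_deriv ?_
  · simp [landau, conjCoord]
  · simp only [landau, conjCoord, Pi.pow_apply, add_zero]
    push_cast
    ring

theorem landau_hasLineDerivAt_one (b : ℝ) (c : Plane) (k : ℕ) (x : Plane) :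
    HasLineDerivAt ℝ (landau b c k)
      (-Complex.I * (k * landau b c (k - 1) x) -
        (b / 2 : ℝ) * ((x 1 - c 1 : ℝ) : ℂ) * landau b c k x) x (coordDir 1) := by
  have h0 : HasDerivAt (fun t : ℝ => x 1 + t - c 1) 1 0 :=
    ((hasDerivAt_id (0 : ℝ)).const_add (x 1)).sub_const (c 1)
  have h1 : HasDerivAt (fun t : ℝ => ((x 0 - c 0 : ℝ) : ℂ) -
      Complex.I * ((x 1 + t - c 1 : ℝ) : ℂ)) (-Complex.I) 0 := by
    simpa using ((h0.ofReal_comp).const_mul Complex.I).const_sub ((x 0 - c 0 : ℝ) : ℂ)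
  have h2 := (((h0.pow 2).const_add ((x 0 - c 0) ^ 2)).const_mul (-(b / 4))).exp.ofReal_comp
  have h3 := (h1.pow k).mul h2
  refine (h3.congr_of_eventuallyEq (Eventually.of_forall fun t => ?_)).congr_deriv ?_
  · simp [landau, conjCoord]
  · simp only [landau, conjCoord, Pi.pow_apply, add_zero]
    push_cast
    ring

theorem partialDeriv_eq_of_hasLineDerivAt {f : Plane → ℂ} (hf : ContDiff ℝ ∞ f) {j : Fin 2}
    {x : Plane} {d : ℂ} (h : HasLineDerivAt ℝ f d x (coordDir j)) : partialDeriv j f x = d :=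
  HasDerivAt.unique ((hf.differentiable (by simp) x).hasFDerivAt.hasLineDerivAt (coordDir j)) h

/-- The linear part of `A` combines with the derivative of the Gaussian to the conjugate coordinate,
so the unperturbed momentum is a combination of the neighbouring functions `n - 1` and `n + 1`. -/
theorem magMomentum_landau_zero {A : Plane → Plane} {b : ℝ} {c : Plane} (n : ℕ) {a : Plane → ℝ}
    (hA : ∀ x, A x 0 = -(b / 2) * (x 1 - c 1) + a x) (x : Plane) :
    magMomentum A 0 (landau b c n) x =
      Complex.I * (-n * landau b c (n - 1) x + (b / 2 : ℝ) * landau b c (n + 1) x) -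
        a x * landau b c n x := by
  rw [magMomentum, partialDeriv_eq_of_hasLineDerivAt (landau_contDiff b c n)
    (landau_hasLineDerivAt_zero b c n x), hA, landau_succ, conjCoord]
  push_cast
  linear_combination ((b / 2 : ℂ) * (x 1 - c 1) * landau b c n x) * Complex.I_sq

theorem magMomentum_landau_one {A : Plane → Plane} {b : ℝ} {c : Plane} (n : ℕ)
    (hA : ∀ x, A x 1 = b / 2 * (x 0 - c 0)) (x : Plane) :
    magMomentum A 1 (landau b c n) x =
      -n * landau b c (n - 1) x - (b / 2 : ℝ) * landau b c (n + 1) x := by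
  rw [magMomentum, partialDeriv_eq_of_hasLineDerivAt (landau_contDiff b c n)
    (landau_hasLineDerivAt_one b c n x), hA, landau_succ, conjCoord]
  push_cast
  linear_combination ((n : ℂ) * landau b c (n - 1) x) * Complex.I_sq

/-- The moment `∫ ‖x‖²ᵏ exp (-‖x‖² / 2)`. -/
def gaussMoment (k : ℕ) : ℝ := ∫ x : Plane, ‖x‖ ^ (2 * k) * Real.exp (-(1 / 2) * ‖x‖ ^ 2)

/-- Polar coordinates reduce the claim to a one-dimensional Gaussian integral with weight `r ^ (2k +
1)`. -/
theorem integrable_gauss {b : ℝ} (hb : 0 < b) (k : ℕ) :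
    Integrable fun x : Plane => ‖x‖ ^ (2 * k) * Real.exp (-b * ‖x‖ ^ 2) := by
  rw [integrable_fun_norm_addHaar (volume : Measure Plane)
    (f := fun r => r ^ (2 * k) * Real.exp (-b * r ^ 2))]
  have h := integrable_rpow_mul_exp_neg_mul_sq hb (s := (2 * k + 1 : ℕ))
    (by push_cast; linarith [(Nat.cast_nonneg k : (0 : ℝ) ≤ k)])
  refine (h.integrableOn (s := Ioi 0)).congr_fun (fun r hr => ?_) measurableSet_Ioi
  simp only [finrank_euclideanSpace, Fintype.card_fin, smul_eq_mul, Real.rpow_natCast]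
  ring

theorem gaussMoment_pos (k : ℕ) : 0 < gaussMoment k := by
  rw [gaussMoment, integral_pos_iff_support_of_nonneg (fun x => by positivity)
    (integrable_gauss (by norm_num) k)]
  have hsub : ({0}ᶜ : Set Plane) ⊆
      Function.support fun x : Plane => ‖x‖ ^ (2 * k) * Real.exp (-(1 / 2) * ‖x‖ ^ 2) := by
    intro x hx
    have : 0 < ‖x‖ := norm_pos_iff.2 hx
    exact (by positivity : 0 < ‖x‖ ^ (2 * k) * Real.exp (-(1 / 2) * ‖x‖ ^ 2)).ne'
  exact (isOpen_compl_singleton.measure_pos volume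
    ⟨coordDir 0, by simp⟩).trans_le (measure_mono hsub)

/-- Translation to the centre and the substitution `y ↦ √b • y`. Each further factor `‖x - c‖` thus
costs `b^(-1/2)` in the `L²` norm, which gives all powers of `b` in the final estimate. -/
theorem integral_norm_landau_sq {b : ℝ} (hb : 0 < b) (c : Plane) (k : ℕ) :
    ∫ x, ‖landau b c k x‖ ^ 2 = (b ^ (k + 1))⁻¹ * gaussMoment k := by
  have e (x : Plane) : ‖landau b c k x‖ ^ 2 =
      (fun y : Plane => ‖y‖ ^ (2 * k) * Real.exp (-(b / 2) * ‖y‖ ^ 2)) (x - c) := by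
    rw [norm_landau, mul_pow, ← Real.exp_nat_mul]
    ring_nf
  simp only [e]
  rw [integral_sub_right_eq_self (fun y : Plane => ‖y‖ ^ (2 * k) * Real.exp (-(b / 2) * ‖y‖ ^ 2)) c]
  have h := Measure.integral_comp_smul (volume : Measure Plane)
    (fun y : Plane => ‖y‖ ^ (2 * k) * Real.exp (-(1 / 2) * ‖y‖ ^ 2)) (√b)
  have hs : √b ^ 2 = b := Real.sq_sqrt hb.le
  have e2 (y : Plane) : ‖√b • y‖ ^ (2 * k) * Real.exp (-(1 / 2) * ‖√b • y‖ ^ 2) =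
      b ^ k * (‖y‖ ^ (2 * k) * Real.exp (-(b / 2) * ‖y‖ ^ 2)) := by
    rw [norm_smul, Real.norm_of_nonneg (Real.sqrt_nonneg b), mul_pow, mul_pow, pow_mul, hs]
    ring_nf
  simp only [e2] at h
  rw [integral_const_mul, finrank_euclideanSpace, Fintype.card_fin, hs, abs_of_pos (by positivity),
    smul_eq_mul] at h
  rw [gaussMoment]
  have hbk : b ^ k ≠ 0 := by positivity
  rw [pow_succ, mul_inv, mul_assoc, ← h, inv_mul_cancel_left₀ hbk]

theorem landau_memLp {b : ℝ} (hb : 0 < b) (c : Plane) (k : ℕ) :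
    MemLp (landau b c k) 2 (volume : Measure Plane) := by
  rw [memLp_two_iff_integrable_sq_norm (landau_contDiff b c k).continuous.aestronglyMeasurable]
  have h := (integrable_gauss (half_pos hb) k).comp_sub_right c
  refine h.congr (ae_of_all _ fun x => ?_)
  simp only
  rw [norm_landau, mul_pow, ← Real.exp_nat_mul]
  ring_nf

/-- The Landau functions as elements of `L²`. -/
def landauL2 {b : ℝ} (hb : 0 < b) (c : Plane) (k : ℕ) : L2Plane :=
  (landau_memLp hb c k).toLp _

theorem norm_landauL2 {b : ℝ} (hb : 0 < b) (c : Plane) (k : ℕ) :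
    ‖landauL2 hb c k‖ = (√b ^ (k + 1))⁻¹ * √(gaussMoment k) := by
  have h : ‖landauL2 hb c k‖ ^ 2 = ∫ x, ‖landau b c k x‖ ^ 2 := by
    rw [norm_sq_eq_integral]
    refine integral_congr_ae ?_
    filter_upwards [(landau_memLp hb c k).coeFn_toLp] with x hx
    rw [landauL2, hx]
  rw [integral_norm_landau_sq hb] at h
  refine (sq_eq_sq₀ (norm_nonneg _) (by positivity)).1 ?_
  rw [h, mul_pow, inv_pow, ← pow_mul, mul_comm (k + 1) 2, pow_mul, Real.sq_sqrt hb.le,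
    Real.sq_sqrt (gaussMoment_pos k).le]

/-- The error term of the Landau function `landau b c n`, if the vector potential of the constant
field `b` is perturbed by `a` in the first component and the electric potential is `v` up to a
constant; `a'` is the derivative of `a` in the first coordinate. -/
def landauError (b : ℝ) (c : Plane) (n : ℕ) (a a' v : Plane → ℝ) (x : Plane) : ℂ :=
  -2 * a x * (Complex.I * (-n * landau b c (n - 1) x + (b / 2 : ℝ) * landau b c (n + 1) x)) +
    (Complex.I * a' x + (a x : ℂ) ^ 2 + v x) * landau b c n x

/-- The line derivative of `landau b c k` in the first coordinate direction. -/
def landauDerivZero (b : ℝ) (c : Plane) (k : ℕ) (x : Plane) : ℂ :=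
  k * landau b c (k - 1) x - (b / 2 : ℝ) * ((x 0 - c 0 : ℝ) : ℂ) * landau b c k x

/-- The line derivative of `landau b c k` in the second coordinate direction. -/
def landauDerivOne (b : ℝ) (c : Plane) (k : ℕ) (x : Plane) : ℂ :=
  -Complex.I * (k * landau b c (k - 1) x) -
    (b / 2 : ℝ) * ((x 1 - c 1 : ℝ) : ℂ) * landau b c k x

/-- With `P` the unperturbed first momentum component, `(P - a)² = P² - 2 a P + i a' + a²`. The
unperturbed squares sum to `(2n+1) b` on the Landau function, and the remainder is `landauError`. -/
theorem landau_eigen_identity (b : ℝ) (c : Plane) (n : ℕ) (a a' v : Plane → ℝ) (x : Plane) :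
    (-Complex.I * (Complex.I * (-n * landauDerivZero b c (n - 1) x +
            (b / 2 : ℝ) * landauDerivZero b c (n + 1) x) -
          (a' x * landau b c n x + a x * landauDerivZero b c n x)) -
        ((-(b / 2) * (x 1 - c 1) + a x : ℝ) : ℂ) *
          (Complex.I * (-n * landau b c (n - 1) x + (b / 2 : ℝ) * landau b c (n + 1) x) -
            a x * landau b c n x)) +
      (-Complex.I * (-n * landauDerivOne b c (n - 1) x -
            (b / 2 : ℝ) * landauDerivOne b c (n + 1) x) -
        ((b / 2 * (x 0 - c 0) : ℝ) : ℂ) *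
          (-n * landau b c (n - 1) x - (b / 2 : ℝ) * landau b c (n + 1) x)) +
      v x * landau b c n x =
      (((2 * n + 1) * b : ℝ) : ℂ) * landau b c n x + landauError b c n a a' v x := by
  have hI : Complex.I * Complex.I = -1 := Complex.I_mul_I
  have h3 : Complex.I ^ 3 = -Complex.I := by rw [pow_succ, sq, hI]; ring
  -- For `n = m + 1` every function can be expressed through those of index `m` and `m - 1`. The
  -- latter appears only in terms that cancel, so it may be an arbitrary number.
  rcases n with _ | m
  · simp only [landauError, landauDerivZero, landauDerivOne, landau_succ, conjCoord]
    push_cast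
    ring_nf
    simp only [Complex.I_sq, h3]
    ring
  · simp only [landauError, landauDerivZero, landauDerivOne, landau_succ, conjCoord,
      Nat.add_sub_cancel]
    push_cast
    generalize landau b c (m - 1) x = p
    ring_nf
    simp only [Complex.I_sq, h3, Complex.I_pow_four]
    ring

theorem norm_natCast_mul_landau (b : ℝ) (c : Plane) (n : ℕ) (x : Plane) :
    ‖x - c‖ ^ 2 * ‖(n : ℂ) * landau b c (n - 1) x‖ = n * ‖landau b c (n + 1) x‖ := by
  rcases n with _ | m
  · simp
  · rw [norm_mul, Complex.norm_natCast, norm_landau, norm_landau, Nat.add_sub_cancel]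
    ring

theorem norm_landau_add (b : ℝ) (c : Plane) (n k : ℕ) (x : Plane) :
    ‖landau b c (n + k) x‖ = ‖x - c‖ ^ k * ‖landau b c n x‖ := by
  rw [norm_landau, norm_landau]; ring

/-- Powers of `‖x - c‖` raise the index of the Landau function. In `-2 a P` the lowering part gives
`2nβ` at index `n + 1` and the raising part `β b` at `n + 3`. The terms `a'` and `v` add `β + γ` at
`n + 1`, and `a²` gives `β²` at `n + 4`. -/
theorem norm_landauError_le {b β γ : ℝ} (hb : 0 ≤ b) (c : Plane) (n : ℕ)
    {a a' v : Plane → ℝ}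
    {x : Plane} (ha : |a x| ≤ β * ‖x - c‖ ^ 2) (ha' : |a' x| ≤ β * ‖x - c‖)
    (hv : |v x| ≤ γ * ‖x - c‖) :
    ‖landauError b c n a a' v x‖ ≤ ((2 * n + 1) * β + γ) * ‖landau b c (n + 1) x‖ +
      β * b * ‖landau b c (n + 3) x‖ + β ^ 2 * ‖landau b c (n + 4) x‖ := by
  have h1 : ‖Complex.I * (-n * landau b c (n - 1) x + (b / 2 : ℝ) * landau b c (n + 1) x)‖ ≤
      ‖(n : ℂ) * landau b c (n - 1) x‖ + b / 2 * ‖landau b c (n + 1) x‖ := by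
    rw [norm_mul, Complex.norm_I, one_mul]
    refine (norm_add_le _ _).trans (le_of_eq ?_)
    rw [neg_mul, norm_neg, norm_mul ((b / 2 : ℝ) : ℂ), Complex.norm_real,
      Real.norm_of_nonneg (by positivity)]
  have h2 : ‖Complex.I * a' x + (a x : ℂ) ^ 2 + v x‖ ≤ |a' x| + |a x| ^ 2 + |v x| := by
    refine (norm_add₃_le).trans (le_of_eq ?_)
    simp
  have h3 : |a x| ^ 2 ≤ (β * ‖x - c‖ ^ 2) ^ 2 := pow_le_pow_left₀ (abs_nonneg _) ha 2
  calc ‖landauError b c n a a' v x‖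
      ≤ 2 * |a x| * (‖(n : ℂ) * landau b c (n - 1) x‖ + b / 2 * ‖landau b c (n + 1) x‖) +
        (|a' x| + |a x| ^ 2 + |v x|) * ‖landau b c n x‖ := by
        refine (norm_add_le _ _).trans (add_le_add ?_ ?_)
        · rw [norm_mul]
          refine mul_le_mul (le_of_eq (by simp)) h1 (norm_nonneg _) (by positivity)
        · rw [norm_mul]
          exact mul_le_mul_of_nonneg_right h2 (norm_nonneg _)
    _ ≤ 2 * (β * ‖x - c‖ ^ 2) *
          (‖(n : ℂ) * landau b c (n - 1) x‖ + b / 2 * ‖landau b c (n + 1) x‖) +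
        (β * ‖x - c‖ + (β * ‖x - c‖ ^ 2) ^ 2 + γ * ‖x - c‖) * ‖landau b c n x‖ := by
        gcongr
    _ = 2 * β * (‖x - c‖ ^ 2 * ‖(n : ℂ) * landau b c (n - 1) x‖) +
        b * β * ‖x - c‖ ^ 2 * ‖landau b c (n + 1) x‖ +
        (β * ‖x - c‖ + (β * ‖x - c‖ ^ 2) ^ 2 + γ * ‖x - c‖) * ‖landau b c n x‖ := by ring
    _ = _ := by
        rw [norm_natCast_mul_landau, norm_landau_add b c n 1, norm_landau_add b c n 3,
          norm_landau_add b c n 4]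
        ring

theorem norm_toLp_le_three {f : Plane → ℂ} {g₁ g₂ g₃ : Plane → ℂ}
    (hf : MemLp f 2 (volume : Measure Plane)) (h₁ : MemLp g₁ 2 (volume : Measure Plane))
    (h₂ : MemLp g₂ 2 (volume : Measure Plane)) (h₃ : MemLp g₃ 2 (volume : Measure Plane))
    {c₁ c₂ c₃ : ℝ} (hc₁ : 0 ≤ c₁) (hc₂ : 0 ≤ c₂) (hc₃ : 0 ≤ c₃)
    (h : ∀ x, ‖f x‖ ≤ c₁ * ‖g₁ x‖ + c₂ * ‖g₂ x‖ + c₃ * ‖g₃ x‖) :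
    ‖hf.toLp f‖ ≤ c₁ * ‖h₁.toLp g₁‖ + c₂ * ‖h₂.toLp g₂‖ + c₃ * ‖h₃.toLp g₃‖ := by
  have k₁ := h₁.norm.const_smul c₁
  have k₂ := h₂.norm.const_smul c₂
  have k₃ := h₃.norm.const_smul c₃
  have e {g : Plane → ℂ} (hg : MemLp g 2 (volume : Measure Plane)) {c : ℝ} (hc : 0 ≤ c) :
      ‖(hg.norm.const_smul c).toLp _‖ = c * ‖hg.toLp g‖ := by
    rw [Lp.norm_toLp, Lp.norm_toLp, eLpNorm_const_smul, eLpNorm_norm, ENNReal.toReal_mul]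
    simp [abs_of_nonneg hc]
  rw [← e h₁ hc₁, ← e h₂ hc₂, ← e h₃ hc₃]
  refine le_trans ?_ norm_add₃_le
  rw [← MemLp.toLp_add, ← MemLp.toLp_add]
  refine Lp.norm_le_norm_of_ae_le ?_
  filter_upwards [hf.coeFn_toLp, ((k₁.add k₂).add k₃).coeFn_toLp] with x e1 e2
  rw [e1, e2]
  exact (h x).trans (le_abs_self _)

theorem memLp_of_norm_le_three {f : Plane → ℂ} {g₁ g₂ g₃ : Plane → ℂ}
    (hf : AEStronglyMeasurable f (volume : Measure Plane))
    (h₁ : MemLp g₁ 2 (volume : Measure Plane))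
    (h₂ : MemLp g₂ 2 (volume : Measure Plane)) (h₃ : MemLp g₃ 2 (volume : Measure Plane))
    {c₁ c₂ c₃ : ℝ} (h : ∀ x, ‖f x‖ ≤ c₁ * ‖g₁ x‖ + c₂ * ‖g₂ x‖ + c₃ * ‖g₃ x‖) :
    MemLp f 2 (volume : Measure Plane) :=
  (((h₁.norm.const_mul c₁).add (h₂.norm.const_mul c₂)).add (h₃.norm.const_mul c₃)).mono hf
    (ae_of_all _ fun x => (h x).trans (le_abs_self _))

theorem integrable_conj_test_mul (χ : testSpace) {w : Plane → ℂ} (hw : Continuous w) :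
    Integrable fun x => conj ((χ : Plane → ℂ) x) * w x := by
  have hcs : HasCompactSupport fun x => conj ((χ : Plane → ℂ) x) :=
    χ.2.2.comp_left (g := fun z : ℂ => conj z) (by simp)
  exact ((Complex.continuous_conj.comp χ.2.1.continuous).mul hw).integrable_of_hasCompactSupport
    hcs.mul_right

theorem integrable_conj_test_mul_of_le (χ : testSpace) {w : Plane → ℂ} {g : Plane → ℝ}
    (hw : AEStronglyMeasurable w (volume : Measure Plane)) (hg : Continuous g)
    (h : ∀ x, ‖w x‖ ≤ g x) : Integrable fun x => conj ((χ : Plane → ℂ) x) * w x := by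
  refine (integrable_conj_test_mul χ (w := fun x => (g x : ℂ)) (by fun_prop)).mono
    ((Complex.continuous_conj.comp χ.2.1.continuous).aestronglyMeasurable.mul hw)
    (ae_of_all _ fun x => ?_)
  rw [norm_mul, norm_mul, Complex.norm_real]
  exact mul_le_mul_of_nonneg_left ((h x).trans (le_abs_self _)) (norm_nonneg _)

theorem continuous_landauDerivZero (b : ℝ) (c : Plane) (k : ℕ) :
    Continuous (landauDerivZero b c k) := by
  have h1 := (landau_contDiff b c (k - 1)).continuous
  have h2 := (landau_contDiff b c k).continuous
  unfold landauDerivZero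
  fun_prop

theorem continuous_landauDerivOne (b : ℝ) (c : Plane) (k : ℕ) :
    Continuous (landauDerivOne b c k) := by
  have h1 := (landau_contDiff b c (k - 1)).continuous
  have h2 := (landau_contDiff b c k).continuous
  unfold landauDerivOne
  fun_prop

/-- The constant in the estimate of the distance of a local Landau level from the spectrum. -/
def landauConst (n : ℕ) : ℝ :=
  ((2 * n + 1) * √(gaussMoment (n + 1)) + √(gaussMoment (n + 3)) + √(gaussMoment (n + 4))) /
    √(gaussMoment n)

theorem landauConst_pos (n : ℕ) : 0 < landauConst n := by
  have h (k : ℕ) : 0 < √(gaussMoment k) := Real.sqrt_pos.2 (gaussMoment_pos k)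
  have h0 := h n
  have h1 := h (n + 1)
  have h3 := h (n + 3)
  have h4 := h (n + 4)
  unfold landauConst
  positivity

/-- Relative to index `n`, the indices `n + 1`, `n + 3`, `n + 4` scale like `b^(-1/2)`, `b^(-3/2)`,
`b^(-2)`. The prefactor `b` of the middle term brings it to the order of the first. -/
theorem norm_landauL2_ratio_le {b β γ : ℝ} (hb : 0 < b) (hβ : 0 ≤ β) (hγ : 0 ≤ γ) (c : Plane)
    (n : ℕ) :
    (((2 * n + 1) * β + γ) * ‖landauL2 hb c (n + 1)‖ + β * b * ‖landauL2 hb c (n + 3)‖ +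
      β ^ 2 * ‖landauL2 hb c (n + 4)‖) / ‖landauL2 hb c n‖ ≤
      landauConst n * ((β + γ) / √b + β ^ 2 / b ^ 2) := by
  have h (k : ℕ) : 0 < √(gaussMoment k) := Real.sqrt_pos.2 (gaussMoment_pos k)
  have h0 := h n
  have h1 := h (n + 1)
  have h3 := h (n + 3)
  have h4 := h (n + 4)
  simp only [norm_landauL2, landauConst]
  obtain ⟨s, hs, rfl⟩ : ∃ s, 0 < s ∧ b = s ^ 2 :=
    ⟨√b, Real.sqrt_pos.2 hb, (Real.sq_sqrt hb.le).symm⟩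
  rw [Real.sqrt_sq hs.le]
  have e : (((2 * n + 1) * β + γ) * ((s ^ (n + 1 + 1))⁻¹ * √(gaussMoment (n + 1))) +
      β * s ^ 2 * ((s ^ (n + 3 + 1))⁻¹ * √(gaussMoment (n + 3))) +
      β ^ 2 * ((s ^ (n + 4 + 1))⁻¹ * √(gaussMoment (n + 4)))) /
        ((s ^ (n + 1))⁻¹ * √(gaussMoment n)) =
      (((2 * n + 1) * β + γ) / s * √(gaussMoment (n + 1)) + β / s * √(gaussMoment (n + 3)) +
        β ^ 2 / (s ^ 2) ^ 2 * √(gaussMoment (n + 4))) / √(gaussMoment n) := by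
    field_simp
    ring
  rw [e, div_mul_eq_mul_div _ _ ((β + γ) / s + _)]
  refine div_le_div_of_nonneg_right ?_ h0.le
  have p : 0 ≤ β ^ 2 / (s ^ 2) ^ 2 := by positivity
  have q : 0 ≤ β / s := by positivity
  have r : 0 ≤ γ / s := by positivity
  rw [add_div ((2 * n + 1) * β), mul_div_assoc, add_div]
  have hn : (0 : ℝ) ≤ n := n.cast_nonneg
  generalize β ^ 2 / (s ^ 2) ^ 2 = P at *
  generalize β / s = Q at *
  generalize γ / s = T at *
  have k1 : 0 ≤ (2 * n * T + (2 * n + 1) * P) * √(gaussMoment (n + 1)) := by positivity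
  have k2 : 0 ≤ (T + P) * √(gaussMoment (n + 3)) := by positivity
  have k3 : 0 ≤ (Q + T) * √(gaussMoment (n + 4)) := by positivity
  nlinarith

theorem infEDist_landau_le (A : C(Plane, Plane)) (V : C(Plane, ℝ)) {C : ℝ} (hC : ∀ x, |V x| ≤ C)
    {b β γ : ℝ} (hb : 0 < b) (hβ : 0 ≤ β) (hγ : 0 ≤ γ) (c : Plane) (n : ℕ) {a a' : Plane → ℝ}
    (hA₀ : ∀ x, A x 0 = -(b / 2) * (x 1 - c 1) + a x) (hA₁ : ∀ x, A x 1 = b / 2 * (x 0 - c 0))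
    (hac : Continuous a) (ham : Measurable a')
    (had : ∀ x, HasLineDerivAt ℝ a (a' x) x (coordDir 0))
    (ha : ∀ x, |a x| ≤ β * ‖x - c‖ ^ 2) (ha' : ∀ x, |a' x| ≤ β * ‖x - c‖)
    (hV : ∀ x, |V x - V c| ≤ γ * ‖x - c‖) :
    Metric.infEDist ((2 * n + 1) * b + V c) (realSpectrum (hamiltonian A V)) ≤
      ENNReal.ofReal (landauConst n * ((β + γ) / √b + β ^ 2 / b ^ 2)) := by
  have hlc (k : ℕ) : Continuous (landau b c k) := (landau_contDiff b c k).continuous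
  have hL := landau_memLp hb c
  have hbound (x : Plane) := norm_landauError_le hb.le c n (v := fun x => V x - V c)
    (ha x) (ha' x) (hV x)
  have hac' : Continuous fun x => (a x : ℂ) := by fun_prop
  have ham' : Measurable fun x => (a' x : ℂ) := Complex.measurable_ofReal.comp ham
  have hVc : Continuous fun x => ((V x - V c : ℝ) : ℂ) := by fun_prop
  have hfm : AEStronglyMeasurable (landauError b c n a a' fun x => V x - V c)
      (volume : Measure Plane) := by
    refine Measurable.aestronglyMeasurable ?_
    have := (hlc (n - 1)).measurable
    have := (hlc (n + 1)).measurable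
    have := (hlc n).measurable
    have := hac'.measurable
    have := hVc.measurable
    unfold landauError
    fun_prop
  have hf := memLp_of_norm_le_three hfm (hL (n + 1)) (hL (n + 3)) (hL (n + 4)) hbound
  have hm0 : magMomentum A 0 (landau b c n) = fun x =>
      Complex.I * (-n * landau b c (n - 1) x + (b / 2 : ℝ) * landau b c (n + 1) x) -
        a x * landau b c n x := funext fun x => magMomentum_landau_zero n hA₀ x
  have hm1 : magMomentum A 1 (landau b c n) = fun x =>
      -n * landau b c (n - 1) x - (b / 2 : ℝ) * landau b c (n + 1) x :=
    funext fun x => magMomentum_landau_one n hA₁ x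
  have hd0 (k : ℕ) (x : Plane) : HasLineDerivAt ℝ (landau b c k) (landauDerivZero b c k x) x
      (coordDir 0) := landau_hasLineDerivAt_zero b c k x
  have hd1 (k : ℕ) (x : Plane) : HasLineDerivAt ℝ (landau b c k) (landauDerivOne b c k x) x
      (coordDir 1) := landau_hasLineDerivAt_one b c k x
  have hae : MemLp (fun x => (a x : ℂ) * landau b c n x) 2 (volume : Measure Plane) := by
    refine ((hL (n + 2)).norm.const_mul β).mono (hac'.mul (hlc n)).aestronglyMeasurable
      (ae_of_all _ fun x => le_trans ?_ (le_abs_self _))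
    rw [norm_mul, Complex.norm_real, norm_landau_add b c n 2, ← mul_assoc]
    exact mul_le_mul_of_nonneg_right (ha x) (norm_nonneg _)
  have hne : (hL n).toLp _ ≠ 0 := by
    rw [← norm_ne_zero_iff]
    change ‖landauL2 hb c n‖ ≠ 0
    rw [norm_landauL2]
    have := Real.sqrt_pos.2 (gaussMoment_pos n)
    positivity
  let w' : Fin 2 → Plane → ℂ := ![fun x => Complex.I * (-n * landauDerivZero b c (n - 1) x +
      (b / 2 : ℝ) * landauDerivZero b c (n + 1) x) -
        (a' x * landau b c n x + a x * landauDerivZero b c n x),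
    fun x => -n * landauDerivOne b c (n - 1) x - (b / 2 : ℝ) * landauDerivOne b c (n + 1) x]
  have key := infEDist_realSpectrum_le_of_pointwise A V hC ((2 * n + 1) * b + V c)
    (landau_contDiff b c n) (hL n) hf ?_ hne (w' := w') ?_ ?_ ?_
  · refine key.trans (ENNReal.ofReal_le_ofReal ?_)
    refine le_trans (div_le_div_of_nonneg_right ?_ (norm_nonneg _))
      (norm_landauL2_ratio_le hb hβ hγ c n)
    exact norm_toLp_le_three hf (hL (n + 1)) (hL (n + 3)) (hL (n + 4)) (by positivity)
      (by positivity) (by positivity) hbound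
  · rw [Fin.forall_fin_two]
    refine ⟨?_, ?_⟩
    · rw [hm0]
      exact ((((hL (n - 1)).const_mul _).add ((hL (n + 1)).const_mul _)).const_mul _).sub hae
    · rw [hm1]
      exact ((hL (n - 1)).const_mul _).sub ((hL (n + 1)).const_mul _)
  · rw [Fin.forall_fin_two]
    refine ⟨fun x => ?_, fun x => ?_⟩
    · rw [hm0]
      have h1 : HasDerivAt _ _ _ := hd0 (n - 1) x
      have h2 : HasDerivAt _ _ _ := hd0 (n + 1) x
      have h3 : HasDerivAt _ _ _ := hd0 n x
      have h4 := HasDerivAt.ofReal_comp (had x)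
      have h5 := (((h1.const_mul (-n : ℂ)).add (h2.const_mul ((b / 2 : ℝ) : ℂ))).const_mul
        Complex.I).sub (h4.mul h3)
      refine HasDerivAt.congr_deriv h5 ?_
      simp [w']
    · rw [hm1]
      have h1 : HasDerivAt _ _ _ := hd1 (n - 1) x
      have h2 : HasDerivAt _ _ _ := hd1 (n + 1) x
      exact (h1.const_mul (-n : ℂ)).sub (h2.const_mul ((b / 2 : ℝ) : ℂ))
  · rw [Fin.forall_fin_two]
    have c0 := continuous_landauDerivZero b c
    have c1 := continuous_landauDerivOne b c
    refine ⟨fun χ => ?_, fun χ => ?_⟩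
    · have i1 := integrable_conj_test_mul χ (w := fun x => Complex.I *
        (-n * landauDerivZero b c (n - 1) x + (b / 2 : ℝ) * landauDerivZero b c (n + 1) x) -
          a x * landauDerivZero b c n x)
        ((continuous_const.mul ((continuous_const.mul (c0 _)).add
          (continuous_const.mul (c0 _)))).sub (hac'.mul (c0 _)))
      -- The factor `a'` is only measurable, so this term is treated by domination and the
      -- continuous ones separately.
      have i2 := integrable_conj_test_mul_of_le χ (w := fun x => (a' x : ℂ) * landau b c n x)
        (g := fun x => β * ‖x - c‖ * ‖landau b c n x‖)
        (ham'.mul (hlc n).measurable).aestronglyMeasurable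
        (by have := hlc n; fun_prop) (fun x => by
          rw [norm_mul, Complex.norm_real]
          exact mul_le_mul_of_nonneg_right (ha' x) (norm_nonneg _))
      refine (i1.sub i2).congr (ae_of_all _ fun x => ?_)
      simp only [w', Pi.sub_apply, Matrix.cons_val_zero]
      ring
    · exact integrable_conj_test_mul χ ((continuous_const.mul (c1 _)).sub
        (continuous_const.mul (c1 _)))
  · intro x
    have h := landau_eigen_identity b c n a a' (fun x => V x - V c) x
    rw [Fin.sum_univ_two, hA₀, hA₁, hm0, hm1]
    simp only [w', Matrix.cons_val_zero, Matrix.cons_val_one]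
    push_cast at h ⊢
    linear_combination h

/-! ### Local Landau levels of a variable field. -/

theorem abs_sub_le_of_fderiv_le {f : Plane → ℝ} {β : ℝ} (hf : Differentiable ℝ f)
    (h : ∀ x, ‖fderiv ℝ f x‖ ≤ β) (x y : Plane) : |f x - f y| ≤ β * ‖x - y‖ :=
  convex_univ.norm_image_sub_le_of_norm_fderiv_le (fun z _ => hf z) (fun z _ => h z)
    (mem_univ y) (mem_univ x)

theorem abs_coord_sub_le (x c : Plane) (j : Fin 2) : |x j - c j| ≤ ‖x - c‖ :=
  PiLp.norm_apply_le (x - c) j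

theorem norm_vec_two_sub_le {x c : Plane} {t : ℝ} (ht : t ∈ uIoc (c 1) (x 1)) :
    ‖!₂[x 0, t] - c‖ ≤ ‖x - c‖ := by
  refine (sq_le_sq₀ (norm_nonneg _) (norm_nonneg _)).1 ?_
  rw [norm_sub_sq_plane, norm_sub_sq_plane]
  refine add_le_add le_rfl (sq_le_sq.2 ?_)
  change |t - c 1| ≤ |x 1 - c 1|
  exact abs_sub_left_of_mem_uIcc (uIoc_subset_uIcc ht)

theorem abs_verticalIntegral_le_of_le {g : Plane → ℝ} {x c : Plane} {K : ℝ}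
    (h : ∀ y, ‖y - c‖ ≤ ‖x - c‖ → |g y| ≤ K) : |verticalIntegral g (c 1) x| ≤ K * ‖x - c‖ := by
  have hK : 0 ≤ K := (abs_nonneg _).trans (h x le_rfl)
  have h1 : ‖verticalIntegral g (c 1) x‖ ≤ K * |x 1 - c 1| :=
    intervalIntegral.norm_integral_le_of_norm_le_const fun t ht => h _ (norm_vec_two_sub_le ht)
  refine h1.trans ?_
  exact mul_le_mul_of_nonneg_left (abs_coord_sub_le x c 1) hK

/-- Differentiation under the integral with the constant bound `β`. The derivative of `g` is not
assumed continuous, so measurability and the bound have to suffice. -/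
theorem verticalIntegral_hasLineDerivAt_zero {g : Plane → ℝ} {β : ℝ} (hg : Differentiable ℝ g)
    (h : ∀ x, ‖fderiv ℝ g x‖ ≤ β) (s : ℝ) (x : Plane) :
    HasLineDerivAt ℝ (verticalIntegral g s)
      (verticalIntegral (fun y => fderiv ℝ g y (coordDir 0)) s x) x (coordDir 0) := by
  have hc (r : ℝ) : Continuous fun t : ℝ => (!₂[r, t] : Plane) :=
    continuous_vec_two.comp (by fun_prop : Continuous fun t : ℝ => (r, t))
  have hcg (r : ℝ) : Continuous fun t : ℝ => g !₂[r, t] := hg.continuous.comp (hc r)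
  have key := intervalIntegral.hasDerivAt_integral_of_dominated_loc_of_deriv_le
    (μ := volume) (a := s) (b := x 1) (F := fun r t => g !₂[x 0 + r, t])
    (F' := fun r t => fderiv ℝ g !₂[x 0 + r, t] (coordDir 0)) (x₀ := 0) (s := univ)
    (bound := fun _ => β) univ_mem
    (Eventually.of_forall fun r => (hcg (x 0 + r)).aestronglyMeasurable)
    ((hcg _).intervalIntegrable _ _)
    ((measurable_fderiv_apply_const ℝ g (coordDir 0)).comp
      (hc _).measurable).aestronglyMeasurable
    (ae_of_all _ fun t _ r _ => ?_) intervalIntegrable_const (ae_of_all _ fun t _ r _ => ?_)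
  · have h2 := key.2
    rw [add_zero] at h2
    refine HasDerivAt.congr_of_eventuallyEq h2 (Eventually.of_forall fun t => ?_)
    simp [verticalIntegral]
  · refine ((fderiv ℝ g _).le_opNorm _).trans ?_
    simpa using h !₂[x 0 + r, t]
  · have h1 : HasDerivAt (fun q : ℝ => (!₂[x 0, t] : Plane) + q • coordDir 0) (coordDir 0) r := by
      simpa using ((hasDerivAt_id r).smul_const (coordDir 0)).const_add (!₂[x 0, t] : Plane)
    have e (q : ℝ) : (!₂[x 0, t] : Plane) + q • coordDir 0 = !₂[x 0 + q, t] := by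
      ext j; fin_cases j <;> simp
    have h2 := (hg ((!₂[x 0, t] : Plane) + r • coordDir 0)).hasFDerivAt.comp_hasDerivAt r h1
    rw [e] at h2
    exact h2.congr_of_eventuallyEq (Eventually.of_forall fun q => by simp [e])

/-- Near every point `c`, the Landau levels of the constant field `B c` shifted by `V c` are close
to the spectrum of the operator with magnetic field `B` and potential `V`. -/
theorem exists_potential_infEDist_landau_le {B : Plane → ℝ} (V : C(Plane, ℝ)) {C β γ : ℝ}
    (hC : ∀ x, |V x| ≤ C) (hB : Differentiable ℝ B) (hV : Differentiable ℝ V)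
    (hβ : ∀ x, ‖fderiv ℝ B x‖ ≤ β) (hγ : ∀ x, ‖fderiv ℝ V x‖ ≤ γ) {c : Plane} (hb : 0 < B c)
    (n : ℕ) :
    ∃ A : C(Plane, Plane), IsVectorPotential A B ∧
      Metric.infEDist ((2 * n + 1) * B c + V c) (realSpectrum (hamiltonian A V)) ≤
        ENNReal.ofReal (landauConst n * ((β + γ) / √(B c) + β ^ 2 / B c ^ 2)) := by
  set b := B c with hbdef
  let g : Plane → ℝ := fun y => b - B y
  have hg : Differentiable ℝ g := hB.const_sub b
  have hgd (x : Plane) : ‖fderiv ℝ g x‖ ≤ β := by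
    simp only [g, fderiv_const_sub, norm_neg, hβ x]
  -- Integrating `B c - B` from the height of `c` corrects the symmetric gauge to the field `B`.
  -- Since the integrand vanishes at `c` and is Lipschitz, `a` is quadratic in `‖x - c‖` and its
  -- horizontal derivative is linear.
  let a := verticalIntegral g (c 1)
  have hac : Continuous a := verticalIntegral_continuous hg.continuous _
  let A : C(Plane, Plane) := ⟨fun x => !₂[-(b / 2) * (x 1 - c 1) + a x, b / 2 * (x 0 - c 0)],
    continuous_vec_two.comp (by fun_prop :
      Continuous fun x : Plane => (-(b / 2) * (x 1 - c 1) + a x, b / 2 * (x 0 - c 0)))⟩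
  have had := verticalIntegral_hasLineDerivAt_zero hg hgd (c 1)
  refine ⟨A, ?_, ?_⟩
  · have := isVectorPotential_of_hasLineDerivAt (A := A) (d₀ := fun x => -(b / 2) + g x)
      (d₁ := fun _ => b / 2) (by have := hg.continuous; fun_prop) continuous_const
      (fun x => ?_) (fun x => ?_)
    · convert this using 2 with x
      simp only [g]; ring
    · have h0 : HasDerivAt (fun t : ℝ => x 1 + t - c 1) 1 0 :=
        ((hasDerivAt_id (0 : ℝ)).const_add (x 1)).sub_const (c 1)
      have h1 : HasDerivAt _ _ _ := verticalIntegral_hasLineDerivAt hg.continuous (c 1) x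
      refine ((h0.const_mul (-(b / 2))).add h1).congr_of_eventuallyEq
        (Eventually.of_forall fun t => ?_) |>.congr_deriv (by ring)
      simp [A, a]
    · have h0 : HasDerivAt (fun t : ℝ => x 0 + t - c 0) 1 0 :=
        ((hasDerivAt_id (0 : ℝ)).const_add (x 0)).sub_const (c 0)
      refine (h0.const_mul (b / 2)).congr_of_eventuallyEq
        (Eventually.of_forall fun t => ?_) |>.congr_deriv (by ring)
      simp [A]
  · have hβ0 : 0 ≤ β := (norm_nonneg _).trans (hβ c)
    have hγ0 : 0 ≤ γ := (norm_nonneg _).trans (hγ c)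
    refine infEDist_landau_le A V hC hb hβ0 hγ0 c n (fun x => rfl) (fun x => rfl) hac ?_ had
      (fun x => ?_) (fun x => ?_) (fun x => abs_sub_le_of_fderiv_le hV hγ x c)
    -- Measurability of the horizontal derivative follows from its being the line derivative of the
    -- continuous function `a`.
    · have := measurable_lineDeriv (𝕜 := ℝ) (v := coordDir 0) hac
      convert this using 2 with x
      exact (had x).lineDeriv.symm
    · refine (abs_verticalIntegral_le_of_le (K := β * ‖x - c‖) fun y hy => ?_).trans_eq (by ring)
      rw [abs_sub_comm]
      exact (abs_sub_le_of_fderiv_le hB hβ y c).trans (mul_le_mul_of_nonneg_left hy hβ0)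
    · refine abs_verticalIntegral_le_of_le fun y _ => ?_
      refine ((fderiv ℝ g y).le_opNorm _).trans ?_
      simpa using hgd y

/-! ### Continuity and translation covariance of the random field. -/

/-- The lattice points whose coordinates differ by at most `r` from those of `y`. -/
def nearLattice (y : Plane) (r : ℝ) : Finset (ℤ × ℤ) :=
  Finset.Icc ⌈y 0 - r⌉ ⌊y 0 + r⌋ ×ˢ Finset.Icc ⌈y 1 - r⌉ ⌊y 1 + r⌋

theorem mem_nearLattice {y : Plane} {r : ℝ} {m : ℤ × ℤ} :
    m ∈ nearLattice y r ↔ |y 0 - m.1| ≤ r ∧ |y 1 - m.2| ≤ r := by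
  simp only [nearLattice, Finset.mem_product, Finset.mem_Icc, Int.ceil_le, Int.le_floor, abs_le]
  constructor <;> rintro ⟨⟨h1, h2⟩, h3, h4⟩ <;> refine ⟨⟨?_, ?_⟩, ?_, ?_⟩ <;> linarith

theorem card_Icc_ceil_floor_le (t : ℝ) {r : ℝ} (hr : 0 ≤ r) :
    ((Finset.Icc ⌈t - r⌉ ⌊t + r⌋).card : ℝ) ≤ 2 * r + 1 := by
  rw [Int.card_Icc]
  rcases le_total (⌊t + r⌋ + 1 - ⌈t - r⌉) 0 with h | h
  · rw [Int.toNat_of_nonpos h]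
    push_cast
    positivity
  · have e : (((⌊t + r⌋ + 1 - ⌈t - r⌉).toNat : ℤ) : ℝ) = ((⌊t + r⌋ + 1 - ⌈t - r⌉ : ℤ) : ℝ) := by
      rw [Int.toNat_of_nonneg h]
    rw [Int.cast_natCast] at e
    rw [e]
    push_cast
    linarith [Int.floor_le (t + r), Int.le_ceil (t - r)]

theorem card_nearLattice_le (y : Plane) {r : ℝ} (hr : 0 ≤ r) :
    ((nearLattice y r).card : ℝ) ≤ (2 * r + 1) ^ 2 := by
  rw [nearLattice, Finset.card_product, sq]
  push_cast
  exact mul_le_mul (card_Icc_ceil_floor_le _ hr) (card_Icc_ceil_floor_le _ hr) (by positivity)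
    (by positivity)

theorem scaled_sub_latticePoint_zero (k : ℕ) (m : ℤ × ℤ) (x : Plane) :
    ((2 : ℝ) ^ k • (x - latticePoint k m)) 0 = ((2 : ℝ) ^ k • x) 0 - m.1 := by
  simp only [latticePoint, PiLp.smul_apply, PiLp.sub_apply, smul_eq_mul, Matrix.cons_val_zero,
    mul_sub]
  rw [mul_div_cancel₀ _ (by positivity)]

theorem scaled_sub_latticePoint_one (k : ℕ) (m : ℤ × ℤ) (x : Plane) :
    ((2 : ℝ) ^ k • (x - latticePoint k m)) 1 = ((2 : ℝ) ^ k • x) 1 - m.2 := by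
  simp only [latticePoint, PiLp.smul_apply, PiLp.sub_apply, smul_eq_mul, Matrix.cons_val_one,
    Matrix.cons_val_zero, mul_sub]
  rw [mul_div_cancel₀ _ (by positivity)]

namespace RandomFieldModel

variable (M : RandomFieldModel)

theorem exists_radius : ∃ r : ℝ, 0 ≤ r ∧ ∀ y, M.u y ≠ 0 → ‖y‖ ≤ r := by
  obtain ⟨r, hr⟩ := M.u_hasCompactSupport.isCompact.isBounded.exists_norm_le
  exact ⟨max r 0, le_max_right _ _, fun y hy =>
    (hr y (subset_tsupport _ hy)).trans (le_max_left _ _)⟩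

/-- The radius of a ball about the origin that contains the support of the profile `u`. -/
def radius : ℝ := M.exists_radius.choose

theorem radius_nonneg : 0 ≤ M.radius := M.exists_radius.choose_spec.1

theorem norm_le_radius {y : Plane} (hy : M.u y ≠ 0) : ‖y‖ ≤ M.radius :=
  M.exists_radius.choose_spec.2 y hy

theorem mem_nearLattice_of_ne_zero {k : ℕ} {m : ℤ × ℤ} {x : Plane}
    (h : M.u ((2 : ℝ) ^ k • (x - latticePoint k m)) ≠ 0) :
    m ∈ nearLattice ((2 : ℝ) ^ k • x) M.radius := by
  rw [mem_nearLattice, ← scaled_sub_latticePoint_zero, ← scaled_sub_latticePoint_one]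
  have h1 := M.norm_le_radius h
  exact ⟨(PiLp.norm_apply_le _ 0).trans h1, (PiLp.norm_apply_le _ 1).trans h1⟩

/-- The part of scale `k` of the random field. -/
def scalePart (k : ℕ) (cfg : ScaleIndex → ℝ) (x : Plane) : ℝ :=
  ∑' m : ℤ × ℤ, cfg (k, m) * M.u ((2 : ℝ) ^ k • (x - latticePoint k m))

/-- On a fixed scale the sum is locally finite in the position, so no bound on the configuration is
needed. -/
theorem continuous_scalePart (k : ℕ) :
    Continuous fun p : (ScaleIndex → ℝ) × Plane => M.scalePart k p.1 p.2 := by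
  let f : ℤ × ℤ → (ScaleIndex → ℝ) × Plane → ℝ := fun m p =>
    p.1 (k, m) * M.u ((2 : ℝ) ^ k • (p.2 - latticePoint k m))
  have hfin (p : (ScaleIndex → ℝ) × Plane) : (Function.support fun m => f m p).Finite :=
    (nearLattice ((2 : ℝ) ^ k • p.2) M.radius).finite_toSet.subset fun m hm =>
      M.mem_nearLattice_of_ne_zero (right_ne_zero_of_mul hm)
  have e : (fun p : (ScaleIndex → ℝ) × Plane => M.scalePart k p.1 p.2) =
      fun p => ∑ᶠ m, f m p := by
    funext p
    exact tsum_eq_finsum (hfin p)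
  rw [e]
  refine continuous_finsum (fun m => ?_) fun p => ?_
  · have := M.u_contDiff.continuous
    fun_prop
  -- Moving the point by less than `1` moves its rescaled coordinates by at most `2 ^ k`, which is
  -- added to the radius.
  · refine ⟨univ ×ˢ Metric.ball p.2 1, prod_mem_nhds univ_mem (Metric.ball_mem_nhds _ one_pos),
      (nearLattice ((2 : ℝ) ^ k • p.2) (M.radius + 2 ^ k)).finite_toSet.subset ?_⟩
    rintro m ⟨q, hq, -, hq2⟩
    have h1 := mem_nearLattice.1
      (M.mem_nearLattice_of_ne_zero (k := k) (m := m) (x := q.2) (right_ne_zero_of_mul hq))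
    have h2 (j : Fin 2) : |((2 : ℝ) ^ k • p.2) j - ((2 : ℝ) ^ k • q.2) j| ≤ 2 ^ k := by
      have h3 : |(p.2 - q.2) j| ≤ 1 := (PiLp.norm_apply_le (p.2 - q.2) j).trans (by
        rw [← dist_eq_norm, dist_comm]; exact (Metric.mem_ball.1 hq2).le)
      rw [PiLp.smul_apply, PiLp.smul_apply, smul_eq_mul, smul_eq_mul, ← mul_sub, abs_mul,
        abs_of_pos (by positivity : (0 : ℝ) < 2 ^ k)]
      exact mul_le_of_le_one_right (by positivity) h3
    refine mem_nearLattice.2 ⟨?_, ?_⟩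
    · have := abs_sub_le (((2 : ℝ) ^ k • p.2) 0) (((2 : ℝ) ^ k • q.2) 0) m.1
      linarith [h2 0, h1.1]
    · have := abs_sub_le (((2 : ℝ) ^ k • p.2) 1) (((2 : ℝ) ^ k • q.2) 1) m.2
      linarith [h2 1, h1.2]

/-- The configurations that obey the almost sure bounds. -/
def boundedConfigs : Set (ScaleIndex → ℝ) :=
  {cfg | ∀ i, |cfg i| ≤ M.Cran * Real.exp (-M.ρ * i.1)}

/-- A bound for the part of scale `k` of the random field. -/
def scaleBound (k : ℕ) : ℝ := (2 * M.radius + 1) ^ 2 * (M.Cran * Real.exp (-M.ρ * k))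

theorem summable_scaleBound : Summable M.scaleBound := by
  refine Summable.mul_left _ (Summable.mul_left _ ?_)
  have : Summable fun k : ℕ => Real.exp (k * -M.ρ) :=
    Real.summable_exp_nat_mul_iff.2 (neg_lt_zero.2 M.ρ_pos)
  simpa only [mul_comm] using this

theorem abs_scalePart_le {cfg : ScaleIndex → ℝ} (h : cfg ∈ M.boundedConfigs) (k : ℕ) (x : Plane) :
    |M.scalePart k cfg x| ≤ M.scaleBound k := by
  have h0 : 0 ≤ M.Cran * Real.exp (-M.ρ * k) := (abs_nonneg _).trans (h (k, 0))
  rw [scalePart, tsum_eq_sum (s := nearLattice ((2 : ℝ) ^ k • x) M.radius) fun m hm => by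
    rw [not_imp_comm.1 M.mem_nearLattice_of_ne_zero hm, mul_zero]]
  refine (Finset.abs_sum_le_sum_abs _ _).trans ?_
  refine (Finset.sum_le_card_nsmul _ _ (M.Cran * Real.exp (-M.ρ * k)) fun m _ => ?_).trans ?_
  · rw [abs_mul, abs_of_nonneg (M.u_nonneg _)]
    exact (mul_le_of_le_one_right (abs_nonneg _) (M.u_le_one _)).trans (h (k, m))
  · rw [nsmul_eq_mul]
    exact mul_le_mul_of_nonneg_right (card_nearLattice_le _ M.radius_nonneg) h0

/-- Weierstrass test: on bounded configurations the scales are dominated by a summable geometric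
sequence. Configurations carry the product topology, so closeness of finitely many variables already
controls the field on compact sets. -/
theorem continuousOn_randomPart :
    ContinuousOn (fun p : (ScaleIndex → ℝ) × Plane => M.randomPart p.1 p.2)
      (M.boundedConfigs ×ˢ univ) :=
  continuousOn_tsum (f := fun k (p : (ScaleIndex → ℝ) × Plane) => M.scalePart k p.1 p.2)
    (fun k => (M.continuous_scalePart k).continuousOn) M.summable_scaleBound
    fun k p hp => M.abs_scalePart_le hp.1 k p.2

theorem continuousOn_field :
    ContinuousOn (fun p : (ScaleIndex → ℝ) × Plane => M.field p.1 p.2)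
      (M.boundedConfigs ×ˢ univ) := by
  have h1 : Continuous fun p : (ScaleIndex → ℝ) × Plane => M.B0 + M.Bvar p.2 :=
    continuous_const.add (M.Bvar_continuous.comp continuous_snd)
  exact h1.continuousOn.add (continuousOn_const.mul M.continuousOn_randomPart)

theorem continuous_field {cfg : ScaleIndex → ℝ} (h : cfg ∈ M.boundedConfigs) :
    Continuous (M.field cfg) :=
  M.continuousOn_field.comp_continuous (f := fun x => (cfg, x)) (by fun_prop)
    fun x => ⟨h, mem_univ x⟩

theorem abs_randomPart_le {cfg : ScaleIndex → ℝ} (h : cfg ∈ M.boundedConfigs) (x : Plane) :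
    |M.randomPart cfg x| ≤ ∑' k, M.scaleBound k :=
  tsum_of_norm_bounded (f := fun k => M.scalePart k cfg x) M.summable_scaleBound.hasSum
    fun k => M.abs_scalePart_le h k x

/-- The translate of a configuration by a vector of `ℤ²`. -/
def shift (a : ℤ × ℤ) (cfg : ScaleIndex → ℝ) : ScaleIndex → ℝ :=
  fun i => cfg (i.1, i.2 + (2 : ℤ) ^ i.1 • a)

theorem shift_mem_boundedConfigs {cfg : ScaleIndex → ℝ} (h : cfg ∈ M.boundedConfigs)
    (a : ℤ × ℤ) : shift a cfg ∈ M.boundedConfigs := fun i => h (i.1, _)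

/-- A translation by `a` in `ℤ²` preserves every lattice `2⁻ᵏ ℤ²` and moves its labels by `2ᵏ a`. -/
theorem latticePoint_add_smul (k : ℕ) (m a : ℤ × ℤ) :
    latticePoint k (m + (2 : ℤ) ^ k • a) = latticePoint k m + !₂[(a.1 : ℝ), (a.2 : ℝ)] := by
  have h : (2 : ℝ) ^ k ≠ 0 := by positivity
  ext j; fin_cases j <;> simp [latticePoint] <;> field_simp

theorem randomPart_shift (a : ℤ × ℤ) (cfg : ScaleIndex → ℝ) (x : Plane) :
    M.randomPart (shift a cfg) x = M.randomPart cfg (x + !₂[(a.1 : ℝ), (a.2 : ℝ)]) := by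
  refine tsum_congr fun k => ?_
  refine .trans ?_ ((Equiv.addRight ((2 : ℤ) ^ k • a)).tsum_eq _)
  refine tsum_congr fun m => ?_
  simp only [shift, Equiv.coe_addRight, latticePoint_add_smul, add_sub_add_right_eq_sub]

theorem field_shift (hper : IsZ2Periodic M.Bvar) (a : ℤ × ℤ) (cfg : ScaleIndex → ℝ) (x : Plane) :
    M.field (shift a cfg) x = M.field cfg (x + !₂[(a.1 : ℝ), (a.2 : ℝ)]) := by
  rw [field, field, randomPart_shift, hper a x]

/-- A bounded configuration whose translates by `ℤ²` accumulate at `η` gives rise to a larger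
spectrum than `η`. -/
theorem realSpectrum_subset_of_shift_mem_nhds {V : C(Plane, ℝ)} {C : ℝ} (hC : ∀ x, |V x| ≤ C)
    (hper : IsZ2Periodic M.Bvar) (hV : IsZ2Periodic V) {cfg η : ScaleIndex → ℝ}
    (hcfg : cfg ∈ M.boundedConfigs) (hη : η ∈ M.boundedConfigs)
    (h : ∀ U ∈ 𝓝 η, ∃ a, shift a cfg ∈ U) {A A' : C(Plane, Plane)}
    (hA : IsVectorPotential A (M.field η)) (hA' : IsVectorPotential A' (M.field cfg)) :
    realSpectrum (hamiltonian A V) ⊆ realSpectrum (hamiltonian A' V) := by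
  refine realSpectrum_subset_of_field_approx hC (M.continuous_field hη) (M.continuous_field hcfg)
    hA hA' fun R _ δ hδ => ?_
  have hc : Continuous fun p : M.boundedConfigs × Plane => M.field p.1 p.2 :=
    M.continuousOn_field.comp_continuous (f := fun p : M.boundedConfigs × Plane => (p.1.1, p.2))
      (by fun_prop) fun p => ⟨p.1.2, mem_univ _⟩
  have hc' : Continuous fun p : M.boundedConfigs × Plane =>
      |M.field p.1 p.2 - M.field η p.2| :=
    (hc.sub ((M.continuous_field hη).comp continuous_snd)).abs
  -- Compactness of the ball turns joint continuity into one neighbourhood of `η` that works for all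
  -- points of the ball.
  have key := (isCompact_closedBall (0 : Plane) R).eventually_forall_of_forall_eventually
    (x₀ := (⟨η, hη⟩ : M.boundedConfigs))
    (P := fun ζ x => |M.field ζ x - M.field η x| < δ) fun x _ =>
      hc'.continuousAt.eventually_lt continuousAt_const (by simpa using hδ)
  obtain ⟨U, hU, hUs⟩ := mem_nhds_induced _ _ _ |>.1 key
  obtain ⟨a, ha⟩ := h U hU
  refine ⟨!₂[(a.1 : ℝ), (a.2 : ℝ)], hV a, fun x hx => ?_⟩
  rw [← M.field_shift hper]
  exact (hUs (show (⟨shift a cfg, M.shift_mem_boundedConfigs hcfg a⟩ : M.boundedConfigs) ∈ _ from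
    ha) x (by simpa using hx)).le

end RandomFieldModel

/-! ### Support of the product measure and recurrence of patterns. -/

theorem infinitePi_preimage_box {ι α : Type*} [DecidableEq ι] (ν : ι → Measure ℝ)
    [∀ i, IsProbabilityMeasure (ν i)] (P : Finset α) (τ : α → ι) (hτ : Set.InjOn τ P)
    (t : α → Set ℝ) (ht : ∀ p ∈ P, MeasurableSet (t p)) :
    Measure.infinitePi ν {cfg | ∀ p ∈ P, cfg (τ p) ∈ t p} = ∏ p ∈ P, ν (τ p) (t p) := by
  let t' : ι → Set ℝ := fun i => {s | ∀ p ∈ P, τ p = i → s ∈ t p}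
  have e {p : α} (hp : p ∈ P) : t' (τ p) = t p := by
    ext s
    refine ⟨fun h => h p hp rfl, fun h q hq hqp => ?_⟩
    rwa [hτ hq hp hqp]
  have h1 : {cfg : ι → ℝ | ∀ p ∈ P, cfg (τ p) ∈ t p} = Set.pi (P.image τ) t' := by
    ext cfg
    simp only [mem_ofPred_eq, Set.mem_pi, Finset.coe_image, forall_mem_image, SetLike.mem_coe]
    exact forall₂_congr fun p hp => by rw [e hp]
  rw [h1, Measure.infinitePi_pi, Finset.prod_image hτ]
  · exact Finset.prod_congr rfl fun p hp => by rw [e hp]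
  · simp only [Finset.forall_mem_image]
    exact fun p hp => by rw [e hp]; exact ht p hp

theorem mem_support_infinitePi {ι : Type*} {ν : ι → Measure ℝ}
    [∀ i, IsProbabilityMeasure (ν i)] [Countable ι] {η : ι → ℝ} (h : ∀ i, η i ∈ (ν i).support) :
    η ∈ (Measure.infinitePi ν).support := by
  rw [Measure.mem_support_iff_forall]
  intro U hU
  rw [nhds_pi] at hU
  obtain ⟨I, hI, t, ht, hs⟩ := Filter.mem_pi.1 hU
  lift I to Finset ι using hI
  choose t' ht' hto htm using fun i => mem_nhds_iff.1 (ht i)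
  have hsub : Set.pi (I : Set ι) t' ⊆ U := (Set.pi_mono fun i _ => ht' i).trans hs
  refine lt_of_lt_of_le ?_ (measure_mono hsub)
  rw [Measure.infinitePi_pi _ fun i _ => (hto i).measurableSet]
  exact CanonicallyOrderedAdd.prod_pos.2 fun i _ =>
    (Measure.mem_support_iff_forall _).1 (h i) _ ((hto i).mem_nhds (htm i))

/-- If there were no mass within `ε` of `σ S`, then almost surely `σ s ≤ S - ε`. So `S ≤ max 0 (S -
ε)`, which forces `S ≤ 0`, and then `σ s ≤ -ε` almost surely contradicts mean zero. The sign `σ`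
covers the maximal and the minimal configuration at once. -/
theorem sign_mul_essSup_mem_support {ν : Measure ℝ} [IsProbabilityMeasure ν] {c σ : ℝ}
    (hσ : σ = 1 ∨ σ = -1) (hmean : ∫ s, s ∂ν = 0) (hc : ∀ᵐ s ∂ν, |s| ≤ c) :
    σ * essSup (fun s : ℝ => max 0 (σ * s)) ν ∈ ν.support := by
  set S := essSup (fun s : ℝ => max 0 (σ * s)) ν with hS
  have hσabs : |σ| = 1 := by rcases hσ with rfl | rfl <;> simp
  have hσσ : σ * σ = 1 := by rcases hσ with rfl | rfl <;> norm_num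
  have habs (s : ℝ) : |σ * s| = |s| := by rw [abs_mul, hσabs, one_mul]
  have hbdd : IsBoundedUnder (· ≤ ·) (ae ν) fun s : ℝ => max 0 (σ * s) := by
    refine ⟨c, ?_⟩
    rw [eventually_map]
    filter_upwards [hc] with s hs
    exact max_le ((abs_nonneg s).trans hs) ((le_abs_self _).trans ((habs s).trans_le hs))
  have hcob : IsCoboundedUnder (· ≤ ·) (ae ν) fun s : ℝ => max 0 (σ * s) :=
    IsBoundedUnder.isCoboundedUnder_le ⟨0, eventually_map.2 (Eventually.of_forall fun s =>
      le_max_left _ _)⟩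
  have hle : ∀ᵐ s ∂ν, max 0 (σ * s) ≤ S := ae_le_essSup hbdd
  by_contra hnot
  obtain ⟨U, hU, hU0⟩ := Measure.notMem_support_iff_exists.1 hnot
  obtain ⟨ε, hε, hεU⟩ := Metric.mem_nhds_iff.1 hU
  have hball : ∀ᵐ s ∂ν, s ∉ Metric.ball (σ * S) ε :=
    measure_eq_zero_iff_ae_notMem.1 (measure_mono_null hεU hU0)
  have hlt : ∀ᵐ s ∂ν, σ * s ≤ S - ε := by
    filter_upwards [hle, hball] with s h1 h2
    rw [Metric.mem_ball, not_lt, Real.dist_eq, ← habs, mul_sub, ← mul_assoc, hσσ, one_mul] at h2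
    have h3 : σ * s ≤ S := (le_max_right _ _).trans h1
    rw [abs_of_nonpos (by linarith)] at h2
    linarith
  have hS1 : S ≤ max 0 (S - ε) := by
    refine essSup_le_of_ae_le _ ?_ hcob
    filter_upwards [hlt] with s hs
    exact max_le_max le_rfl hs
  have hS0 : S ≤ 0 := by
    rcases le_max_iff.1 hS1 with h | h
    · exact h
    · linarith
  have hint : Integrable (fun s : ℝ => s) ν :=
    (integrable_const c).mono' measurable_id.aestronglyMeasurable hc
  have h1 : ∫ s, σ * s ∂ν ≤ ∫ _, (-ε) ∂ν := by
    refine integral_mono_ae (hint.const_mul σ) (integrable_const _) ?_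
    filter_upwards [hlt] with s hs
    exact hs.trans (by linarith)
  rw [integral_const_mul, hmean, mul_zero, integral_const, probReal_univ, one_smul] at h1
  linarith

namespace RandomFieldModel

variable (M : RandomFieldModel)

theorem ν_isProbabilityMeasure (i : ScaleIndex) : IsProbabilityMeasure (M.ν i) := M.ν_prob i

attribute [local instance] ν_isProbabilityMeasure

instance prob_isProbabilityMeasure : IsProbabilityMeasure M.prob := by
  unfold prob; infer_instance

theorem omegaPlus_mem_support : M.omegaPlus ∈ M.prob.support := by
  refine mem_support_infinitePi fun i => ?_
  simpa [omegaPlus] using sign_mul_essSup_mem_support (σ := 1) (.inl rfl) (M.ν_mean i)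
    (M.ν_bound i)

theorem omegaMinus_mem_support : M.omegaMinus ∈ M.prob.support := by
  refine mem_support_infinitePi fun i => ?_
  simpa [omegaMinus] using sign_mul_essSup_mem_support (σ := -1) (.inr rfl) (M.ν_mean i)
    (M.ν_bound i)

theorem isClosed_boundedConfigs : IsClosed M.boundedConfigs := by
  simp only [boundedConfigs, ofPred_forall]
  exact isClosed_iInter fun i => isClosed_le (by fun_prop) continuous_const

/-- The bounds define a closed set of full measure. They therefore hold everywhere on the support,
in particular at `omegaPlus` and `omegaMinus`. -/
theorem support_subset_boundedConfigs : M.prob.support ⊆ M.boundedConfigs := by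
  refine Measure.support_subset_of_isClosed M.isClosed_boundedConfigs ?_
  change ∀ᵐ cfg ∂M.prob, ∀ i, _
  refine ae_all_iff.2 fun i => ?_
  exact (measurePreserving_eval_infinitePi M.ν i).quasiMeasurePreserving.ae (M.ν_bound i)

/-- The index of `i` after a translation by `(l, 0)`. -/
def shiftIndex (l : ℤ) (i : ScaleIndex) : ScaleIndex := (i.1, i.2 + (2 : ℤ) ^ i.1 • (l, 0))

/-- Translates by multiples of `L = 2 N + 1` are disjoint: first labels in `F` differ by at most `2
N`, whereas distinct translations differ by at least `2ᵏ L` on scale `k`. Disjointness of the index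
sets gives independence of the corresponding events. -/
theorem exists_step_injOn (F : Finset ScaleIndex) :
    ∃ L : ℤ, Set.InjOn (fun p : ℕ × ScaleIndex => shiftIndex (L * p.1) p.2) (univ ×ˢ F) := by
  obtain ⟨N, hN⟩ : ∃ N : ℕ, ∀ i ∈ F, i.2.1.natAbs ≤ N :=
    ⟨F.sup fun i => i.2.1.natAbs, fun i hi => Finset.le_sup (f := fun i => i.2.1.natAbs) hi⟩
  refine ⟨2 * N + 1, ?_⟩
  rintro ⟨j, k, m₁, m₂⟩ ⟨-, hi⟩ ⟨j', k', m₁', m₂'⟩ ⟨-, hi'⟩ h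
  simp only [shiftIndex, Prod.mk.injEq, Prod.smul_mk, smul_eq_mul, Prod.mk_add_mk, mul_zero,
    add_zero] at h
  obtain ⟨rfl, h1, rfl⟩ := h
  have b1 : |m₁| ≤ N := by
    have := hN _ hi
    rw [Int.abs_eq_natAbs]
    exact_mod_cast this
  have b2 : |m₁'| ≤ N := by
    have := hN _ hi'
    rw [Int.abs_eq_natAbs]
    exact_mod_cast this
  have hj : (j : ℤ) = j' := by
    by_contra hne
    have h2 : m₁' - m₁ = 2 ^ k * ((2 * N + 1) * ((j : ℤ) - j')) := by linear_combination -h1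
    have h3 : |m₁' - m₁| = 2 ^ k * ((2 * N + 1) * |(j : ℤ) - j'|) := by
      rw [h2, abs_mul, abs_mul, abs_of_pos (by positivity : (0 : ℤ) < 2 ^ k),
        abs_of_pos (by positivity : (0 : ℤ) < 2 * N + 1)]
    have h4 : 1 ≤ |(j : ℤ) - j'| := Int.one_le_abs (sub_ne_zero.2 hne)
    have h5 : (1 : ℤ) ≤ 2 ^ k := one_le_pow₀ (by norm_num)
    have h6 : (2 * N + 1 : ℤ) ≤ (2 * N + 1) * |(j : ℤ) - j'| :=
      le_mul_of_one_le_right (by positivity) h4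
    have h7 : (2 * N + 1 : ℤ) * |(j : ℤ) - j'| ≤ 2 ^ k * ((2 * N + 1) * |(j : ℤ) - j'|) :=
      le_mul_of_one_le_left (by positivity) h5
    have h8 := abs_sub m₁' m₁
    omega
  obtain rfl : j = j' := by exact_mod_cast hj
  simp_all

theorem ν_shiftIndex (hiid : M.IID) (l : ℤ) (i : ScaleIndex) : M.ν (shiftIndex l i) = M.ν i :=
  hiid _ _ _

/-- A pattern of positive probability on finitely many indices almost surely occurs in a
translate of the configuration. -/
theorem ae_exists_shift_mem_box (hiid : M.IID) (F : Finset ScaleIndex) (t : ScaleIndex → Set ℝ)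
    (ht : ∀ i ∈ F, MeasurableSet (t i)) (hpos : ∀ i ∈ F, M.ν i (t i) ≠ 0) :
    ∀ᵐ cfg ∂M.prob, ∃ a, shift a cfg ∈ Set.pi F t := by
  obtain ⟨L, hL⟩ := exists_step_injOn F
  let s : ℕ → Set (ScaleIndex → ℝ) := fun j =>
    {cfg | ∀ i ∈ F, cfg (shiftIndex (L * j) i) ∈ t i}
  have hsm (j : ℕ) : MeasurableSet (s j) := by
    have : s j = ⋂ i ∈ F, (fun cfg : ScaleIndex → ℝ => cfg (shiftIndex (L * j) i)) ⁻¹' t i := by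
      ext; simp [s]
    rw [this]
    exact Finset.measurableSet_biInter _ fun i hi => measurable_pi_apply _ (ht i hi)
  have hbox (T : Finset ℕ) : M.prob (⋂ j ∈ T, s j) = ∏ j ∈ T, ∏ i ∈ F, M.ν i (t i) := by
    have hsub : ((T ×ˢ F : Finset (ℕ × ScaleIndex)) : Set (ℕ × ScaleIndex)) ⊆ univ ×ˢ F :=
      fun p hp => ⟨mem_univ _, (Finset.mem_product.1 hp).2⟩
    have := infinitePi_preimage_box M.ν (T ×ˢ F)
      (fun p : ℕ × ScaleIndex => shiftIndex (L * p.1) p.2) (hL.mono hsub) (fun p => t p.2)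
      fun p hp => ht _ (Finset.mem_product.1 hp).2
    rw [Finset.prod_product] at this
    simp only [M.ν_shiftIndex hiid] at this
    rw [← this, prob]
    congr 1
    ext cfg
    simp only [s, mem_iInter, mem_ofPred_eq, Finset.mem_product]
    exact ⟨fun h p hp => h p.1 hp.1 p.2 hp.2, fun h j hj i hi => h (j, i) ⟨hj, hi⟩⟩
  have hone (j : ℕ) : M.prob (s j) = ∏ i ∈ F, M.ν i (t i) := by
    simpa using hbox {j}
  have hind : ProbabilityTheory.iIndepSet s M.prob := by
    rw [ProbabilityTheory.iIndepSet_iff_meas_biInter hsm]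
    intro T
    rw [hbox T]
    exact Finset.prod_congr rfl fun j _ => (hone j).symm
  -- Second Borel–Cantelli lemma: the events are independent and share one positive probability, so
  -- their probabilities have infinite sum.
  have hlim := ProbabilityTheory.measure_limsup_eq_one hsm hind (by
    simp only [hone]
    exact ENNReal.tsum_const_eq_top_of_ne_zero (Finset.prod_ne_zero_iff.2 hpos))
  have hae : ∀ᵐ cfg ∂M.prob, cfg ∈ limsup s atTop := by
    rw [← prob_compl_eq_zero_iff (MeasurableSet.measurableSet_limsup hsm)] at hlim
    exact measure_eq_zero_iff_ae_notMem.1 hlim |>.mono fun cfg h => not_not.1 h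
  filter_upwards [hae] with cfg h
  obtain ⟨j, hj⟩ := (mem_limsup_iff_frequently_mem.1 h).exists
  exact ⟨(L * j, 0), fun i hi => hj i hi⟩

/-- Almost surely, the translates of the configuration accumulate at every point of the support
of the product measure. -/
theorem ae_forall_mem_support_exists_shift (hiid : M.IID) :
    ∀ᵐ cfg ∂M.prob, ∀ η ∈ M.prob.support, ∀ U ∈ 𝓝 η, ∃ a, shift a cfg ∈ U := by
  have key (O : Set (ScaleIndex → ℝ)) (hO : IsOpen O) (hpos : 0 < M.prob O) :
      ∀ᵐ cfg ∂M.prob, ∃ a, shift a cfg ∈ O := by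
    obtain ⟨η, hηO, hη⟩ := Measure.nonempty_inter_support_of_pos hpos
    have hU := hO.mem_nhds hηO
    rw [nhds_pi] at hU
    obtain ⟨I, hI, t, ht, hs⟩ := Filter.mem_pi.1 hU
    lift I to Finset ScaleIndex using hI
    choose t' ht' hto htm using fun i => mem_nhds_iff.1 (ht i)
    have hbox : 0 < M.prob (Set.pi I t') := (Measure.mem_support_iff_forall _).1 hη _
      (set_pi_mem_nhds I.finite_toSet fun i _ => (hto i).mem_nhds (htm i))
    rw [prob, Measure.infinitePi_pi _ fun i _ => (hto i).measurableSet] at hbox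
    filter_upwards [M.ae_exists_shift_mem_box hiid I t' (fun i _ => (hto i).measurableSet)
      (Finset.prod_ne_zero_iff.1 hbox.ne')] with cfg ⟨a, ha⟩
    exact ⟨a, hs (Set.pi_mono (fun i _ => ht' i) ha)⟩
  -- A countable basis allows a single null set to serve all `η` and all neighbourhoods.
  have hall : ∀ᵐ cfg ∂M.prob, ∀ O ∈ TopologicalSpace.countableBasis (ScaleIndex → ℝ),
      0 < M.prob O → ∃ a, shift a cfg ∈ O := by
    refine (ae_ball_iff (TopologicalSpace.countable_countableBasis _)).2 fun O hO => ?_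
    by_cases hpos : 0 < M.prob O
    · filter_upwards [key O (TopologicalSpace.isOpen_of_mem_countableBasis hO) hpos] with cfg h _
      exact h
    · exact ae_of_all _ fun cfg h => absurd h hpos
  filter_upwards [hall] with cfg h η hη U hU
  obtain ⟨O, hO, hηO, hOU⟩ :=
    (TopologicalSpace.isBasis_countableBasis (ScaleIndex → ℝ)).mem_nhds_iff.1 hU
  obtain ⟨a, ha⟩ := h O hO ((Measure.mem_support_iff_forall _).1 hη O
    ((TopologicalSpace.isOpen_of_mem_countableBasis hO).mem_nhds hηO))
  exact ⟨a, hOU ha⟩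

end RandomFieldModel

/-! ### The almost sure spectrum and the conclusion. -/

theorem IsZ2Periodic.exists_abs_le {f : Plane → ℝ} (hf : IsZ2Periodic f) (hc : Continuous f) :
    ∃ C, ∀ x, |f x| ≤ C := by
  obtain ⟨C, hC⟩ := (isCompact_closedBall (0 : Plane) 2).exists_bound_of_continuousOn hc.continuousOn
  refine ⟨C, fun x => ?_⟩
  have h := hf (⌊x 0⌋, ⌊x 1⌋) !₂[Int.fract (x 0), Int.fract (x 1)]
  have e : (!₂[Int.fract (x 0), Int.fract (x 1)] : Plane) + !₂[((⌊x 0⌋ : ℤ) : ℝ), (⌊x 1⌋ : ℝ)] = x := by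
    ext j; fin_cases j <;> simp [Int.fract_add_floor]
  rw [e] at h
  rw [h]
  refine hC _ ?_
  rw [mem_closedBall_zero_iff]
  refine (sq_le_sq₀ (norm_nonneg _) (by norm_num)).1 ?_
  rw [EuclideanSpace.norm_sq_eq, Fin.sum_univ_two]
  change ‖Int.fract (x 0)‖ ^ 2 + ‖Int.fract (x 1)‖ ^ 2 ≤ 2 ^ 2
  rw [Real.norm_of_nonneg (Int.fract_nonneg _), Real.norm_of_nonneg (Int.fract_nonneg _)]
  nlinarith [Int.fract_nonneg (x 0), Int.fract_nonneg (x 1), Int.fract_lt_one (x 0),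
    Int.fract_lt_one (x 1)]

theorem norm_fderiv_le_toReal_gradSup {f : Plane → ℝ} (h : gradSup f ≠ ⊤) (x : Plane) :
    ‖fderiv ℝ f x‖ ≤ (gradSup f).toReal := by
  rw [← toReal_enorm]
  exact ENNReal.toReal_mono h (le_iSup (fun x => ‖fderiv ℝ f x‖ₑ) x)

/-- The local Landau levels are close to every set that contains the spectra of all realizations
of the operator with magnetic field `B`. -/
theorem infEDist_localLevel_le {B : Plane → ℝ} (V : C(Plane, ℝ)) {C : ℝ} (hC : ∀ x, |V x| ≤ C)
    (hB : Differentiable ℝ B) (hV : Differentiable ℝ V) {b₀ : ℝ} (hb₀ : 0 < b₀)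
    (hb : ∀ x, b₀ ≤ B x) {S : Set ℝ}
    (hS : ∀ A, IsVectorPotential A B → realSpectrum (hamiltonian A V) ⊆ S) (n : ℕ) (c : Plane) :
    Metric.infEDist ((2 * (n : ℝ) + 1) * B c + V c) S ≤ ENNReal.ofReal (landauConst n) *
      (K2 B V * ENNReal.ofReal (b₀ ^ (-(1 / 2) : ℝ)) + K3 B * ENNReal.ofReal (b₀ ^ (-2 : ℝ))) := by
  -- If a gradient is unbounded, the right side is infinite because its other factors are positive.
  by_cases hK : K2 B V = ⊤
  · have h1 : ENNReal.ofReal (b₀ ^ (-(1 / 2) : ℝ)) ≠ 0 := by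
      rw [Ne, ENNReal.ofReal_eq_zero, not_le]; positivity
    have h2 : ENNReal.ofReal (landauConst n) ≠ 0 := by
      rw [Ne, ENNReal.ofReal_eq_zero, not_le]; exact landauConst_pos n
    rw [hK, ENNReal.top_mul h1, top_add, ENNReal.mul_top h2]
    exact le_top
  obtain ⟨hBt, hVt⟩ := ENNReal.add_ne_top.1 hK
  set β := (gradSup B).toReal
  set γ := (gradSup V).toReal
  have hβ0 : 0 ≤ β := ENNReal.toReal_nonneg
  have hγ0 : 0 ≤ γ := ENNReal.toReal_nonneg
  have hbc : 0 < B c := hb₀.trans_le (hb c)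
  obtain ⟨A, hA, hdist⟩ := exists_potential_infEDist_landau_le V hC hB hV
    (norm_fderiv_le_toReal_gradSup hBt) (norm_fderiv_le_toReal_gradSup hVt) hbc n
  refine (Metric.infEDist_anti (hS A hA)).trans (hdist.trans ?_)
  have e1 : K2 B V = ENNReal.ofReal (β + γ) := by
    rw [ENNReal.ofReal_add hβ0 hγ0, ENNReal.ofReal_toReal hBt, ENNReal.ofReal_toReal hVt, K2]
  have e2 : K3 B = ENNReal.ofReal (β ^ 2) := by
    rw [ENNReal.ofReal_pow hβ0, ENNReal.ofReal_toReal hBt, K3]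
  rw [e1, e2, ← ENNReal.ofReal_mul (by positivity), ← ENNReal.ofReal_mul (by positivity),
    ← ENNReal.ofReal_add (by positivity) (by positivity),
    ← ENNReal.ofReal_mul (landauConst_pos n).le]
  refine ENNReal.ofReal_le_ofReal (mul_le_mul_of_nonneg_left ?_ (landauConst_pos n).le)
  have e3 : b₀ ^ (-(1 / 2) : ℝ) = (√b₀)⁻¹ := by rw [Real.rpow_neg hb₀.le, ← Real.sqrt_eq_rpow]
  have e4 : b₀ ^ (-2 : ℝ) = (b₀ ^ 2)⁻¹ := by rw [Real.rpow_neg hb₀.le, Real.rpow_two]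
  rw [e3, e4, ← div_eq_mul_inv, ← div_eq_mul_inv]
  have hs : 0 < √b₀ := Real.sqrt_pos.2 hb₀
  have := hb c
  gcongr

namespace RandomFieldModel

variable (M : RandomFieldModel)

theorem exists_abs_field_le (hper : IsZ2Periodic M.Bvar) {cfg : ScaleIndex → ℝ}
    (h : cfg ∈ M.boundedConfigs) : ∃ D, ∀ x, |M.field cfg x| ≤ D := by
  obtain ⟨C, hC⟩ := hper.exists_abs_le M.Bvar_continuous
  refine ⟨|M.B0| + C + M.μ * ∑' k, M.scaleBound k, fun x => (abs_add_three _ _ _).trans ?_⟩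
  rw [abs_mul, abs_of_pos M.μ_pos]
  exact add_le_add (add_le_add le_rfl (hC x))
    (mul_le_mul_of_nonneg_left (M.abs_randomPart_le h x) M.μ_pos.le)

theorem exists_abs_level_le (hper : IsZ2Periodic M.Bvar) {V : C(Plane, ℝ)} {C : ℝ}
    (hC : ∀ x, |V x| ≤ C) {cfg : ScaleIndex → ℝ} (h : cfg ∈ M.boundedConfigs) (n : ℕ) :
    ∃ D, ∀ x, |(2 * (n : ℝ) + 1) * M.field cfg x + V x| ≤ D := by
  obtain ⟨D, hD⟩ := M.exists_abs_field_le hper h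
  refine ⟨(2 * n + 1) * D + C, fun x => (abs_add_le _ _).trans (add_le_add ?_ (hC x))⟩
  rw [abs_mul, abs_of_pos (by positivity)]
  exact mul_le_mul_of_nonneg_left (hD x) (by positivity)

/-- There is an almost sure spectrum, and it contains the spectra of the operators that belong to
configurations in the support of the product measure. -/
theorem exists_isAlmostSureSpectrum (hiid : M.IID) (hper : IsZ2Periodic M.Bvar) {V : C(Plane, ℝ)}
    (hV : IsZ2Periodic V) {C : ℝ} (hC : ∀ x, |V x| ≤ C) :
    ∃ S, M.IsAlmostSureSpectrum V S ∧ ∀ η ∈ M.prob.support, ∀ A,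
      IsVectorPotential A (M.field η) → realSpectrum (hamiltonian A V) ⊆ S := by
  have hgood : ∀ᵐ cfg ∂M.prob, cfg ∈ M.prob.support ∧
      ∀ η ∈ M.prob.support, ∀ U ∈ 𝓝 η, ∃ a, shift a cfg ∈ U :=
    Filter.Eventually.and Measure.support_mem_ae (M.ae_forall_mem_support_exists_shift hiid)
  have hb := M.support_subset_boundedConfigs
  have hsub {cfg η : ScaleIndex → ℝ} (h1 : cfg ∈ M.prob.support)
      (h2 : ∀ η ∈ M.prob.support, ∀ U ∈ 𝓝 η, ∃ a, shift a cfg ∈ U) (hη : η ∈ M.prob.support)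
      {A A' : C(Plane, Plane)} (hA : IsVectorPotential A (M.field η))
      (hA' : IsVectorPotential A' (M.field cfg)) :
      realSpectrum (hamiltonian A V) ⊆ realSpectrum (hamiltonian A' V) :=
    M.realSpectrum_subset_of_shift_mem_nhds hC hper hV (hb h1) (hb hη) (h2 η hη) hA hA'
  obtain ⟨cfg₀, h₀, h₀'⟩ := hgood.exists
  have hA₀ := axisPotential_isVectorPotential (M.continuous_field (hb h₀))
  refine ⟨realSpectrum (hamiltonian (axisPotential (M.continuous_field (hb h₀))) V), ?_,
    fun η hη A hA => hsub h₀ h₀' hη hA hA₀⟩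
  -- Two typical configurations both lie in the support and both have translates accumulating at the
  -- other, so the inclusion of spectra holds in both directions.
  filter_upwards [hgood] with cfg ⟨h1, h2⟩
  exact ⟨⟨_, axisPotential_isVectorPotential (M.continuous_field (hb h1))⟩, fun A hA =>
    Subset.antisymm (hsub h₀ h₀' h1 hA hA₀) (hsub h1 h2 h₀ hA₀ hA)⟩

end RandomFieldModel

theorem theorem2p2 (n : ℕ) :
    ∃ C : ℝ, 0 < C ∧ ∀ (M : RandomFieldModel) (V : C(Plane, ℝ)),
      M.IID → IsZ2Periodic M.Bvar → IsZ2Periodic V → Differentiable ℝ V →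
      ∃ S : Set ℝ, M.IsAlmostSureSpectrum V S ∧
        (∀ b₀ : ℝ, 0 < b₀ → (∀ x, b₀ ≤ M.field M.omegaPlus x) →
          Differentiable ℝ (M.field M.omegaPlus) →
          Metric.infEDist (M.EPlus V n) S ≤ ENNReal.ofReal C *
            (K2 (M.field M.omegaPlus) V * ENNReal.ofReal (b₀ ^ (-(1 / 2) : ℝ)) +
              K3 (M.field M.omegaPlus) * ENNReal.ofReal (b₀ ^ (-2 : ℝ)))) ∧
        (∀ b₀ : ℝ, 0 < b₀ → (∀ x, b₀ ≤ M.field M.omegaMinus x) →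
          Differentiable ℝ (M.field M.omegaMinus) →
          Metric.infEDist (M.EMinus V n) S ≤ ENNReal.ofReal C *
            (K2 (M.field M.omegaMinus) V * ENNReal.ofReal (b₀ ^ (-(1 / 2) : ℝ)) +
              K3 (M.field M.omegaMinus) * ENNReal.ofReal (b₀ ^ (-2 : ℝ)))) := by
  refine ⟨landauConst n, landauConst_pos n, fun M V hiid hper hVper hV => ?_⟩
  obtain ⟨C, hC⟩ := hVper.exists_abs_le V.continuous
  obtain ⟨S, hS, hsub⟩ := M.exists_isAlmostSureSpectrum hiid hper hVper hC
  -- The supremum or infimum need not be attained, but it lies in the closure of the local levels,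
  -- and the bound is a closed condition that is uniform in the centre.
  have hclosure {r : ℝ≥0∞} {T : Set ℝ} (hT : ∀ y ∈ T, Metric.infEDist y S ≤ r) {y : ℝ}
      (hy : y ∈ closure T) : Metric.infEDist y S ≤ r :=
    closure_minimal (t := {y | Metric.infEDist y S ≤ r}) hT
      (isClosed_le Metric.continuous_infEDist continuous_const) hy
  refine ⟨S, hS, fun b₀ hb₀ hb hB => ?_, fun b₀ hb₀ hb hB => ?_⟩
  · have hη := M.omegaPlus_mem_support
    obtain ⟨D, hD⟩ := M.exists_abs_level_le hper hC (M.support_subset_boundedConfigs hη) n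
    refine hclosure (forall_mem_range.2 fun c =>
      infEDist_localLevel_le V hC hB hV hb₀ hb (hsub _ hη) n c)
      (csSup_mem_closure (range_nonempty _) ⟨D, ?_⟩)
    exact forall_mem_range.2 fun x => (abs_le.1 (hD x)).2
  · have hη := M.omegaMinus_mem_support
    obtain ⟨D, hD⟩ := M.exists_abs_level_le hper hC (M.support_subset_boundedConfigs hη) n
    refine hclosure (forall_mem_range.2 fun c =>
      infEDist_localLevel_le V hC hB hV hb₀ hb (hsub _ hη) n c)
      (csInf_mem_closure (range_nonempty _) ⟨-D, ?_⟩)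
    exact forall_mem_range.2 fun x => (abs_le.1 (hD x)).1

end
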